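/- Let $k$ be a field, $n\ge 0$, $[n]=\{1,\dots,n\}$, $S=k[x_1,\dots,x_n]$ with the $\mathbb Z^n$-grading $\deg x_i=\varepsilon_i$, and let $E=k\langle e_1,\dots,e_n\rangle$ be the exterior algebra with $\deg e_i=-\varepsilon_i$. Identify $F\subset[n]$ with the corresponding $0/1$-vector, put $F^{\sf c}=[n]\setminus F$, $\mathbf 1=(1,\dots,1)$, $\|a\|=\sum_i a_i$, $\operatorname{supp}_+(a)=\{i: a_i>0\}$ and $\alpha(j,F)=\#\{i\in F: i<j\}$. All modules are $\mathbb Z^n$-graded. A *squarefree $S$-module* is an $\mathbb N^n$-graded $S$-module $M$ with $\dim_k M_a<\infty$ for all $a$ such that multiplication by $x^b$ is a bijection $M_a\to M_{a+b}$ whenever $a,b\in\mathbb N^n$ and $\operatorname{supp}_+(a+b)=\operatorname{supp}_+(a)$. A *squarefree $E$-module* is a finitely generated graded left $E$-module $N$ with $N=\bigoplus_{F\subset[n]}N_{-F}$. Let $\mathbf{Sq}_S$, $\mathbf{Sq}_E$ be the corresponding categories, with degree-preserving maps, and ${}^*\mathbf{mod}_E$ the category of finitely generated graded $E$-modules. $D^b(\mathbf{Sq}_S)$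 and $D^b(\mathbf{Sq}_E)$ are the bounded derived categories, and $D^b_{\mathbf{Sq}_E}({}^*\mathbf{mod}_E)$ is the full subcategory of $D({}^*\mathbf{mod}_E)$ of the complexes whose cohomology is bounded and squarefree. $T^n$ denotes translation, $(T^nK)^i=K^{i+n}$. * $\mathbf A:\mathbf{Sq}_S^{op}\to\mathbf{Sq}_S$ is Alexander duality: $\mathbf A(M)_F=(M_{F^{\sf c}})^*$, with $x_i:\mathbf A(M)_F\to \mathbf A(M)_{F\cup\{i\}}$, $i\notin F$, the transpose of $x_i:M_{F^{\sf c}\setminus\{i\}}\to M_{F^{\sf c}}$; for complexes $\mathbf A(M^\bullet)^i=\mathbf A(M^{-i})$. * $\mathbf D(M^\bullet)$ is the $\mathbb N^n$-graded part of $\operatorname{Hom}_S^\bullet(M^\bullet,\omega^\bullet)$. Here $\omega^\bullet$ is the minimal graded injective resolution of $S(-\mathbf 1)[n]$, that is, $\omega^i=\bigoplus_{|F|=-i}{}^*E(S/P_F)$, where $P_F=(x_l: l\notin F)$ and ${}^*E(S/P_F)$ has the basis $x^a$, $a\in\mathbb Z^n$ with $a_l\le0$ for $l\notin F$; the differential is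 composed of the maps $(-1)^{\alpha(j,F)}\mathrm{nat}:{}^*E(S/P_F)\to{}^*E(S/P_{F\setminus\{j\}})$, $j\in F$. The differential of $\operatorname{Hom}^t$ is $f\mapsto((-1)^tf_{j+1}\delta^j_M+d_\omega f_j)_j$. * $\mathcal S:\mathbf{Sq}_E\to\mathbf{Sq}_S$ is given by $\mathcal S(N)_F=N_{-F}$, with $x_i:\mathcal S(N)_F\to\mathcal S(N)_{F\cup\{i\}}$, $i\notin F$, equal to $z\mapsto(-1)^{\alpha(i,F)}e_iz$. * $\mathcal R(M^\bullet)$ is the complex of $E$-modules with $\mathcal R^i(M^\bullet)=\bigoplus_{i=j+\|a\|}\operatorname{Hom}_k(E(-\mathbf 1),M^j_a)$, $E$-action $(af)(e)=f(ea)$, and differential $f\mapsto[e\mapsto\sum_l x_lf(e_le)]+(-1)^i\,\delta^j\circ f$ for $f\in \operatorname{Hom}_k(E(-\mathbf 1),M^j_a)$. Then $\mathbf A,\mathbf D,\mathcal S,\mathcal R$ preserve quasi-isomorphisms between bounded complexes of squarefree modules, and so induce functors on derived categories. The canonical functor $D^b(\mathbf{Sq}_E)\to D({}^*\mathbf{mod}_E)$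 is fully faithful with essential image $D^b_{\mathbf{Sq}_E}({}^*\mathbf{mod}_E)$. For every $M^\bullet\in D^b(\mathbf{Sq}_S)$ we have $\mathcal R(M^\bullet)\in D^b_{\mathbf{Sq}_E}({}^*\mathbf{mod}_E)\cong D^b(\mathbf{Sq}_E)$. Moreover, with $\mathcal R$ regarded in this way as a functor $D^b(\mathbf{Sq}_S)\to D^b(\mathbf{Sq}_E)$, there is a natural isomorphism of functors $T^n\circ\mathcal S\circ\mathcal R\;\cong\;\mathbf D\circ\mathbf A$ on $D^b(\mathbf{Sq}_S)$. -/

import Mathlib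

open CategoryTheory CategoryTheory.Limits

universe u

noncomputable section

namespace SqBGG

/-! ### `ℤⁿ`-graded modules over a `ℤⁿ`-graded algebra -/

section Graded

variable {k : Type u} [Field k] {n : ℕ} {A : Type u} [Ring A] [Algebra k A]

/-- A `ℤⁿ`-graded left module over a `k`-algebra `A` with homogeneous components `𝒜 a`:
an `A`-module `M` with `M = ⨁ₐ Mₐ` (as a `k`-vector space) and `𝒜 a • M b ⊆ M (a + b)`. -/
structure GrMod (𝒜 : (Fin n → ℤ) → Submodule k A) where
  carrier : Type u
  [addCommGroup : AddCommGroup carrier]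
  [modk : Module k carrier]
  [modA : Module A carrier]
  [tower : IsScalarTower k A carrier]
  deg : (Fin n → ℤ) → Submodule k carrier
  independent : iSupIndep deg
  iSup_deg : ⨆ a, deg a = ⊤
  smul_mem : ∀ {a b : Fin n → ℤ} {s : A} {m : carrier},
    s ∈ 𝒜 a → m ∈ deg b → s • m ∈ deg (a + b)

attribute [instance] GrMod.addCommGroup GrMod.modk GrMod.modA GrMod.tower

variable {𝒜 : (Fin n → ℤ) → Submodule k A}

namespace GrMod

instance : CoeSort (GrMod 𝒜) (Type u) := ⟨carrier⟩

/-- A morphism of graded modules: an `A`-linear map that preserves degrees. -/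
@[ext]
structure Hom (M N : GrMod 𝒜) where
  lin : M →ₗ[A] N
  map_deg : ∀ (a : Fin n → ℤ) (m : M), m ∈ M.deg a → lin m ∈ N.deg a

instance : Category (GrMod 𝒜) where
  Hom M N := Hom M N
  id M := ⟨LinearMap.id, fun _ _ h => h⟩
  comp f g := ⟨g.lin ∘ₗ f.lin, fun a _ h => g.map_deg a _ (f.map_deg a _ h)⟩

@[ext]
lemma hom_ext {M N : GrMod 𝒜} {f g : M ⟶ N} (h : ∀ m, f.lin m = g.lin m) : f = g :=
  Hom.ext (LinearMap.ext h)

@[simp] lemma id_lin (M : GrMod 𝒜) : Hom.lin (𝟙 M) = LinearMap.id := rfl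
@[simp] lemma comp_lin {M N P : GrMod 𝒜} (f : M ⟶ N) (g : N ⟶ P) :
    Hom.lin (f ≫ g) = Hom.lin g ∘ₗ Hom.lin f := rfl

instance {M N : GrMod 𝒜} : Zero (M ⟶ N) := ⟨⟨0, fun _ _ _ => Submodule.zero_mem _⟩⟩
instance {M N : GrMod 𝒜} : Add (M ⟶ N) :=
  ⟨fun f g => ⟨f.lin + g.lin, fun a m h =>
    Submodule.add_mem _ (f.map_deg a m h) (g.map_deg a m h)⟩⟩
instance {M N : GrMod 𝒜} : Neg (M ⟶ N) :=
  ⟨fun f => ⟨-f.lin, fun a m h => Submodule.neg_mem _ (f.map_deg a m h)⟩⟩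

@[simp] lemma zero_lin (M N : GrMod 𝒜) : Hom.lin (0 : M ⟶ N) = 0 := rfl
@[simp] lemma add_lin {M N : GrMod 𝒜} (f g : M ⟶ N) : Hom.lin (f + g) = f.lin + g.lin := rfl
@[simp] lemma neg_lin {M N : GrMod 𝒜} (f : M ⟶ N) : Hom.lin (-f) = -f.lin := rfl

instance {M N : GrMod 𝒜} : AddCommGroup (M ⟶ N) where
  add_assoc f g h := by ext m; simp [add_assoc]
  zero_add f := by ext m; simp
  add_zero f := by ext m; simp
  add_comm f g := by ext m; simp [add_comm]
  neg_add_cancel f := by ext m; simp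
  nsmul := nsmulRec
  zsmul := zsmulRec

instance : Preadditive (GrMod 𝒜) where
  add_comp _ _ _ f g h := by ext m; simp
  comp_add _ _ _ f g h := by ext m; simp

/-- The functor `M ↦ Mₐ` to `k`-vector spaces. -/
def comp (𝒜 : (Fin n → ℤ) → Submodule k A) (a : Fin n → ℤ) : GrMod 𝒜 ⥤ ModuleCat.{u} k where
  obj M := ModuleCat.of k (M.deg a)
  map f := ModuleCat.ofHom ((f.lin.restrictScalars k).restrict (f.map_deg a))

instance (a : Fin n → ℤ) : (comp 𝒜 a).Additive where
  map_add := rfl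

/-- Two `k`-linear maps that agree on homogeneous elements are equal. -/
lemma lin_ext (M : GrMod 𝒜) {V : Type*} [AddCommGroup V] [Module k V] {f g : M →ₗ[k] V}
    (h : ∀ a, ∀ m ∈ M.deg a, f m = g m) : f = g := by
  have : (⊤ : Submodule k M) ≤ LinearMap.eqLocus f g := by
    rw [← M.iSup_deg]
    exact iSup_le fun a m hm => h a m hm
  ext m
  exact this trivial

/-- The linear forms on `M` that factor through `Mₐ`, i.e. the dual vector space `(Mₐ)*`. -/
def dualDeg (M : GrMod 𝒜) (a : Fin n → ℤ) : Submodule k (Module.Dual k M) where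
  carrier := {φ | ∀ b, b ≠ a → ∀ m ∈ M.deg b, φ m = 0}
  add_mem' h1 h2 b hb m hm := by simp [h1 b hb m hm, h2 b hb m hm]
  zero_mem' _ _ _ _ := rfl
  smul_mem' c _ h b hb m hm := by simp [h b hb m hm]

lemma finite_dualDeg (M : GrMod 𝒜) (a : Fin n → ℤ) (h : Module.Finite k (M.deg a)) :
    Module.Finite k (M.dualDeg a) := by
  refine Module.Finite.of_injective
    (((M.deg a).subtype.dualMap) ∘ₗ (M.dualDeg a).subtype) ?_
  intro φ ψ hφψ
  refine Subtype.ext (M.lin_ext fun b m hm => ?_)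
  by_cases hb : b = a
  · subst hb
    exact congrArg (fun f => f ⟨m, hm⟩) hφψ
  · rw [φ.2 b hb m hm, ψ.2 b hb m hm]

section Pieces

variable (X : Type u) [AddCommGroup X] [Module k X] [Module A X] [IsScalarTower k A X]

/-- The `A`-submodule spanned by a family of subspaces `Pₐ` of an `A`-module with
`𝒜 a • P b ⊆ P (a + b)`. -/
def piecesSub (h𝒜 : ⨆ a, 𝒜 a = ⊤) (P : (Fin n → ℤ) → Submodule k X)
    (hs : ∀ (a b : Fin n → ℤ) (s : A) (x : X), s ∈ 𝒜 a → x ∈ P b → s • x ∈ P (a + b)) :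
    Submodule A X where
  __ := (⨆ a, P a : Submodule k X)
  smul_mem' s x hx := by
    have h1 : ∀ s ∈ (⨆ a, 𝒜 a), ∀ x ∈ ⨆ a, P a, s • x ∈ ⨆ a, P a := by
      intro s hs' x hx
      induction hs' using Submodule.iSup_induction' with
      | mem a s hsa =>
        induction hx using Submodule.iSup_induction' with
        | mem b x hxb => exact Submodule.mem_iSup_of_mem _ (hs a b s x hsa hxb)
        | zero => simp
        | add x y _ _ h1 h2 => rw [smul_add]; exact Submodule.add_mem _ h1 h2
      | zero => simp
      | add s t _ _ h1 h2 => rw [add_smul]; exact Submodule.add_mem _ h1 h2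
    exact h1 s (h𝒜 ▸ trivial) x hx

/-- The graded module `⨁ₐ Pₐ` given by an independent family of subspaces `Pₐ` of an
`A`-module with `𝒜 a • P b ⊆ P (a + b)`. -/
def ofPieces (h𝒜 : ⨆ a, 𝒜 a = ⊤) (P : (Fin n → ℤ) → Submodule k X) (hP : iSupIndep P)
    (hs : ∀ (a b : Fin n → ℤ) (s : A) (x : X), s ∈ 𝒜 a → x ∈ P b → s • x ∈ P (a + b)) :
    GrMod 𝒜 where
  carrier := piecesSub X h𝒜 P hs
  deg a := (P a).comap ((Submodule.subtype _).restrictScalars k)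
  independent a := by
    rw [Submodule.disjoint_def]
    intro x h1 h2
    have h3 : (x : X) ∈ ⨆ j, ⨆ _ : j ≠ a, P j := by
      have : (⨆ j, ⨆ _ : j ≠ a, (P j).comap
          ((Submodule.subtype (piecesSub X h𝒜 P hs)).restrictScalars k)) ≤
          (⨆ j, ⨆ _ : j ≠ a, P j).comap
          ((Submodule.subtype (piecesSub X h𝒜 P hs)).restrictScalars k) :=
        iSup₂_le fun j hj => Submodule.comap_mono (le_iSup₂_of_le j hj le_rfl)
      exact this h2
    exact Subtype.ext ((Submodule.disjoint_def.mp (hP a)) x h1 h3)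
  iSup_deg := by
    rw [eq_top_iff]
    rintro ⟨x, hx⟩ -
    refine Submodule.iSup_induction' P (motive := fun x hx =>
      (⟨x, hx⟩ : piecesSub X h𝒜 P hs) ∈ ⨆ a, (P a).comap
          ((Submodule.subtype (piecesSub X h𝒜 P hs)).restrictScalars k)) ?_ ?_ ?_ hx
    · intro a x hx
      exact Submodule.mem_iSup_of_mem a hx
    · exact Submodule.zero_mem _
    · intro x y _ _ h1 h2
      exact Submodule.add_mem _ h1 h2
  smul_mem h1 h2 := hs _ _ _ _ h1 h2

end Pieces

variable {X Y : Type u} [AddCommGroup X] [Module k X] [Module A X] [IsScalarTower k A X]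
  [AddCommGroup Y] [Module k Y] [Module A Y] [IsScalarTower k A Y]
  {h𝒜 : ⨆ a, 𝒜 a = ⊤} {P : (Fin n → ℤ) → Submodule k X} {hP : iSupIndep P}
  {hs : ∀ (a b : Fin n → ℤ) (s : A) (x : X), s ∈ 𝒜 a → x ∈ P b → s • x ∈ P (a + b)}
  {Q : (Fin n → ℤ) → Submodule k Y} {hQ : iSupIndep Q}
  {hs' : ∀ (a b : Fin n → ℤ) (s : A) (x : Y), s ∈ 𝒜 a → x ∈ Q b → s • x ∈ Q (a + b)}

/-- The morphism `⨁ₐ Pₐ ⟶ ⨁ₐ Qₐ` induced by an `A`-linear map `T` with `T(Pₐ) ⊆ Qₐ`. -/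
def ofPiecesMap (T : X →ₗ[A] Y) (hT : ∀ a, ∀ x ∈ P a, T x ∈ Q a) :
    ofPieces X h𝒜 P hP hs ⟶ ofPieces Y h𝒜 Q hQ hs' where
  lin := T.restrict (p := piecesSub X h𝒜 P hs) (q := piecesSub Y h𝒜 Q hs') (fun x hx => by
    have : (⨆ a, P a) ≤ (⨆ a, Q a).comap (T.restrictScalars k) :=
      iSup_le fun a x hx => Submodule.mem_iSup_of_mem a (hT a x hx)
    exact this hx)
  map_deg a x hx := hT a x.1 hx

lemma finite_deg {a : Fin n → ℤ} (h : Module.Finite k (P a)) :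
    Module.Finite k ((ofPieces X h𝒜 P hP hs).deg a) := by
  let j : ((ofPieces X h𝒜 P hP hs).deg a) →ₗ[k] P a :=
    { toFun := fun x => ⟨x.1.1, x.2⟩
      map_add' := fun _ _ => rfl
      map_smul' := fun _ _ => rfl }
  refine Module.Finite.of_injective j fun x y hxy => ?_
  exact Subtype.ext (Subtype.ext (congrArg (fun z : P a => z.1) hxy))

lemma mem_pieces {a : Fin n → ℤ} {x : X} (hx : x ∈ P a) : x ∈ piecesSub X h𝒜 P hs :=
  Submodule.mem_iSup_of_mem a hx

end GrMod
end Graded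

section

lemma iSupIndep_of_eval {k : Type*} [Field k] {ι : Type*} {X : Type*} [AddCommGroup X] [Module k X]
    {I : Type*} {V : I → Type*} [∀ i, AddCommGroup (V i)] [∀ i, Module k (V i)]
    (ev : ∀ i, X →ₗ[k] V i) {P : ι → Submodule k X} (W : ∀ i, ι → Submodule k (V i))
    (hW : ∀ i, iSupIndep (W i)) (hev : ∀ i c x, x ∈ P c → ev i x ∈ W i c)
    (hinj : ∀ x, (∀ i, ev i x = 0) → x = 0) : iSupIndep P := by
  intro c
  rw [Submodule.disjoint_def]
  intro x h1 h2
  refine hinj x fun i => ?_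
  refine Submodule.disjoint_def.mp (hW i c) _ (hev i c x h1) ?_
  have : (⨆ j, ⨆ _ : j ≠ c, P j) ≤ (⨆ j, ⨆ _ : j ≠ c, W i j).comap (ev i) :=
    iSup₂_le fun j hj x hx => Submodule.mem_iSup_of_mem j (Submodule.mem_iSup_of_mem hj (hev i j x hx))
  exact this h2

variable (k : Type u) [Field k] (n : ℕ)

/-- The unit vector `εᵢ ∈ ℤⁿ`. -/
abbrev eps {n : ℕ} (i : Fin n) : Fin n → ℤ := Pi.single i 1

/-- The squarefree vector in `ℤⁿ` with support `F`. -/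
def ind {n : ℕ} (F : Finset (Fin n)) : Fin n → ℤ := fun i => if i ∈ F then 1 else 0

/-- `supp₊ a = {i | aᵢ > 0}`. -/
def supp {n : ℕ} (a : Fin n → ℤ) : Finset (Fin n) := Finset.univ.filter fun i => 0 < a i

/-- `‖a‖ = ∑ᵢ aᵢ`. -/
def tot {n : ℕ} (a : Fin n → ℤ) : ℤ := ∑ i, a i

/-- `α(j, F) = #{i ∈ F | i < j}`. -/
def alpha {n : ℕ} (j : Fin n) (F : Finset (Fin n)) : ℕ := (F.filter fun i => i < j).card

/-- An exponent vector in `ℕⁿ` as an element of `ℤⁿ`. -/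
def toZ {n : ℕ} (b : Fin n →₀ ℕ) : Fin n → ℤ := fun i => (b i : ℤ)

/-- The polynomial ring `S = k[x₁, …, xₙ]`. -/
abbrev S := MvPolynomial (Fin n) k

/-- The `ℤⁿ`-grading of `S` with `deg xᵢ = εᵢ`. -/
def grS : (Fin n → ℤ) → Submodule k (S k n) :=
  MvPolynomial.weightedHomogeneousSubmodule k (fun i : Fin n => eps i)

/-- The exterior algebra `E = ⋀ S₁*` on `e₁, …, eₙ`. -/
abbrev E := ExteriorAlgebra k (Fin n → k)

/-- The generator `eᵢ` of `E`. -/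
def e (i : Fin n) : E k n := ExteriorAlgebra.ι k (Pi.single i 1)

/-- The monomial basis of `E`: `eF F` is the product of the `eᵢ`, `i ∈ F`, in increasing order. -/
def eF : Module.Basis (Finset (Fin n)) k (E k n) := (Pi.basisFun k (Fin n)).ExteriorAlgebra

/-- The `ℤⁿ`-grading of `E` with `deg eᵢ = -εᵢ`. -/
def grE (a : Fin n → ℤ) : Submodule k (E k n) :=
  Submodule.span k {x | ∃ F : Finset (Fin n), a = -ind F ∧ x = eF k n F}

variable {k n}

lemma weight_eps (b : Fin n →₀ ℕ) : Finsupp.weight (fun i : Fin n => eps i) b = toZ b := by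
  ext j
  simp [Finsupp.weight_apply, Finsupp.sum, toZ, Pi.single_apply]
  intro h; simp [h]

lemma monomial_mem_grS (b : Fin n →₀ ℕ) (c : k) : MvPolynomial.monomial b c ∈ grS k n (toZ b) := by
  rw [grS, MvPolynomial.mem_weightedHomogeneousSubmodule]
  exact MvPolynomial.isWeightedHomogeneous_monomial _ _ _ (weight_eps b)

lemma iSup_grS : ⨆ a, grS k n a = ⊤ := by
  rw [eq_top_iff]
  intro p _
  induction p using MvPolynomial.induction_on' with
  | monomial b c => exact Submodule.mem_iSup_of_mem _ (monomial_mem_grS b c)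
  | add p q hp hq => exact Submodule.add_mem _ (hp trivial) (hq trivial)

lemma X_mem_grS (i : Fin n) : (MvPolynomial.X i : S k n) ∈ grS k n (eps i) := by
  rw [grS, MvPolynomial.mem_weightedHomogeneousSubmodule]
  exact MvPolynomial.isWeightedHomogeneous_X _ _ _

lemma toZ_single (i : Fin n) : toZ (Finsupp.single i 1) = eps i := by
  ext j; simp [toZ, Finsupp.single_apply, Pi.single_apply, eq_comm]

lemma toZ_add (b c : Fin n →₀ ℕ) : toZ (b + c) = toZ b + toZ c := by
  ext j; simp [toZ]

lemma iSup_grE : ⨆ a, grE k n a = ⊤ := by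
  rw [eq_top_iff, ← (eF k n).span_eq, Submodule.span_le]
  rintro _ ⟨F, rfl⟩
  exact Submodule.mem_iSup_of_mem (-ind F) (Submodule.subset_span ⟨F, rfl, rfl⟩)

lemma eF_mem (F : Finset (Fin n)) : eF k n F ∈ grE k n (-ind F) :=
  Submodule.subset_span ⟨F, rfl, rfl⟩

lemma ind_union {F G : Finset (Fin n)} (h : Disjoint F G) : ind (F ∪ G) = ind F + ind G := by
  ext i
  have hd : i ∈ F → i ∉ G := fun hi => Finset.disjoint_left.mp h hi
  by_cases h1 : i ∈ F <;> by_cases h2 : i ∈ G <;> simp_all [ind]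

lemma grE_mul {a b : Fin n → ℤ} {s t : E k n} (hs : s ∈ grE k n a) (ht : t ∈ grE k n b) :
    s * t ∈ grE k n (a + b) := by
  induction hs using Submodule.span_induction with
  | zero => simp
  | add s s' _ _ h1 h2 => rw [add_mul]; exact Submodule.add_mem _ h1 h2
  | smul c s _ h => rw [smul_mul_assoc]; exact Submodule.smul_mem _ _ h
  | mem s hs =>
    obtain ⟨F, rfl, rfl⟩ := hs
    induction ht using Submodule.span_induction with
    | zero => simp
    | add s s' _ _ h1 h2 => rw [mul_add]; exact Submodule.add_mem _ h1 h2
    | smul c s _ h => rw [mul_smul_comm]; exact Submodule.smul_mem _ _ h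
    | mem t ht =>
      obtain ⟨G, rfl, rfl⟩ := ht
      let s : Set.powersetCard (Fin n) F.card := ⟨F, rfl⟩
      let t : Set.powersetCard (Fin n) G.card := ⟨G, rfl⟩
      by_cases h : Disjoint F G
      · have := ExteriorAlgebra.basis_mul_of_disjoint (Pi.basisFun k (Fin n)) s t h
        have h2 : eF k n F * eF k n G = _ := this
        rw [h2]
        have h3 : eF k n (F ∪ G) ∈ grE k n (-ind F + -ind G) := by
          rw [← neg_add, ← ind_union h]; exact eF_mem _
        rw [← Finset.disjUnion_eq_union _ _ h] at h3
        rw [Units.smul_def]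
        exact zsmul_mem h3 _
      · have h2 : eF k n F * eF k n G = 0 :=
          ExteriorAlgebra.basis_mul_of_not_disjoint (Pi.basisFun k (Fin n)) s t h
        rw [h2]; exact Submodule.zero_mem _

lemma e_mem (i : Fin n) : e k n i ∈ grE k n (-eps i) := by
  have : e k n i = eF k n {i} := by
    rw [eF, ExteriorAlgebra.basis_apply_ofCard (n := 1) _ (by simp)]
    simp [ExteriorAlgebra.ιMulti_family, e, ExteriorAlgebra.ιMulti_apply,
      Set.powersetCard.ofFinEmbEquiv_symm_apply]
  rw [this]
  convert eF_mem {i} using 2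
  ext j; simp [ind, Pi.single_apply]

end

section

section Derived

variable {k : Type u} [Field k] {n : ℕ} {A : Type u} [Ring A] [Algebra k A]
  {𝒜 : (Fin n → ℤ) → Submodule k A} (P : ObjectProperty (GrMod 𝒜))

/-- Cochain complexes in a full subcategory `P` of the category of graded modules. -/
abbrev Com := CochainComplex P.FullSubcategory ℤ

/-- The complex of `k`-vector spaces formed by the degree `a` components. -/
abbrev compCom (a : Fin n → ℤ) : Com P ⥤ CochainComplex (ModuleCat.{u} k) ℤ :=
  (P.ι ⋙ GrMod.comp 𝒜 a).mapHomologicalComplex _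

/-- Quasi-isomorphisms of complexes of graded modules: the induced map on `Hⁱ(-)ₐ = Hⁱ((-)ₐ)` is
bijective for all `i ∈ ℤ` and all `a ∈ ℤⁿ`. -/
def qis : MorphismProperty (Com P) := fun _ _ f => ∀ a, QuasiIso ((compCom P a).map f)

/-- The property of being a bounded complex. -/
def isBounded : ObjectProperty (Com P) := fun K =>
  ∃ l m : ℤ, K.IsStrictlyGE l ∧ K.IsStrictlyLE m

/-- The category `Comᵇ` of bounded complexes. -/
abbrev ComB := (isBounded P).FullSubcategory

/-- The quasi-isomorphisms between bounded complexes. -/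
def qisB : MorphismProperty (ComB P) := (qis P).inverseImage (isBounded P).ι

/-- The derived category: all complexes, with quasi-isomorphisms inverted. -/
abbrev Der := (qis P).Localization

/-- The bounded derived category: bounded complexes, with quasi-isomorphisms inverted. -/
abbrev DerB := (qisB P).Localization

end Derived

end

section

variable {k : Type u} [Field k] {n : ℕ}


/-! ### Squarefree modules -/

/-- Squarefree `S`-modules: `M` is `ℕⁿ`-graded with finite dimensional components, and
`x^b : M_a → M_{a+b}` is bijective whenever `a, b ∈ ℕⁿ` and `supp₊ (a + b) = supp₊ a`. -/
structure IsSqS (M : GrMod (grS k n)) : Prop where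
  nonneg : ∀ a, ¬ 0 ≤ a → M.deg a = ⊥
  finite : ∀ a, Module.Finite k (M.deg a)
  bij : ∀ a b : Fin n →₀ ℕ, supp (toZ a + toZ b) = supp (toZ a) →
    Set.BijOn (fun y : M => (MvPolynomial.monomial b (1 : k) : S k n) • y)
      (M.deg (toZ a)) (M.deg (toZ a + toZ b))

/-- Finitely generated graded `E`-modules. -/
def IsFgE (N : GrMod (grE k n)) : Prop := Module.Finite (E k n) N

/-- Squarefree `E`-modules: finitely generated, and `N = ⨁_F N_{-F}`. -/
def IsSqE (N : GrMod (grE k n)) : Prop :=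
  Module.Finite (E k n) N ∧ ∀ a, (∀ F : Finset (Fin n), a ≠ -ind F) → N.deg a = ⊥

variable (k n) in
/-- The category of squarefree `S`-modules. -/
abbrev SqS := ObjectProperty.FullSubcategory (IsSqS : ObjectProperty (GrMod (grS k n)))

variable (k n) in
/-- The category of squarefree `E`-modules. -/
abbrev SqE := ObjectProperty.FullSubcategory (IsSqE : ObjectProperty (GrMod (grE k n)))

variable (k n) in
/-- The category of finitely generated `ℤⁿ`-graded `E`-modules. -/
abbrev ModE := ObjectProperty.FullSubcategory (IsFgE : ObjectProperty (GrMod (grE k n)))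

/-! ### Modules over the polynomial ring from commuting operators -/

/-- The action of `S` given by pairwise commuting operators. -/
def polyAct {V : Type*} [AddCommGroup V] [Module k V] (x : Fin n → Module.End k V)
    (h : ∀ l m, x l * x m = x m * x l) : S k n →ₐ[k] Module.End k V :=
  letI : CommRing (Algebra.adjoin k (Set.range x)) :=
    { (inferInstance : Ring (Algebra.adjoin k (Set.range x))) with
      mul_comm := (Algebra.isMulCommutative_adjoin k (by
        rintro _ ⟨l, rfl⟩ _ ⟨m, rfl⟩; exact h l m)).is_comm.comm }
  (Algebra.adjoin k (Set.range x)).val.comp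
    (MvPolynomial.aeval fun l => ⟨x l, Algebra.subset_adjoin ⟨l, rfl⟩⟩)

lemma polyAct_X {V : Type*} [AddCommGroup V] [Module k V] (x : Fin n → Module.End k V)
    (h : ∀ l m, x l * x m = x m * x l) (l : Fin n) :
    polyAct x h (MvPolynomial.X l) = x l := by
  simp [polyAct]

lemma monomial_smul_induction {X : Type*} [AddCommGroup X] [Module (S k n) X]
    (Q : (Fin n → ℤ) → X → Prop)
    (hQ : ∀ l a x, Q a x → Q (a + eps l) ((MvPolynomial.X l : S k n) • x))
    (b : Fin n →₀ ℕ) : ∀ a x, Q a x → Q (a + toZ b) ((MvPolynomial.monomial b (1 : k)) • x) := by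
  induction b using Finsupp.induction_linear with
  | zero =>
    intro a x h
    have : toZ (0 : Fin n →₀ ℕ) = 0 := by ext; simp [toZ]
    rw [this, add_zero]
    change Q a ((1 : S k n) • x)
    rwa [one_smul]
  | add b c hb hc =>
    intro a x h
    have : MvPolynomial.monomial (b + c) (1 : k) =
      MvPolynomial.monomial c (1 : k) * MvPolynomial.monomial b (1 : k) := by
      rw [MvPolynomial.monomial_mul, add_comm, one_mul]
    rw [this, mul_smul, toZ_add, ← add_assoc]
    exact hc _ _ (hb _ _ h)
  | single l m =>
    induction m with
    | zero =>
      intro a x h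
      have : toZ (0 : Fin n →₀ ℕ) = 0 := by ext; simp [toZ]
      rw [Finsupp.single_zero, this, add_zero]
      change Q a ((1 : S k n) • x)
      rwa [one_smul]
    | succ m ih =>
      intro a x h
      have : MvPolynomial.monomial (Finsupp.single l (m + 1)) (1 : k) =
        MvPolynomial.X l * MvPolynomial.monomial (Finsupp.single l m) (1 : k) := by
        rw [MvPolynomial.X, MvPolynomial.monomial_mul, one_mul, ← Finsupp.single_add, add_comm]
      rw [this, mul_smul, Finsupp.single_add, toZ_add, toZ_single, ← add_assoc]
      exact hQ _ _ _ (ih _ _ h)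

lemma smul_mem_of_X {X : Type*} [AddCommGroup X] [Module k X] [Module (S k n) X]
    [IsScalarTower k (S k n) X] (P : (Fin n → ℤ) → Submodule k X)
    (h : ∀ l a x, x ∈ P a → (MvPolynomial.X l : S k n) • x ∈ P (a + eps l)) :
    ∀ (a b : Fin n → ℤ) (s : S k n) (x : X), s ∈ grS k n a → x ∈ P b → s • x ∈ P (a + b) := by
  intro a b s x hs hx
  rw [grS, MvPolynomial.mem_weightedHomogeneousSubmodule] at hs
  rw [s.as_sum, Finset.sum_smul]
  refine Submodule.sum_mem _ fun d hd => ?_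
  have h1 := hs (MvPolynomial.mem_support_iff.mp hd)
  rw [weight_eps] at h1
  have : MvPolynomial.monomial d (s.coeff d) = s.coeff d • MvPolynomial.monomial d (1 : k) := by
    rw [MvPolynomial.smul_monomial, smul_eq_mul, mul_one]
  rw [this, smul_assoc, add_comm, ← h1]
  exact Submodule.smul_mem _ _ (monomial_smul_induction (fun a x => x ∈ P a) h d b x hx)

lemma isLinear_of_X {X Y : Type*} [AddCommGroup X] [Module k X] [Module (S k n) X]
    [IsScalarTower k (S k n) X] [AddCommGroup Y] [Module k Y] [Module (S k n) Y]
    [IsScalarTower k (S k n) Y] (f : X →ₗ[k] Y)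
    (h : ∀ l x, f ((MvPolynomial.X l : S k n) • x) = (MvPolynomial.X l : S k n) • f x)
    (s : S k n) : ∀ x, f (s • x) = s • f x := by
  induction s using MvPolynomial.induction_on with
  | C c =>
    intro x
    have : (MvPolynomial.C c : S k n) = algebraMap k _ c := rfl
    rw [this, algebraMap_smul, algebraMap_smul, map_smul]
  | add p q hp hq => intro x; rw [add_smul, add_smul, map_add, hp, hq]
  | mul_X p l hp => intro x; rw [mul_smul, mul_smul, hp, h]

/-! ### Squarefree modules from representations of the Boolean lattice -/

lemma supp_add_eps_zero {a : Fin n → ℤ} {l : Fin n} (h : a l = 0) :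
    supp (a + eps l) = insert l (supp a) := by
  ext m
  by_cases hm : m = l
  · subst hm; simp [supp, h]
  · simp [supp, hm, Pi.single_apply]

lemma supp_add_eps_ne {a : Fin n → ℤ} {l : Fin n} (h : a l ≠ 0) :
    supp (a + eps l) = supp a := by
  ext m
  by_cases hm : m = l
  · subst hm; simp [supp]; omega
  · simp [supp, hm, Pi.single_apply]

lemma notMem_supp {a : Fin n → ℤ} {l : Fin n} (h : a l = 0) : l ∉ supp a := by
  simp [supp, h]

variable (k n) in
/-- A representation of the Boolean lattice `2^[n]`, with vector spaces `U F` realized as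
subspaces of a common vector space `V`, and transition maps `t l F : U F → U (F ∪ {l})`. -/
structure BoolRep where
  V : Type u
  [addCommGroup : AddCommGroup V]
  [mod : Module k V]
  t : Fin n → Finset (Fin n) → V →ₗ[k] V
  comm : ∀ F l m v, l ≠ m → l ∉ F → m ∉ F → t m (insert l F) (t l F v) = t l (insert m F) (t m F v)
  U : Finset (Fin n) → Submodule k V
  mapU : ∀ F l v, l ∉ F → v ∈ U F → t l F v ∈ U (insert l F)
  fin : ∀ F, Module.Finite k (U F)

namespace BoolRep

attribute [instance] BoolRep.addCommGroup BoolRep.mod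

variable (ρ : BoolRep k n)

/-- The ambient `S`-module `⨁_{a ∈ ℤⁿ} V`. -/
def Amb : Type u := (Fin n → ℤ) →₀ ρ.V

instance : AddCommGroup ρ.Amb := inferInstanceAs (AddCommGroup ((Fin n → ℤ) →₀ ρ.V))
instance : Module k ρ.Amb := inferInstanceAs (Module k ((Fin n → ℤ) →₀ ρ.V))

/-- The element `v` in degree `a`. -/
def inc (a : Fin n → ℤ) : ρ.V →ₗ[k] ρ.Amb := Finsupp.lsingle a

lemma amb_ext {W : Type*} [AddCommGroup W] [Module k W] {f g : ρ.Amb →ₗ[k] W}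
    (h : ∀ a v, f (ρ.inc a v) = g (ρ.inc a v)) : f = g := Finsupp.lhom_ext h

/-- The linear map on the ambient module with prescribed values in each degree. -/
def ambLift {W : Type*} [AddCommGroup W] [Module k W] (f : (Fin n → ℤ) → ρ.V →ₗ[k] W) :
    ρ.Amb →ₗ[k] W := Finsupp.lsum k f

lemma ambLift_inc {W : Type*} [AddCommGroup W] [Module k W] (f : (Fin n → ℤ) → ρ.V →ₗ[k] W) (a v) :
    ρ.ambLift f (ρ.inc a v) = f a v := Finsupp.lsum_single _ _ _ _

/-- The operator `x_l` on `⨁_{a ∈ ℤⁿ} V`: it is `t l (supp₊ a)` on the summand of degree `a` if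
`a_l = 0`, and the identity otherwise. -/
def op (l : Fin n) : Module.End k ρ.Amb :=
  ρ.ambLift fun a => ρ.inc (a + eps l) ∘ₗ
    (if a l = 0 then ρ.t l (supp a) else LinearMap.id)

lemma op_single_zero {l : Fin n} {a : Fin n → ℤ} (h : a l = 0) (v : ρ.V) :
    ρ.op l (ρ.inc a v) = ρ.inc (a + eps l) (ρ.t l (supp a) v) := by
  simp [op, ambLift_inc, h]

lemma op_single_ne {l : Fin n} {a : Fin n → ℤ} (h : a l ≠ 0) (v : ρ.V) :
    ρ.op l (ρ.inc a v) = ρ.inc (a + eps l) v := by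
  simp [op, ambLift_inc, h]

lemma op_comm (l m : Fin n) : ρ.op l * ρ.op m = ρ.op m * ρ.op l := by
  by_cases hlm : l = m
  · rw [hlm]
  refine ρ.amb_ext fun a v => ?_
  have h1 : (a + eps m) l = a l := by simp [hlm]
  have h2 : (a + eps l) m = a m := by simp [Ne.symm hlm]
  simp only [Module.End.mul_apply]
  by_cases hl : a l = 0 <;> by_cases hm : a m = 0
  · rw [op_single_zero _ hl, op_single_zero _ hm, op_single_zero _ (h1.trans hl),
      op_single_zero _ (h2.trans hm), supp_add_eps_zero hl, supp_add_eps_zero hm,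
      ρ.comm _ _ _ _ hlm (notMem_supp hl) (notMem_supp hm), add_right_comm]
  · rw [op_single_zero _ hl, op_single_ne _ hm, op_single_zero _ (h1.trans hl),
      op_single_ne _ (by rwa [h2]), supp_add_eps_ne hm, add_right_comm]
  · rw [op_single_ne _ hl, op_single_zero _ hm, op_single_ne _ (by rwa [h1]),
      op_single_zero _ (h2.trans hm), supp_add_eps_ne hl, add_right_comm]
  · rw [op_single_ne _ hl, op_single_ne _ hm, op_single_ne _ (by rwa [h1]),
      op_single_ne _ (by rwa [h2]), add_right_comm]

instance : Module (S k n) ρ.Amb :=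
  Module.compHom ρ.Amb (polyAct ρ.op ρ.op_comm).toRingHom
instance : IsScalarTower k (S k n) ρ.Amb where
  smul_assoc c s x := by
    change polyAct ρ.op ρ.op_comm (c • s) x = c • polyAct ρ.op ρ.op_comm s x
    rw [map_smul]; rfl

lemma X_smul (l : Fin n) (x : ρ.Amb) : (MvPolynomial.X l : S k n) • x = ρ.op l x := by
  change polyAct ρ.op ρ.op_comm (MvPolynomial.X l) x = _
  rw [polyAct_X]

lemma inc_inj {a : Fin n → ℤ} {v w : ρ.V} (h : ρ.inc a v = ρ.inc a w) : v = w :=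
  Finsupp.single_injective a h

open Classical in
/-- The component of degree `a`: it is `U (supp₊ a)` if `a ∈ ℕⁿ`, and zero otherwise. -/
def piece (a : Fin n → ℤ) : Submodule k ρ.Amb :=
  if 0 ≤ a then (ρ.U (supp a)).map (ρ.inc a) else ⊥

variable {ρ}

lemma mem_piece {a : Fin n → ℤ} {x : ρ.Amb} :
    x ∈ ρ.piece a ↔ ∃ v ∈ ρ.U (supp a), ρ.inc a v = x ∧ (0 ≤ a ∨ v = 0) := by
  by_cases h : 0 ≤ a
  · simp [piece, h]
  · simp only [piece, h, if_false, Submodule.mem_bot, false_or]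
    constructor
    · rintro rfl; exact ⟨0, Submodule.zero_mem _, map_zero _, rfl⟩
    · rintro ⟨v, _, rfl, rfl⟩; exact map_zero _

variable (ρ)

lemma piece_X (l : Fin n) (a : Fin n → ℤ) (x : ρ.Amb) (hx : x ∈ ρ.piece a) :
    (MvPolynomial.X l : S k n) • x ∈ ρ.piece (a + eps l) := by
  obtain ⟨v, hv, rfl, h⟩ := mem_piece.mp hx
  have h0 : 0 ≤ a → 0 ≤ a + eps l := fun h i => by
    have := h i
    by_cases hi : i = l
    · subst hi; simp at this ⊢; omega
    · simpa [Pi.single_apply, hi] using this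
  rw [X_smul, mem_piece]
  by_cases ha : a l = 0
  · refine ⟨ρ.t l (supp a) v, ?_, (ρ.op_single_zero ha v).symm, h.imp h0 fun h => by rw [h, map_zero]⟩
    rw [supp_add_eps_zero ha]
    exact ρ.mapU _ _ _ (notMem_supp ha) hv
  · refine ⟨v, ?_, (ρ.op_single_ne ha v).symm, h.imp_left h0⟩
    rwa [supp_add_eps_ne ha]

lemma piece_indep : iSupIndep ρ.piece := by
  refine iSupIndep_of_eval (I := Fin n → ℤ) (V := fun _ => ρ.V)
    (fun b => (Finsupp.lapply b : ((Fin n → ℤ) →₀ ρ.V) →ₗ[k] ρ.V))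
    (fun b a => if a = b then ⊤ else ⊥) ?_ ?_ ?_
  · intro b a
    rw [Submodule.disjoint_def]
    intro x hx hx'
    by_cases h : a = b
    · have : (⨆ j, ⨆ _ : j ≠ a, if j = b then (⊤ : Submodule k ρ.V) else ⊥) = ⊥ := by
        simp only [iSup_eq_bot]
        intro j hj
        rw [if_neg (by rwa [← h])]
      simpa [this] using hx'
    · simpa [h] using hx
  · rintro b a x hx
    obtain ⟨v, -, rfl, -⟩ := mem_piece.mp hx
    by_cases h : a = b
    · simp [h]
    · simp only [h, if_false, Submodule.mem_bot]
      exact Finsupp.single_eq_of_ne (Ne.symm h)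
  · intro x h
    exact Finsupp.ext h

lemma monomial_smul_inc (b : Fin n →₀ ℕ) (a : Fin n → ℤ) (v : ρ.V)
    (h : ∀ l, b l ≠ 0 → 0 < a l) :
    (MvPolynomial.monomial b (1 : k) : S k n) • ρ.inc a v = ρ.inc (a + toZ b) v := by
  induction b using Finsupp.induction_linear generalizing a with
  | zero =>
    have : toZ (0 : Fin n →₀ ℕ) = 0 := by ext; simp [toZ]
    rw [this, add_zero]
    exact one_smul (S k n) _
  | add b c hb hc =>
    have : MvPolynomial.monomial (b + c) (1 : k) =
      MvPolynomial.monomial c (1 : k) * MvPolynomial.monomial b (1 : k) := by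
      rw [MvPolynomial.monomial_mul, add_comm, one_mul]
    rw [this, mul_smul, toZ_add, ← add_assoc, hb, hc]
    · intro l hl
      have := h l (by simp [hl])
      simp [toZ]; omega
    · intro l hl
      exact h l (by simp [hl])
  | single l m =>
    induction m with
    | zero =>
      have : toZ (0 : Fin n →₀ ℕ) = 0 := by ext; simp [toZ]
      rw [Finsupp.single_zero, this, add_zero]
      exact one_smul (S k n) _
    | succ m ih =>
      have h1 : MvPolynomial.monomial (Finsupp.single l (m + 1)) (1 : k) =
        MvPolynomial.X l * MvPolynomial.monomial (Finsupp.single l m) (1 : k) := by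
        rw [MvPolynomial.X, MvPolynomial.monomial_mul, one_mul, ← Finsupp.single_add, add_comm]
      have hl : 0 < a l := h l (by simp)
      rw [h1, mul_smul, ih, X_smul, Finsupp.single_add, toZ_add, toZ_single, ← add_assoc]
      · exact ρ.op_single_ne (by simp [toZ]; omega) v
      · intro l' hl'
        apply h
        simp only [Finsupp.single_apply] at hl' ⊢
        split_ifs at hl' ⊢
        · omega
        · exact hl'

/-- The squarefree module of a representation of the Boolean lattice: `M_F = U F` for
`F ⊆ [n]`, and `x_l : M_F → M_{F ∪ {l}}` is `t l F` for `l ∉ F`. -/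
def toSq : SqS k n where
  obj := GrMod.ofPieces ρ.Amb iSup_grS ρ.piece ρ.piece_indep (smul_mem_of_X ρ.piece ρ.piece_X)
  property := by
    refine ⟨fun a ha => ?_, fun a => ?_, fun a b hab => ?_⟩
    · rw [eq_bot_iff]
      rintro x (hx : x.1 ∈ ρ.piece a)
      rw [piece, if_neg ha, Submodule.mem_bot] at hx
      exact Subtype.ext hx
    · refine GrMod.finite_deg ?_
      by_cases h : 0 ≤ a
      · have := ρ.fin (supp a)
        rw [piece, if_pos h]
        infer_instance
      · rw [piece, if_neg h]
        infer_instance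
    · have hb : ∀ l, b l ≠ 0 → 0 < toZ a l := by
        intro l hl
        have : l ∈ supp (toZ a + toZ b) := by
          rw [supp, Finset.mem_filter]
          refine ⟨Finset.mem_univ _, ?_⟩
          simp only [toZ, Pi.add_apply]
          omega
        rw [hab] at this
        simpa [supp] using this
      refine ⟨fun x hx => GrMod.smul_mem _ (by simpa using monomial_mem_grS b 1) hx |> fun h => by
        rwa [add_comm] at h, ?_, ?_⟩
      · rintro x (hx : x.1 ∈ ρ.piece _) y (hy : y.1 ∈ ρ.piece _) hxy
        obtain ⟨v, -, hv, -⟩ := mem_piece.mp hx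
        obtain ⟨w, -, hw, -⟩ := mem_piece.mp hy
        have h2 : (MvPolynomial.monomial b (1 : k) : S k n) • x.1 =
          (MvPolynomial.monomial b (1 : k) : S k n) • y.1 := congrArg Subtype.val hxy
        rw [← hv, ← hw, monomial_smul_inc _ _ _ _ hb, monomial_smul_inc _ _ _ _ hb] at h2
        exact Subtype.ext (by rw [← hv, ← hw, ρ.inc_inj h2])
      · rintro y (hy : y.1 ∈ ρ.piece _)
        obtain ⟨w, hw, hw', -⟩ := mem_piece.mp hy
        rw [hab] at hw
        have h3 : ρ.inc (toZ a) w ∈ ρ.piece (toZ a) :=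
          mem_piece.mpr ⟨w, hw, rfl, Or.inl fun i => by simp [toZ]⟩
        refine ⟨⟨ρ.inc (toZ a) w, GrMod.mem_pieces h3⟩, h3, Subtype.ext ?_⟩
        rw [← hw']
        exact monomial_smul_inc _ _ _ _ hb

variable {ρ} {σ τ : BoolRep k n}

/-- The `k`-linear map of ambient modules induced by a linear map. -/
def mapAmb (T : ρ.V →ₗ[k] σ.V) : ρ.Amb →ₗ[k] σ.Amb := ρ.ambLift fun a => σ.inc a ∘ₗ T

lemma mapAmb_inc (T : ρ.V →ₗ[k] σ.V) (a v) :
    mapAmb T (ρ.inc a v) = σ.inc a (T v) := by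
  simp [mapAmb, ambLift_inc]

/-- The morphism of squarefree modules induced by a morphism of representations. -/
def mapSq (T : ρ.V →ₗ[k] σ.V) (ht : ∀ l F v, T (ρ.t l F v) = σ.t l F (T v))
    (hU : ∀ F v, v ∈ ρ.U F → T v ∈ σ.U F) : ρ.toSq ⟶ σ.toSq :=
  ObjectProperty.homMk (GrMod.ofPiecesMap (P := ρ.piece) (Q := σ.piece)
    (hP := ρ.piece_indep) (hQ := σ.piece_indep)
    { mapAmb T with
      map_smul' := isLinear_of_X (mapAmb T) (fun l x => by
          rw [X_smul, X_smul]
          change (mapAmb T ∘ₗ ρ.op l) x = (σ.op l ∘ₗ mapAmb T) x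
          congr 1
          refine ρ.amb_ext fun a v => ?_
          by_cases h : a l = 0
          · simp [op_single_zero _ h, ht, mapAmb_inc]
          · simp [op_single_ne _ h, mapAmb_inc]) }
    (fun a x hx => by
      obtain ⟨v, hv, rfl, h⟩ := mem_piece.mp hx
      exact mem_piece.mpr ⟨T v, hU _ _ hv, (mapAmb_inc T a v).symm,
        h.imp_right fun h => by rw [h, map_zero]⟩))


end BoolRep

end

section

section Aux
variable {k : Type u} [Field k] {n : ℕ} {A : Type u} [Ring A] [Algebra k A]
  {𝒜 : (Fin n → ℤ) → Submodule k A} {P : ObjectProperty (GrMod 𝒜)}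

lemma d_d (K : Com P) (i j l : ℤ) (x : (K.X i).obj) :
    (K.d j l).hom.lin ((K.d i j).hom.lin x) = 0 := by
  have := congrArg (fun g => g.hom.lin x) (K.d_comp_d i j l)
  exact this

lemma f_d {K L : Com P} (f : K ⟶ L) (i j : ℤ) (x : (K.X i).obj) :
    (f.f j).hom.lin ((K.d i j).hom.lin x) = (L.d i j).hom.lin ((f.f i).hom.lin x) := by
  have := congrArg (fun g => g.hom.lin x) (f.comm i j)
  exact this.symm

lemma isZero_iff {X : P.FullSubcategory} : IsZero X ↔ ∀ x : X.obj, x = 0 := by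
  rw [IsZero.iff_id_eq_zero]
  constructor
  · intro h x
    exact congrArg (fun g => g.hom.lin x) h
  · intro h
    refine ObjectProperty.hom_ext _ (GrMod.hom_ext fun x => ?_)
    rw [h x, map_zero, map_zero]

lemma isBounded_iff (K : Com P) :
    isBounded P K ↔ ∃ N : ℤ, ∀ i, N < |i| → ∀ x : (K.X i).obj, x = 0 := by
  simp only [isBounded, CochainComplex.isStrictlyGE_iff, CochainComplex.isStrictlyLE_iff,
    isZero_iff]
  constructor
  · rintro ⟨l, m, h1, h2⟩
    refine ⟨max |l| |m|, fun i hi => ?_⟩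
    rcases lt_max_iff.mp (show max |l| |m| < max i (-i) from hi) with h | h
    · exact h2 i (by have := le_max_right |l| |m|; have := le_abs_self m; omega)
    · exact h1 i (by have := le_max_left |l| |m|; have := neg_abs_le l; omega)
  · rintro ⟨N, h⟩
    refine ⟨-N, N, fun i hi => h i ?_, fun i hi => h i ?_⟩
    · have := neg_le_abs i; omega
    · have := le_abs_self i; omega

end Aux

end

section

variable {k : Type u} [Field k] {n : ℕ}


/-! ### The Alexander duality functor `A` -/

/-- Multiplication by `x_l` as a `k`-linear map. -/
def mulX (M : GrMod (grS k n)) (l : Fin n) : M →ₗ[k] M :=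
  (LinearMap.lsmul (S k n) M (MvPolynomial.X l)).restrictScalars k

lemma mulX_apply (M : GrMod (grS k n)) (l : Fin n) (m : M) :
    mulX M l m = (MvPolynomial.X l : S k n) • m := rfl

lemma X_smul_mem (M : GrMod (grS k n)) (l : Fin n) {a : Fin n → ℤ} {m : M} (hm : m ∈ M.deg a) :
    (MvPolynomial.X l : S k n) • m ∈ M.deg (a + eps l) := by
  rw [add_comm]; exact M.smul_mem (X_mem_grS l) hm

lemma ind_compl_insert {F : Finset (Fin n)} {l : Fin n} (h : l ∉ F) :
    ind (insert l F)ᶜ + eps l = ind Fᶜ := by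
  ext m
  by_cases hm : m = l
  · subst hm; simp [ind, h]
  · simp [ind, hm]

/-- The representation `F ↦ (M_{Fᶜ})*` of the Boolean lattice; the transition map for
`F ⊆ F ∪ {l}` is the transpose of `x_l : M_{(F ∪ {l})ᶜ} → M_{Fᶜ}`. -/
def alexRep (M : SqS k n) : BoolRep k n where
  V := Module.Dual k M.obj
  t l _ := (mulX M.obj l).dualMap
  comm F l m φ _ _ _ := by
    ext x
    simp [mulX_apply, smul_smul, mul_comm]
  U F := M.obj.dualDeg (ind Fᶜ)
  mapU F l φ hl hφ b hb m hm := by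
    refine hφ (b + eps l) (fun h => hb ?_) _ (X_smul_mem _ l hm)
    rwa [← ind_compl_insert hl, add_left_inj] at h
  fin F := M.obj.finite_dualDeg _ (M.property.finite _)

/-- The transpose of a morphism of squarefree modules. -/
def alexMap {M N : SqS k n} (f : M ⟶ N) : (alexRep N).toSq ⟶ (alexRep M).toSq :=
  BoolRep.mapSq (ρ := alexRep N) (σ := alexRep M) (f.hom.lin.restrictScalars k).dualMap
    (fun l _ (φ : Module.Dual k N.obj) => LinearMap.ext fun m =>
      (congrArg φ (map_smul f.hom.lin (MvPolynomial.X l : S k n) m)).symm)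
    (fun _ _ hφ b hb m hm => hφ b hb _ (f.hom.map_deg b m hm))

lemma toSq_hom_ext {ρ σ : BoolRep k n} {f g : ρ.toSq ⟶ σ.toSq}
    (h : ∀ x : ρ.toSq.obj, (f.hom.lin x).1 = (g.hom.lin x).1) : f = g :=
  ObjectProperty.hom_ext _ (GrMod.hom_ext fun x => Subtype.ext (h x))

lemma mapAmb_id (ρ : BoolRep k n) (T : ρ.V →ₗ[k] ρ.V) (h : T = LinearMap.id) :
    BoolRep.mapAmb T = LinearMap.id := by
  subst h
  exact ρ.amb_ext fun a v => by simp [BoolRep.mapAmb_inc]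

lemma mapAmb_comp {ρ σ τ : BoolRep k n} (T : ρ.V →ₗ[k] σ.V) (T' : σ.V →ₗ[k] τ.V)
    (T'' : ρ.V →ₗ[k] τ.V) (h : T'' = T' ∘ₗ T) (x : ρ.Amb) :
    BoolRep.mapAmb T'' x = BoolRep.mapAmb T' (BoolRep.mapAmb T x) := by
  subst h
  have : BoolRep.mapAmb (T' ∘ₗ T) = BoolRep.mapAmb T' ∘ₗ BoolRep.mapAmb T :=
    ρ.amb_ext fun a v => by simp [BoolRep.mapAmb_inc]
  rw [this]; rfl

lemma mapAmb_zero {ρ σ : BoolRep k n} (T : ρ.V →ₗ[k] σ.V) (h : T = 0) (x : ρ.Amb) :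
    BoolRep.mapAmb T x = 0 := by
  subst h
  have : BoolRep.mapAmb (0 : ρ.V →ₗ[k] σ.V) = 0 :=
    ρ.amb_ext fun a v => by simp [BoolRep.mapAmb_inc]
  rw [this]; rfl

variable (k n) in
/-- The Alexander duality functor `A` on squarefree modules: `A(M)_F = (M_{Fᶜ})*`, and
`x_l : A(M)_F → A(M)_{F ∪ {l}}` is the transpose of `x_l : M_{Fᶜ ∖ {l}} → M_{Fᶜ}`. -/
def alex : (SqS k n)ᵒᵖ ⥤ SqS k n where
  obj M := (alexRep M.unop).toSq
  map f := alexMap f.unop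
  map_id M := toSq_hom_ext fun x =>
    congrArg (fun g => g x.1) (mapAmb_id (alexRep M.unop) _ rfl)
  map_comp f g := toSq_hom_ext fun x => by
    change BoolRep.mapAmb _ x.1 = BoolRep.mapAmb _ (BoolRep.mapAmb _ x.1)
    apply mapAmb_comp
    rfl

lemma alex_map_zero {M N : SqS k n} : (alex k n).map (0 : M ⟶ N).op = 0 :=
  toSq_hom_ext fun x => by
    change BoolRep.mapAmb _ x.1 = 0
    apply mapAmb_zero
    exact LinearMap.ext fun φ => LinearMap.ext fun m => map_zero φ

/-- The complex `A(M)`, with `A(M)ⁱ = A(M⁻ⁱ)`. -/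
def alexObj (M : ComB (IsSqS (k := k) (n := n))) : Com (IsSqS (k := k) (n := n)) where
  X i := (alex k n).obj (Opposite.op (M.obj.X (-i)))
  d i j := (alex k n).map (M.obj.d (-j) (-i)).op
  shape i j h := by
    rw [M.obj.shape, alex_map_zero]
    simp only [ComplexShape.up_Rel] at h ⊢
    omega
  d_comp_d' i j l _ _ := by
    rw [← Functor.map_comp, ← op_comp, M.obj.d_comp_d, alex_map_zero]

lemma isZero_toSq {ρ : BoolRep k n} (h : ∀ v : ρ.V, v = 0) (x : ρ.toSq.obj) : x = 0 :=
  Subtype.ext (Finsupp.ext fun _ => h _)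

variable (k n) in
/-- The functor `A` on bounded complexes of squarefree modules. -/
def alexCom : (ComB (IsSqS (k := k) (n := n)))ᵒᵖ ⥤ ComB (IsSqS (k := k) (n := n)) where
  obj M := ⟨alexObj M.unop, by
    obtain ⟨N, hN⟩ := (isBounded_iff _).mp M.unop.property
    refine (isBounded_iff _).mpr ⟨N, fun i hi => isZero_toSq fun (φ : Module.Dual k _) =>
      LinearMap.ext fun m => ?_⟩
    rw [hN (-i) (by rwa [abs_neg]) m]
    exact map_zero φ⟩
  map f := ObjectProperty.homMk
    { f := fun i => (alex k n).map (f.unop.hom.f (-i)).op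
      comm' := fun i j _ => by
        change (alex k n).map _ ≫ (alex k n).map _ = (alex k n).map _ ≫ (alex k n).map _
        rw [← Functor.map_comp, ← Functor.map_comp, ← op_comp, ← op_comp, f.unop.hom.comm] }
  map_id M := ObjectProperty.hom_ext _ (HomologicalComplex.hom_ext _ _ fun i => (alex k n).map_id _)
  map_comp f g := ObjectProperty.hom_ext _
    (HomologicalComplex.hom_ext _ _ fun i => (alex k n).map_comp _ _)

/-! ### The functor `𝒮` from squarefree `E`-modules to squarefree `S`-modules -/

lemma e_sq (l : Fin n) : e k n l * e k n l = 0 := ExteriorAlgebra.ι_sq_zero _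

lemma e_anti (l m : Fin n) : e k n l * e k n m = -(e k n m * e k n l) := by
  rw [eq_neg_iff_add_eq_zero]
  exact ExteriorAlgebra.ι_add_mul_swap _ _

/-- Multiplication by `(-1)^c e_l` as a `k`-linear map. -/
def mulE (N : GrMod (grE k n)) (l : Fin n) (c : ℕ) : N →ₗ[k] N where
  toFun z := (-1 : ℤ) ^ c • (e k n l • z)
  map_add' x y := by simp
  map_smul' r x := by
    rw [RingHom.id_apply, smul_comm r, smul_comm (e k n l) r]

lemma alpha_insert {l m : Fin n} {F : Finset (Fin n)} (hl : l ∉ F) :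
    alpha m (insert l F) = alpha m F + if l < m then 1 else 0 := by
  unfold alpha
  rw [Finset.filter_insert]
  split_ifs with h
  · rw [Finset.card_insert_of_notMem (by simp [hl])]
  · rfl

lemma e_smul_mem (N : GrMod (grE k n)) (l : Fin n) {a : Fin n → ℤ} {z : N} (hz : z ∈ N.deg a) :
    e k n l • z ∈ N.deg (a - eps l) := by
  rw [sub_eq_add_neg, add_comm]; exact N.smul_mem (e_mem l) hz

lemma ind_insert {F : Finset (Fin n)} {l : Fin n} (h : l ∉ F) : ind (insert l F) = ind F + eps l := by
  ext m
  by_cases hm : m = l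
  · subst hm; simp [ind, h]
  · simp [ind, hm]

lemma finiteE : Module.Finite k (E k n) := Module.Finite.of_basis (eF k n)

lemma finite_of_finiteE (N : GrMod (grE k n)) (h : Module.Finite (E k n) N) :
    Module.Finite k N := by
  have := finiteE (k := k) (n := n)
  exact Module.Finite.trans (E k n) N

/-- The representation `F ↦ N_{-F}` of the Boolean lattice; the transition map for
`F ⊆ F ∪ {l}` is `z ↦ (-1)^{α(l, F)} e_l z`. -/
def extRep (N : SqE k n) : BoolRep k n where
  V := N.obj
  t l F := mulE N.obj l (alpha l F)
  comm F l m z hlm hl hm := by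
    simp only [mulE, LinearMap.coe_mk, AddHom.coe_mk, alpha_insert hl, alpha_insert hm]
    rw [smul_comm (e k n m), smul_comm (e k n l), smul_smul, smul_smul, smul_smul, smul_smul,
      e_anti m l, neg_smul, smul_neg, ← neg_smul]
    congr 1
    rcases lt_or_gt_of_ne hlm with h | h
    · simp [h, h.not_gt, pow_succ]; ring
    · simp [h, h.not_gt, pow_succ]; ring
  U F := N.obj.deg (-ind F)
  mapU F l z hl hz := by
    have := e_smul_mem N.obj l hz
    rw [← neg_add', ← ind_insert hl] at this
    exact zsmul_mem this _
  fin F := by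
    have := finite_of_finiteE N.obj N.property.1
    infer_instance

variable (k n) in
/-- The functor `𝒮`: `𝒮(N)_F = N_{-F}`, and `x_l : 𝒮(N)_F → 𝒮(N)_{F ∪ {l}}` is
`z ↦ (-1)^{α(l, F)} e_l z` for `l ∉ F`. -/
def fS : SqE k n ⥤ SqS k n where
  obj N := (extRep N).toSq
  map {N N'} f := BoolRep.mapSq (ρ := extRep N) (σ := extRep N') (f.hom.lin.restrictScalars k)
    (fun l F (z : N.obj) => by
      change f.hom.lin ((-1 : ℤ) ^ _ • (e k n l • z)) =
        (-1 : ℤ) ^ _ • (e k n l • f.hom.lin z)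
      rw [map_zsmul, map_smul])
    (fun F z hz => f.hom.map_deg _ z hz)
  map_id N := toSq_hom_ext fun x =>
    congrArg (fun g => g x.1) (mapAmb_id (extRep N) _ rfl)
  map_comp f g := toSq_hom_ext fun x => by
    change BoolRep.mapAmb _ x.1 = BoolRep.mapAmb _ (BoolRep.mapAmb _ x.1)
    apply mapAmb_comp
    rfl

instance : (fS k n).PreservesZeroMorphisms where
  map_zero N N' := toSq_hom_ext fun x => by
    change BoolRep.mapAmb _ x.1 = 0
    apply mapAmb_zero
    rfl

variable (k n) in
/-- The functor `𝒮` on bounded complexes. -/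
def fSCom : ComB (IsSqE (k := k) (n := n)) ⥤ ComB (IsSqS (k := k) (n := n)) :=
  ObjectProperty.lift _ ((isBounded _).ι ⋙ (fS k n).mapHomologicalComplex _) (fun N => by
    obtain ⟨b, hb⟩ := (isBounded_iff _).mp N.property
    exact (isBounded_iff _).mpr ⟨b, fun i hi => isZero_toSq fun z => hb i hi z⟩)

end

section

variable {k : Type u} [Field k] {n : ℕ}


/-! ### The functor `ℛ` of Bernstein, Gel'fand and Gel'fand -/

variable (k n) in
/-- The vector space `Hom_k(E, V)`. -/
def CoInd (V : Type u) [AddCommGroup V] [Module k V] : Type u := E k n →ₗ[k] V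

section CoInd
variable (V : Type u) [AddCommGroup V] [Module k V]

instance : AddCommGroup (CoInd k n V) := inferInstanceAs (AddCommGroup (E k n →ₗ[k] V))
instance : Module k (CoInd k n V) := inferInstanceAs (Module k (E k n →ₗ[k] V))
instance : FunLike (CoInd k n V) (E k n) V := inferInstanceAs (FunLike (E k n →ₗ[k] V) (E k n) V)
instance : LinearMapClass (CoInd k n V) k (E k n) V :=
  inferInstanceAs (LinearMapClass (E k n →ₗ[k] V) k (E k n) V)

/-- The left `E`-module structure on `Hom_k(E, V)`: `(a f)(s) = f(s a)`. -/
instance : Module (E k n) (CoInd k n V) where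
  smul a f := LinearMap.comp (f : E k n →ₗ[k] V) (LinearMap.mulRight k a)
  one_smul f := LinearMap.ext fun s => congrArg f (mul_one s)
  mul_smul a b f := LinearMap.ext fun s => congrArg f (mul_assoc s a b).symm
  smul_zero _ := rfl
  smul_add _ _ _ := rfl
  add_smul a b f := LinearMap.ext fun s =>
    (congrArg f (mul_add s a b)).trans (map_add f _ _)
  zero_smul f := LinearMap.ext fun s => (congrArg f (mul_zero s)).trans (map_zero f)

variable {V}

lemma CoInd.smul_apply (a : E k n) (f : CoInd k n V) (s : E k n) : (a • f) s = f (s * a) := rfl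
lemma CoInd.add_apply (f g : CoInd k n V) (s : E k n) : (f + g) s = f s + g s := rfl
lemma CoInd.zero_apply (s : E k n) : (0 : CoInd k n V) s = 0 := rfl
lemma CoInd.ksmul_apply (c : k) (f : CoInd k n V) (s : E k n) : (c • f) s = c • f s := rfl

lemma CoInd.ext {f g : CoInd k n V} (h : ∀ s, f s = g s) : f = g := LinearMap.ext h

lemma CoInd.ext_hom {f g : CoInd k n V} (h : ∀ a, ∀ s ∈ grE k n a, f s = g s) : f = g := by
  have : (⊤ : Submodule k (E k n)) ≤ LinearMap.eqLocus (f : E k n →ₗ[k] V) (g : E k n →ₗ[k] V) := by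
    rw [← iSup_grE]
    exact iSup_le fun a s hs => h a s hs
  exact CoInd.ext fun s => this trivial

instance : IsScalarTower k (E k n) (CoInd k n V) where
  smul_assoc c a f := CoInd.ext fun s => by
    rw [CoInd.ksmul_apply, CoInd.smul_apply, CoInd.smul_apply, mul_smul_comm, map_smul]

end CoInd

section BGG

variable (M : Com (IsSqS (k := k) (n := n)))

/-- The ambient `E`-module `∏_j Hom_k(E, M^j)`. -/
abbrev RAmb : Type u := ∀ j : ℤ, CoInd k n (M.X j).obj

/-- The component of degree `c ∈ ℤⁿ` of `ℛⁱ(M) = ⨁_{i = j + ‖a‖} Hom_k(E(-𝟏), M^j_a)`: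
families of linear maps `f_j : E(-𝟏) → M^j` of degree `c` whose values lie in the components `M^j_a`
with `j + ‖a‖ = i`. (An element of degree `b` of `E` has degree `b + 𝟏` in `E(-𝟏)`.) -/
def rPiece (i : ℤ) (c : Fin n → ℤ) : Submodule k (RAmb M) where
  carrier := {f | ∀ j b, ∀ s ∈ grE k n b, f j s ∈ (M.X j).obj.deg (b + 1 + c) ∧
    (j + tot (b + 1 + c) ≠ i → f j s = 0)}
  add_mem' {f g} hf hg j b s hs :=
    ⟨Submodule.add_mem _ (hf j b s hs).1 (hg j b s hs).1, fun h => by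
      rw [Pi.add_apply, CoInd.add_apply, (hf j b s hs).2 h, (hg j b s hs).2 h, add_zero]⟩
  zero_mem' _ _ _ _ := ⟨Submodule.zero_mem _, fun _ => rfl⟩
  smul_mem' r f hf j b s hs :=
    ⟨Submodule.smul_mem _ _ (hf j b s hs).1, fun h => by
      rw [Pi.smul_apply, CoInd.ksmul_apply, (hf j b s hs).2 h, smul_zero]⟩

lemma rPiece_smul (i : ℤ) (a b : Fin n → ℤ) (s : E k n) (f : RAmb M) (hs : s ∈ grE k n a)
    (hf : f ∈ rPiece M i b) : s • f ∈ rPiece M i (a + b) := by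
  intro j c t ht
  have h := hf j _ _ (grE_mul ht hs)
  have e : c + a + 1 + b = c + 1 + (a + b) := by abel
  rw [e] at h
  exact h

lemma rPiece_indep (i : ℤ) : iSupIndep (rPiece M i) := by
  refine iSupIndep_of_eval (I := ℤ × (Σ b : Fin n → ℤ, grE k n b))
    (V := fun p => (M.X p.1).obj)
    (fun p => LinearMap.applyₗ (p.2.2 : E k n) ∘ₗ
      (LinearMap.proj p.1 : RAmb M →ₗ[k] CoInd k n (M.X p.1).obj))
    (fun p c => (M.X p.1).obj.deg (p.2.1 + 1 + c)) ?_ ?_ ?_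
  · rintro ⟨j, b, s⟩
    exact (M.X j).obj.independent.comp (add_right_injective _)
  · rintro ⟨j, b, s⟩ c f hf
    exact (hf j b s s.2).1
  · intro f hf
    funext j
    exact CoInd.ext_hom fun b s hs => hf ⟨j, b, ⟨s, hs⟩⟩

/-- The graded `E`-module `ℛⁱ(M)`. -/
def rMod (i : ℤ) : GrMod (grE k n) :=
  GrMod.ofPieces (RAmb M) iSup_grE (rPiece M i) (rPiece_indep M i) (rPiece_smul M i)

lemma le_tot {a : Fin n → ℤ} (h : 0 ≤ a) (l : Fin n) : a l ≤ tot a :=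
  Finset.single_le_sum (f := a) (fun i _ => h i) (Finset.mem_univ l)

lemma rMod_fg (hM : isBounded _ M) (i : ℤ) : IsFgE (rMod M i) := by
  obtain ⟨N, hN⟩ := (isBounded_iff _).mp hM
  have hfin : ∀ j a, Module.Finite k ((M.X j).obj.deg a) := fun j a => (M.X j).property.finite a
  let W : ∀ j, Submodule k (M.X j).obj := fun j =>
    ⨆ a : Finset.Icc (0 : Fin n → ℤ) (fun _ => i - j), (M.X j).obj.deg a
  have hW : ∀ (f : RAmb M) (c), f ∈ rPiece M i c → ∀ j F, f j (eF k n F) ∈ W j := by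
    intro f c hf j F
    obtain ⟨h1, h2⟩ := hf j _ _ (eF_mem F)
    by_cases h3 : j + tot (-ind F + 1 + c) = i
    · by_cases h4 : 0 ≤ -ind F + 1 + c
      · exact Submodule.mem_iSup_of_mem
          (⟨_, Finset.mem_Icc.mpr ⟨h4, fun l => by have := le_tot h4 l; dsimp only; omega⟩⟩ :
            Finset.Icc (0 : Fin n → ℤ) (fun _ => i - j)) h1
      · rw [(M.X j).property.nonneg _ h4, Submodule.mem_bot] at h1
        rw [h1]; exact Submodule.zero_mem _
    · rw [h2 h3]; exact Submodule.zero_mem _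
  have hW' : ∀ f : rMod M i, ∀ j F, f.1 j (eF k n F) ∈ W j := by
    rintro ⟨f, hf⟩ j F
    have : (⨆ c, rPiece M i c) ≤ (W j).comap (LinearMap.applyₗ (eF k n F) ∘ₗ
      (LinearMap.proj j : RAmb M →ₗ[k] CoInd k n (M.X j).obj)) :=
      iSup_le fun c f hf => hW f c hf j F
    exact this hf
  let T : rMod M i →ₗ[k] ∀ j : Finset.Icc (-N) N, ∀ _ : Finset (Fin n), W j :=
    { toFun := fun f j F => ⟨f.1 j (eF k n F), hW' f j F⟩
      map_add' := fun _ _ => rfl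
      map_smul' := fun _ _ => rfl }
  have : Module.Finite k (rMod M i) := by
    refine Module.Finite.of_injective T fun f g hfg => Subtype.ext (funext fun j => ?_)
    by_cases hj : N < |j|
    · exact CoInd.ext fun s => (hN j hj _).trans (hN j hj _).symm
    · rw [not_lt, abs_le] at hj
      refine (eF k n).ext fun F => ?_
      exact congrArg (fun g => (g ⟨j, Finset.mem_Icc.mpr hj⟩ F).1) hfg
  exact Module.Finite.of_restrictScalars_finite k (E k n) _

/-- The differential of `ℛ(M)` in cohomological degree `i`, on the ambient module:
`(d f)_j (s) = ∑_l x_l f_j(e_l s) + (-1)ⁱ δ(f_{j-1}(s))`. -/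
def rFun (i : ℤ) (f : RAmb M) : RAmb M := fun j =>
  (∑ l, mulX (M.X j).obj l ∘ₗ (f j : E k n →ₗ[k] (M.X j).obj) ∘ₗ LinearMap.mulLeft k (e k n l) +
    (i.negOnePow : ℤ) • ((M.d (j - 1) j).hom.lin.restrictScalars k ∘ₗ
      (f (j - 1) : E k n →ₗ[k] (M.X (j - 1)).obj)) : E k n →ₗ[k] (M.X j).obj)

lemma rFun_apply (i : ℤ) (f : RAmb M) (j : ℤ) (s : E k n) :
    rFun M i f j s = ∑ l, (MvPolynomial.X l : S k n) • f j (e k n l * s) +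
      (i.negOnePow : ℤ) • (M.d (j - 1) j).hom.lin (f (j - 1) s) := by
  refine (LinearMap.add_apply _ _ s).trans ?_
  rw [LinearMap.sum_apply]
  rfl

/-- The differential of `ℛ(M)` as an `E`-linear map. -/
def rDiff (i : ℤ) : RAmb M →ₗ[E k n] RAmb M where
  toFun := rFun M i
  map_add' f g := funext fun j => CoInd.ext fun s => by
    simp only [Pi.add_apply, CoInd.add_apply, rFun_apply, smul_add, map_add,
      Finset.sum_add_distrib]
    abel
  map_smul' a f := funext fun j => CoInd.ext fun s => by
    simp only [Pi.smul_apply, CoInd.smul_apply, rFun_apply, RingHom.id_apply, mul_assoc]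

lemma tot_add (a b : Fin n → ℤ) : tot (a + b) = tot a + tot b := Finset.sum_add_distrib

lemma tot_eps (l : Fin n) : tot (eps l) = 1 := by simp [tot]

lemma rDiff_mem (i : ℤ) (c : Fin n → ℤ) (f : RAmb M) (hf : f ∈ rPiece M i c) :
    rDiff M i f ∈ rPiece M (i + 1) c := by
  intro j b s hs
  have h1 : ∀ l, (MvPolynomial.X l : S k n) • f j (e k n l * s) ∈ (M.X j).obj.deg (b + 1 + c) ∧
      (j + tot (b + 1 + c) ≠ i + 1 → (MvPolynomial.X l : S k n) • f j (e k n l * s) = 0) := by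
    intro l
    have e1 : -eps l + b + 1 + c + eps l = b + 1 + c := by abel
    obtain ⟨h1, h2⟩ := hf j _ _ (grE_mul (e_mem l) hs)
    refine ⟨e1 ▸ X_smul_mem _ l h1, fun h => ?_⟩
    rw [h2, smul_zero]
    intro h3
    rw [← e1, tot_add _ (eps l), tot_eps] at h
    omega
  obtain ⟨h3, h4⟩ := hf (j - 1) b s hs
  change rFun M i f j s ∈ _ ∧ (_ → rFun M i f j s = 0)
  rw [rFun_apply]
  refine ⟨Submodule.add_mem _ (Submodule.sum_mem _ fun l _ => (h1 l).1)
    (zsmul_mem ((M.d (j - 1) j).hom.map_deg _ _ h3) _), fun h => ?_⟩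
  rw [h4 (by omega), map_zero, smul_zero, add_zero]
  exact Finset.sum_eq_zero fun l _ => (h1 l).2 h

lemma rDiff_rDiff (i : ℤ) (f : RAmb M) : rDiff M (i + 1) (rDiff M i f) = 0 := by
  funext j
  refine CoInd.ext fun s => ?_
  change rFun M (i + 1) (rFun M i f) j s = 0
  have h1 : ∑ l, (MvPolynomial.X l : S k n) • ∑ m, (MvPolynomial.X m : S k n) •
      f j (e k n m * (e k n l * s)) = 0 := by
    simp only [Finset.smul_sum]
    rw [← Finset.sum_product']
    refine Finset.sum_involution (fun p _ => (p.2, p.1)) ?_ ?_ (fun _ _ => by simp) (fun _ _ => rfl)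
    · rintro ⟨l, m⟩ -
      dsimp only
      rw [smul_smul, smul_smul, mul_comm (MvPolynomial.X m), ← smul_add, ← map_add, ← mul_assoc,
        ← mul_assoc, e_anti m l, neg_mul, neg_add_cancel, map_zero, smul_zero]
    · rintro ⟨l, m⟩ - h h2
      simp only [Prod.mk.injEq] at h2
      obtain ⟨rfl, -⟩ := h2
      apply h
      dsimp only
      rw [← mul_assoc, e_sq, zero_mul, map_zero, smul_zero, smul_zero]
  simp only [rFun_apply, smul_add, Finset.sum_add_distrib, h1, map_add, map_sum, map_zsmul,
    d_d, smul_zero, add_zero, zero_add, map_smul, Int.negOnePow_succ, Units.val_neg, neg_smul]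
  rw [Finset.smul_sum, ← Finset.sum_neg_distrib, ← Finset.sum_add_distrib]
  refine Finset.sum_eq_zero fun l _ => ?_
  rw [smul_comm, add_neg_cancel]

/-- The map of ambient modules induced by a map of complexes. -/
def rMap {M N : Com (IsSqS (k := k) (n := n))} (φ : M ⟶ N) : RAmb M →ₗ[E k n] RAmb N where
  toFun f j := ((φ.f j).hom.lin.restrictScalars k ∘ₗ (f j : E k n →ₗ[k] (M.X j).obj) :
    E k n →ₗ[k] (N.X j).obj)
  map_add' _ _ := funext fun j => CoInd.ext fun _ => map_add (φ.f j).hom.lin _ _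
  map_smul' _ _ := rfl

lemma rMap_apply {M N : Com (IsSqS (k := k) (n := n))} (φ : M ⟶ N) (f : RAmb M) (j : ℤ)
    (s : E k n) : rMap φ f j s = (φ.f j).hom.lin (f j s) := rfl

lemma rMap_mem {M N : Com (IsSqS (k := k) (n := n))} (φ : M ⟶ N) (i : ℤ) (c : Fin n → ℤ)
    (f : RAmb M) (hf : f ∈ rPiece M i c) : rMap φ f ∈ rPiece N i c := by
  intro j b s hs
  rw [rMap_apply]
  exact ⟨(φ.f j).hom.map_deg _ _ (hf j b s hs).1, fun h => by rw [(hf j b s hs).2 h, map_zero]⟩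

lemma rMap_rDiff {M N : Com (IsSqS (k := k) (n := n))} (φ : M ⟶ N) (i : ℤ) (f : RAmb M) :
    rDiff N i (rMap φ f) = rMap φ (rDiff M i f) := by
  funext j
  refine CoInd.ext fun s => ?_
  change rFun N i (rMap φ f) j s = (φ.f j).hom.lin (rFun M i f j s)
  simp only [rFun_apply, rMap_apply, map_add, map_sum, map_smul, map_zsmul, f_d]

end BGG

/-- The graded module `ℛⁱ(M)` for a bounded complex `M`. -/
abbrev rObj (M : ComB (IsSqS (k := k) (n := n))) (i : ℤ) : ModE k n :=
  ⟨rMod M.obj i, rMod_fg M.obj M.property i⟩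

/-- The differential `ℛⁱ(M) ⟶ ℛⁱ⁺¹(M)`. -/
def rD (M : ComB (IsSqS (k := k) (n := n))) (i : ℤ) : rObj M i ⟶ rObj M (i + 1) :=
  ObjectProperty.homMk (GrMod.ofPiecesMap (hP := rPiece_indep M.obj i)
    (hQ := rPiece_indep M.obj (i + 1)) (rDiff M.obj i) (rDiff_mem M.obj i))

/-- The morphism `ℛⁱ(M) ⟶ ℛⁱ(N)` induced by `φ : M ⟶ N`. -/
def rHom {M N : ComB (IsSqS (k := k) (n := n))} (φ : M ⟶ N) (i : ℤ) : rObj M i ⟶ rObj N i :=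
  ObjectProperty.homMk (GrMod.ofPiecesMap (hP := rPiece_indep M.obj i)
    (hQ := rPiece_indep N.obj i) (rMap φ.hom) (rMap_mem φ.hom i))

variable (k n) in
/-- The functor `ℛ` from bounded complexes of squarefree `S`-modules to complexes of finitely
generated graded `E`-modules. -/
def rCom : ComB (IsSqS (k := k) (n := n)) ⥤ Com (IsFgE (k := k) (n := n)) where
  obj M := CochainComplex.of (rObj M) (rD M) fun i =>
    ObjectProperty.hom_ext _ (GrMod.hom_ext fun f => Subtype.ext (rDiff_rDiff M.obj i f.1))
  map {M N} φ := CochainComplex.ofHom (fun i => rHom φ i) fun i => by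
    change rHom φ i ≫ CochainComplex.of.d (rObj N) (rD N) i (i + 1) =
      CochainComplex.of.d (rObj M) (rD M) i (i + 1) ≫ rHom φ (i + 1)
    rw [CochainComplex.of_d, CochainComplex.of_d]
    exact ObjectProperty.hom_ext _
      (GrMod.hom_ext fun f => Subtype.ext (rMap_rDiff φ.hom i f.1))
  map_id M := HomologicalComplex.hom_ext _ _ fun i => by
    rfl
  map_comp φ ψ := HomologicalComplex.hom_ext _ _ fun i => by
    rfl

end

section

variable {k : Type u} [Field k] {n : ℕ}


/-! ### The dualizing complex -/

variable (k n) in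
/-- The vector space with basis `(F, a)`, `F ⊆ [n]`, `a ∈ ℤⁿ`; the basis element `(F, a)` stands for
the monomial `x^a` in the injective hull `*E(S/P_F)`, which is spanned by the `x^a`
with `a_l ≤ 0` for all `l ∉ F`. -/
def Om : Type u := (Finset (Fin n) × (Fin n → ℤ)) →₀ k

namespace Om

instance : AddCommGroup (Om k n) :=
  inferInstanceAs (AddCommGroup ((Finset (Fin n) × (Fin n → ℤ)) →₀ k))
instance : Module k (Om k n) :=
  inferInstanceAs (Module k ((Finset (Fin n) × (Fin n → ℤ)) →₀ k))

/-- The basis element `(F, a)`. -/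
def mon (F : Finset (Fin n)) (a : Fin n → ℤ) : Om k n := Finsupp.single (F, a) 1

/-- The linear map with prescribed values on the basis. -/
def lift {V : Type*} [AddCommGroup V] [Module k V]
    (v : Finset (Fin n) → (Fin n → ℤ) → V) : Om k n →ₗ[k] V :=
  Finsupp.linearCombination k (fun p : Finset (Fin n) × (Fin n → ℤ) => v p.1 p.2)

lemma lift_mon {V : Type*} [AddCommGroup V] [Module k V]
    (v : Finset (Fin n) → (Fin n → ℤ) → V) (F a) : lift v (mon F a : Om k n) = v F a := by
  refine (Finsupp.linearCombination_single k (1 : k) _).trans ?_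
  simp

lemma hom_ext {V : Type*} [AddCommGroup V] [Module k V] {f g : Om k n →ₗ[k] V}
    (h : ∀ F a, f (mon F a) = g (mon F a)) : f = g :=
  Finsupp.lhom_ext' fun p => LinearMap.ext_ring (h p.1 p.2)

open Classical in
/-- Multiplication by `x_l` on `*E(S/P_F)`: `x_l x^a = x^{a + ε_l}` if `l ∈ F` or `a_l < 0`, and
`x_l x^a = 0` if `l ∉ F` and `a_l = 0`. -/
def op (l : Fin n) : Module.End k (Om k n) :=
  lift fun F a => if l ∈ F ∨ a l < 0 then mon F (a + eps l) else 0

lemma op_pos {l : Fin n} {F : Finset (Fin n)} {a : Fin n → ℤ} (h : l ∈ F ∨ a l < 0) :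
    op l (mon F a : Om k n) = mon F (a + eps l) := by rw [op, lift_mon, if_pos h]

lemma op_neg {l : Fin n} {F : Finset (Fin n)} {a : Fin n → ℤ} (h : ¬ (l ∈ F ∨ a l < 0)) :
    op l (mon F a : Om k n) = 0 := by rw [op, lift_mon, if_neg h]

lemma op_comm (l m : Fin n) : (op l : Module.End k (Om k n)) * op m = op m * op l := by
  by_cases hlm : l = m
  · rw [hlm]
  refine hom_ext fun F a => ?_
  have h1 : (a + eps m) l = a l := by simp [hlm]
  have h2 : (a + eps l) m = a m := by simp [Ne.symm hlm]
  simp only [Module.End.mul_apply]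
  by_cases hl : l ∈ F ∨ a l < 0 <;> by_cases hm : m ∈ F ∨ a m < 0
  · rw [op_pos hl, op_pos hm, op_pos (by rwa [h1]), op_pos (by rwa [h2]), add_right_comm]
  · rw [op_pos hl, op_neg hm, op_neg (by rwa [h2]), map_zero]
  · rw [op_neg hl, op_pos hm, op_neg (by rwa [h1]), map_zero]
  · rw [op_neg hl, op_neg hm, map_zero, map_zero]

instance : Module (S k n) (Om k n) := Module.compHom _ (polyAct op op_comm).toRingHom
instance : IsScalarTower k (S k n) (Om k n) where
  smul_assoc c s x := by
    change polyAct op op_comm (c • s) x = c • polyAct op op_comm s x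
    rw [map_smul]; rfl

lemma X_smul (l : Fin n) (x : Om k n) : (MvPolynomial.X l : S k n) • x = op l x := by
  change polyAct op op_comm (MvPolynomial.X l) x = _
  rw [polyAct_X]

/-- The basis of the component of degree `a` of `ωⁱ = ⨁_{|F| = -i} *E(S/P_F)`. -/
def index (i : ℤ) (a : Fin n → ℤ) : Set (Finset (Fin n) × (Fin n → ℤ)) :=
  {p | p.2 = a ∧ (p.1.card : ℤ) = -i ∧ ∀ l ∉ p.1, a l ≤ 0}

variable (k) in
/-- The component of degree `a` of `ωⁱ = ⨁_{|F| = -i} *E(S/P_F)`. -/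
def piece (i : ℤ) (a : Fin n → ℤ) : Submodule k (Om k n) := Finsupp.supported k k (index i a)

lemma mon_mem {i : ℤ} {F : Finset (Fin n)} {a : Fin n → ℤ} (h1 : (F.card : ℤ) = -i)
    (h2 : ∀ l ∉ F, a l ≤ 0) : mon F a ∈ piece k i a :=
  Finsupp.single_mem_supported k 1 ⟨rfl, h1, h2⟩

lemma map_piece {i : ℤ} {a : Fin n → ℤ} {V : Type*} [AddCommGroup V] [Module k V]
    {f : Om k n →ₗ[k] V} {W : Submodule k V}
    (h : ∀ F : Finset (Fin n), (F.card : ℤ) = -i → (∀ l ∉ F, a l ≤ 0) → f (mon F a) ∈ W)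
    {x : Om k n} (hx : x ∈ piece k i a) : f x ∈ W := by
  have h2 : x ∈ Submodule.span k
      ((fun p : Finset (Fin n) × (Fin n → ℤ) => (mon p.1 p.2 : Om k n)) '' index i a) :=
    (Finsupp.supported_eq_span_single k (index i a)).le hx
  refine (Submodule.span_le (p := W.comap f)).mpr ?_ h2
  rintro _ ⟨⟨F, b⟩, ⟨rfl, h1, h2⟩, rfl⟩
  exact h F h1 h2

/-- Equalities of linear maps on `ωⁱ_a` can be checked on monomials. -/
lemma eq_on_piece {i : ℤ} {a : Fin n → ℤ} {V : Type*} [AddCommGroup V] [Module k V]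
    {f g : Om k n →ₗ[k] V} (h : ∀ F : Finset (Fin n), (F.card : ℤ) = -i → (∀ l ∉ F, a l ≤ 0) →
      f (mon F a) = g (mon F a)) {x : Om k n} (hx : x ∈ piece k i a) : f x = g x :=
  map_piece (W := LinearMap.eqLocus f g) (f := LinearMap.id) h hx

lemma piece_X (i : ℤ) (l : Fin n) (a : Fin n → ℤ) (x : Om k n) (hx : x ∈ piece k i a) :
    (MvPolynomial.X l : S k n) • x ∈ piece k i (a + eps l) := by
  rw [X_smul]
  refine map_piece (fun F h1 h2 => ?_) hx
  by_cases h : l ∈ F ∨ a l < 0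
  · rw [op_pos h]
    refine mon_mem h1 fun m hm => ?_
    by_cases hml : m = l
    · subst hml
      have := h.resolve_left hm
      simp; omega
    · simpa [hml] using h2 m hm
  · rw [op_neg h]; exact Submodule.zero_mem _

lemma piece_indep (i : ℤ) : iSupIndep (piece k (n := n) i) := by
  intro a
  have : (⨆ j, ⨆ _ : j ≠ a, piece k i j) ≤ Finsupp.supported k k {p | p.2 ≠ a} :=
    iSup₂_le fun b hb => Finsupp.supported_mono fun p hp => by
      rw [Set.mem_ofPred_eq, hp.1]; exact hb
  refine Disjoint.mono_right this ?_
  exact Finsupp.disjoint_supported_supported (Set.disjoint_left.mpr fun p h1 h2 => h2 h1.1)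

lemma finite_piece (i : ℤ) (a : Fin n → ℤ) : Module.Finite k (piece k i a) := by
  have : (index i a).Finite := by
    refine (Set.finite_range fun F : Finset (Fin n) => (F, a)).subset ?_
    rintro ⟨F, b⟩ ⟨rfl, -⟩
    exact ⟨F, rfl⟩
  have := this.to_subtype
  exact Module.Finite.equiv (Finsupp.supportedEquivFinsupp (M := k) (R := k) (index i a)).symm

lemma piece_eq_bot {i : ℤ} (hi : (n : ℤ) < |i|) (a : Fin n → ℤ) : piece k i a = ⊥ := by
  rw [eq_bot_iff]
  intro x hx
  refine map_piece (f := LinearMap.id) (fun F h _ => ?_) hx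
  have h2 := Finset.card_le_univ F
  rw [Fintype.card_fin] at h2
  rcases abs_cases i with h3 | h3 <;> omega

open Classical in
/-- The differential of `ω`: it is composed of `(-1)^{α(j, F)} nat : *E(S/P_F) → *E(S/P_{F∖{j}})`,
`j ∈ F`, where `nat` sends `x^a` to `x^a` if `a_j ≤ 0`, and to zero otherwise. -/
def dk : Om k n →ₗ[k] Om k n :=
  lift fun F a => ∑ j ∈ F, if a j ≤ 0 then (-1 : k) ^ alpha j F • mon (F.erase j) a else 0

lemma dk_mon (F : Finset (Fin n)) (a : Fin n → ℤ) : dk (mon F a : Om k n) =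
    ∑ j ∈ F, if a j ≤ 0 then (-1 : k) ^ alpha j F • mon (F.erase j) a else 0 := by
  rw [dk, lift_mon]

lemma dk_X (l : Fin n) (x : Om k n) :
    dk ((MvPolynomial.X l : S k n) • x) = (MvPolynomial.X l : S k n) • dk x := by
  rw [X_smul, X_smul]
  change (dk ∘ₗ op l) x = (op l ∘ₗ dk) x
  congr 1
  refine hom_ext fun F a => ?_
  simp only [LinearMap.comp_apply, dk_mon, map_sum]
  by_cases h : l ∈ F ∨ a l < 0
  · rw [op_pos h, dk_mon]
    refine Finset.sum_congr rfl fun j hj => ?_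
    by_cases hjl : j = l
    · subst hjl
      by_cases h0 : a j ≤ 0
      · rw [if_pos h0, map_smul]
        by_cases h1 : a j < 0
        · rw [op_pos (Or.inr h1), if_pos (by simp; omega)]
        · rw [op_neg (by simp [h1]), if_neg (by simp; omega), smul_zero]
      · rw [if_neg h0, if_neg (by simp; omega), map_zero]
    · have h1 : (a + eps l) j = a j := by simp [hjl]
      rw [h1]
      by_cases h0 : a j ≤ 0
      · rw [if_pos h0, if_pos h0, map_smul, op_pos]
        exact h.imp_left fun h => Finset.mem_erase.mpr ⟨Ne.symm hjl, h⟩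
      · rw [if_neg h0, if_neg h0, map_zero]
  · rw [op_neg h, map_zero]
    refine (Finset.sum_eq_zero fun j hj => ?_).symm
    split_ifs
    · rw [map_smul, op_neg, smul_zero]
      exact fun h2 => h (h2.imp_left fun h => Finset.mem_of_mem_erase h)
    · exact map_zero _

variable (k n) in
/-- The differential of `ω` as an `S`-linear map. -/
def d : Om k n →ₗ[S k n] Om k n := { dk with map_smul' := isLinear_of_X dk dk_X }

lemma d_apply (x : Om k n) : d k n x = dk x := rfl

lemma d_mem {i : ℤ} {a : Fin n → ℤ} {x : Om k n} (hx : x ∈ piece k i a) :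
    d k n x ∈ piece k (i + 1) a := by
  refine map_piece (f := dk) (fun F h1 h2 => ?_) hx
  rw [dk_mon]
  refine Submodule.sum_mem _ fun j hj => ?_
  split_ifs with h0
  · refine Submodule.smul_mem _ _ (mon_mem ?_ fun l hl => ?_)
    · rw [Finset.card_erase_of_mem hj]
      have := Finset.card_pos.mpr ⟨j, hj⟩
      omega
    · by_cases hlj : l = j
      · rwa [hlj]
      · exact h2 l fun h => hl (Finset.mem_erase.mpr ⟨hlj, h⟩)
  · exact Submodule.zero_mem _

lemma alpha_erase {F : Finset (Fin n)} {i j : Fin n} (hi : i ∈ F) :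
    alpha j F = alpha j (F.erase i) + if i < j then 1 else 0 := by
  conv_lhs => rw [← Finset.insert_erase hi]
  exact alpha_insert (Finset.notMem_erase i F)

lemma d_d (x : Om k n) : d k n (d k n x) = 0 := by
  change (dk ∘ₗ dk) x = (0 : Om k n →ₗ[k] Om k n) x
  congr 1
  refine hom_ext fun F a => ?_
  simp only [LinearMap.comp_apply, dk_mon, map_sum, LinearMap.zero_apply]
  have h1 : ∀ j ∈ F, dk (if a j ≤ 0 then (-1 : k) ^ alpha j F • (mon (F.erase j) a : Om k n) else 0) =
      ∑ i ∈ F, if i ≠ j ∧ a i ≤ 0 ∧ a j ≤ 0 then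
        ((-1 : k) ^ alpha j F * (-1 : k) ^ alpha i (F.erase j)) •
          (mon ((F.erase j).erase i) a : Om k n) else 0 := by
    intro j hj
    by_cases h0 : a j ≤ 0
    · rw [if_pos h0, map_smul, dk_mon, Finset.smul_sum]
      rw [← Finset.sum_erase F (a := j) (by simp)]
      refine Finset.sum_congr rfl fun i hi => ?_
      rw [smul_ite, smul_zero, smul_smul]
      simp [h0, (Finset.mem_erase.mp hi).1]
    · simp [h0]
  rw [Finset.sum_congr rfl h1, ← Finset.sum_product']
  refine Finset.sum_involution (fun p _ => (p.2, p.1)) ?_ ?_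
    (fun p hp => Finset.mem_product.mpr (Finset.mem_product.mp hp).symm) (fun _ _ => rfl)
  · rintro ⟨j, i⟩ hp
    obtain ⟨hj, hi⟩ := Finset.mem_product.mp hp
    dsimp only at hj hi ⊢
    by_cases h : i ≠ j ∧ a i ≤ 0 ∧ a j ≤ 0
    · rw [if_pos h, if_pos ⟨h.1.symm, h.2.2, h.2.1⟩, Finset.erase_right_comm, ← add_smul]
      have : (-1 : k) ^ alpha j F * (-1) ^ alpha i (F.erase j) +
          (-1) ^ alpha i F * (-1) ^ alpha j (F.erase i) = 0 := by
        rw [alpha_erase (j := j) hi, alpha_erase (j := i) hj]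
        rcases lt_or_gt_of_ne h.1 with h | h
        · rw [if_pos h, if_neg h.not_gt]; ring
        · rw [if_neg h.not_gt, if_pos h]; ring
      rw [this, zero_smul]
    · rw [if_neg h, if_neg (fun h2 => h ⟨h2.1.symm, h2.2.2, h2.2.1⟩), add_zero]
  · rintro ⟨j, i⟩ - h h2
    simp only [Prod.mk.injEq] at h2
    exact h (if_neg fun h3 => h3.1 h2.1)

end Om

end

section

variable {k : Type u} [Field k] {n : ℕ}


/-! ### The duality functor `D` -/

namespace Om

lemma monomial_mon (b : Fin n →₀ ℕ) (F : Finset (Fin n)) (a : Fin n → ℤ)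
    (h : ∀ l, b l ≠ 0 → l ∈ F) :
    (MvPolynomial.monomial b (1 : k) : S k n) • (mon F a : Om k n) = mon F (a + toZ b) := by
  induction b using Finsupp.induction_linear generalizing a with
  | zero =>
    have : toZ (0 : Fin n →₀ ℕ) = 0 := by ext; simp [toZ]
    rw [this, add_zero]
    exact one_smul (S k n) _
  | add b c hb hc =>
    have : MvPolynomial.monomial (b + c) (1 : k) =
      MvPolynomial.monomial c (1 : k) * MvPolynomial.monomial b (1 : k) := by
      rw [MvPolynomial.monomial_mul, add_comm, one_mul]
    rw [this, mul_smul, toZ_add, ← add_assoc, hb _ fun l hl => h l (by simp [hl]),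
      hc _ fun l hl => h l (by simp [hl])]
  | single l m =>
    induction m with
    | zero =>
      have : toZ (0 : Fin n →₀ ℕ) = 0 := by ext; simp [toZ]
      rw [Finsupp.single_zero, this, add_zero]
      exact one_smul (S k n) _
    | succ m ih =>
      have h1 : MvPolynomial.monomial (Finsupp.single l (m + 1)) (1 : k) =
        MvPolynomial.X l * MvPolynomial.monomial (Finsupp.single l m) (1 : k) := by
        rw [MvPolynomial.X, MvPolynomial.monomial_mul, one_mul, ← Finsupp.single_add, add_comm]
      have hl : l ∈ F := h l (by simp)
      rw [h1, mul_smul, ih, X_smul, Finsupp.single_add, toZ_add, toZ_single, ← add_assoc]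
      · exact op_pos (Or.inl hl)
      · intro l' hl'
        rw [Finsupp.single_apply] at hl'
        split_ifs at hl' with h2
        · rwa [← h2]
        · exact absurd rfl hl'

open Classical in
/-- Division by `x^b` on the summands `*E(S/P_F)` with `supp b ⊆ F`, and zero on the others. -/
def divk (b : Fin n →₀ ℕ) : Om k n →ₗ[k] Om k n :=
  lift fun F a => if ∀ l, b l ≠ 0 → l ∈ F then mon F (a - toZ b) else 0

lemma divk_pos {b : Fin n →₀ ℕ} {F : Finset (Fin n)} (h : ∀ l, b l ≠ 0 → l ∈ F)
    (a : Fin n → ℤ) : divk b (mon F a : Om k n) = mon F (a - toZ b) := by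
  rw [divk, lift_mon, if_pos h]

lemma divk_neg {b : Fin n →₀ ℕ} {F : Finset (Fin n)} (h : ¬ ∀ l, b l ≠ 0 → l ∈ F)
    (a : Fin n → ℤ) : divk b (mon F a : Om k n) = 0 := by
  rw [divk, lift_mon, if_neg h]

lemma divk_X (b : Fin n →₀ ℕ) (l : Fin n) (x : Om k n) :
    divk b ((MvPolynomial.X l : S k n) • x) = (MvPolynomial.X l : S k n) • divk b x := by
  rw [X_smul, X_smul]
  change (divk b ∘ₗ op l) x = (op l ∘ₗ divk b) x
  congr 1
  refine hom_ext fun F a => ?_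
  simp only [LinearMap.comp_apply]
  by_cases h : ∀ l, b l ≠ 0 → l ∈ F
  · have h1 : (l ∈ F ∨ (a - toZ b) l < 0) ↔ (l ∈ F ∨ a l < 0) := by
      by_cases hl : l ∈ F
      · simp [hl]
      · have : b l = 0 := by
          by_contra h0; exact hl (h l h0)
        simp [toZ, this]
    rw [divk_pos h]
    by_cases h2 : l ∈ F ∨ a l < 0
    · rw [op_pos h2, op_pos (h1.mpr h2), divk_pos h, add_sub_right_comm]
    · rw [op_neg h2, op_neg (fun h3 => h2 (h1.mp h3)), map_zero]
  · rw [divk_neg h, map_zero]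
    by_cases h2 : l ∈ F ∨ a l < 0
    · rw [op_pos h2, divk_neg h]
    · rw [op_neg h2, map_zero]

/-- `divk` as an `S`-linear map. -/
def div (b : Fin n →₀ ℕ) : Om k n →ₗ[S k n] Om k n :=
  { divk b with map_smul' := isLinear_of_X (divk b) (divk_X b) }

/-- Multiplication by a monomial as a `k`-linear map. -/
def monk (b : Fin n →₀ ℕ) : Om k n →ₗ[k] Om k n :=
  (LinearMap.lsmul (S k n) (Om k n) (MvPolynomial.monomial b 1)).restrictScalars k

lemma monk_apply (b : Fin n →₀ ℕ) (x : Om k n) :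
    monk b x = (MvPolynomial.monomial b (1 : k) : S k n) • x := rfl

lemma divk_monk {b : Fin n →₀ ℕ} {i : ℤ} {a : Fin n → ℤ}
    (h : ∀ F : Finset (Fin n), (∀ l ∉ F, a l ≤ 0) → ∀ l, b l ≠ 0 → l ∈ F) {x : Om k n}
    (hx : x ∈ piece k i a) : divk b ((MvPolynomial.monomial b (1 : k) : S k n) • x) = x := by
  rw [← monk_apply]
  refine eq_on_piece (f := divk b ∘ₗ monk b) (g := LinearMap.id) (fun F _ h3 => ?_) hx
  rw [LinearMap.comp_apply, monk_apply, monomial_mon _ _ _ (h F h3), divk_pos (h F h3),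
    add_sub_cancel_right, LinearMap.id_apply]

lemma monk_divk {b : Fin n →₀ ℕ} {i : ℤ} {a : Fin n → ℤ}
    (h : ∀ F : Finset (Fin n), (∀ l ∉ F, a l ≤ 0) → ∀ l, b l ≠ 0 → l ∈ F) {x : Om k n}
    (hx : x ∈ piece k i a) : (MvPolynomial.monomial b (1 : k) : S k n) • divk b x = x := by
  rw [← monk_apply]
  refine eq_on_piece (f := monk b ∘ₗ divk b) (g := LinearMap.id) (fun F _ h3 => ?_) hx
  rw [LinearMap.comp_apply, divk_pos (h F h3), monk_apply, monomial_mon _ _ _ (h F h3),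
    sub_add_cancel, LinearMap.id_apply]

end Om

section Dual

variable (M : Com (IsSqS (k := k) (n := n)))

/-- The ambient `S`-module `∏_j Hom_S(M^j, ω)`. -/
abbrev DAmb : Type u := ∀ j : ℤ, (M.X j).obj →ₗ[S k n] Om k n

/-- The component of degree `a` of `Homᵗ_S(M, ω) = ∏_j Hom_S(M^j, ω^{t+j})`. -/
def homPiece (t : ℤ) (a : Fin n → ℤ) : Submodule k (DAmb M) where
  carrier := {f | ∀ j b, ∀ m ∈ (M.X j).obj.deg b, f j m ∈ Om.piece k (t + j) (a + b)}
  add_mem' hf hg j b m hm := Submodule.add_mem _ (hf j b m hm) (hg j b m hm)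
  zero_mem' _ _ _ _ := Submodule.zero_mem _
  smul_mem' c _ hf j b m hm := Submodule.smul_mem _ c (hf j b m hm)

open Classical in
/-- The component of degree `a` of `𝒩(Homᵗ_S(M, ω))`, where `𝒩` is the `ℕⁿ`-graded part. -/
def dPiece (t : ℤ) (a : Fin n → ℤ) : Submodule k (DAmb M) :=
  if 0 ≤ a then homPiece M t a else ⊥

variable {M}

lemma dPiece_pos {t : ℤ} {a : Fin n → ℤ} (h : 0 ≤ a) : dPiece M t a = homPiece M t a := if_pos h

lemma dPiece_le (t : ℤ) (a : Fin n → ℤ) : dPiece M t a ≤ homPiece M t a := by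
  by_cases h : 0 ≤ a
  · rw [dPiece_pos h]
  · rw [dPiece, if_neg h]; exact bot_le

lemma map_dPiece {N : Com (IsSqS (k := k) (n := n))} {t t' : ℤ} {T : DAmb M →ₗ[S k n] DAmb N}
    {a : Fin n → ℤ} (h : ∀ f ∈ homPiece M t a, T f ∈ homPiece N t' a) (f : DAmb M)
    (hf : f ∈ dPiece M t a) : T f ∈ dPiece N t' a := by
  by_cases h0 : 0 ≤ a
  · rw [dPiece_pos h0] at hf ⊢; exact h f hf
  · rw [dPiece, if_neg h0, Submodule.mem_bot] at hf ⊢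
    rw [hf, map_zero]

variable (M)

lemma dPiece_X (t : ℤ) (l : Fin n) (a : Fin n → ℤ) (f : DAmb M) (hf : f ∈ dPiece M t a) :
    (MvPolynomial.X l : S k n) • f ∈ dPiece M t (a + eps l) := by
  by_cases h0 : 0 ≤ a
  · have h1 : 0 ≤ a + eps l := fun i => by
      have := h0 i
      by_cases hi : i = l
      · subst hi; simp at this ⊢; omega
      · simpa [Pi.single_apply, hi] using this
    rw [dPiece_pos h0] at hf
    rw [dPiece_pos h1]
    intro j b m hm
    rw [add_right_comm]
    exact Om.piece_X _ l _ _ (hf j b m hm)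
  · rw [dPiece, if_neg h0, Submodule.mem_bot] at hf
    rw [hf, smul_zero]; exact Submodule.zero_mem _

lemma dAmb_ext {f g : DAmb M} (h : ∀ j b, ∀ m ∈ (M.X j).obj.deg b, f j m = g j m) : f = g := by
  funext j
  have : (f j).restrictScalars k = (g j).restrictScalars k :=
    GrMod.lin_ext _ fun b m hm => h j b m hm
  exact LinearMap.ext fun m => congrArg (fun φ => φ m) this

lemma dPiece_indep (t : ℤ) : iSupIndep (dPiece M t) := by
  refine iSupIndep_of_eval (I := Σ (j : ℤ) (b : Fin n → ℤ), (M.X j).obj.deg b)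
    (V := fun _ => Om k n)
    (fun p => LinearMap.applyₗ' k (p.2.2 : (M.X p.1).obj) ∘ₗ LinearMap.proj p.1)
    (fun p a => Om.piece k (t + p.1) (a + p.2.1)) ?_ ?_ ?_
  · rintro ⟨j, b, m⟩
    exact (Om.piece_indep (t + j)).comp (add_left_injective b)
  · rintro ⟨j, b, m⟩ a f hf
    exact dPiece_le t a hf j b m m.2
  · intro f hf
    exact dAmb_ext M fun j b m hm => hf ⟨j, b, ⟨m, hm⟩⟩

/-- The graded `S`-module `𝒩(Homᵗ_S(M, ω))`. -/
def dMod (t : ℤ) : GrMod (grS k n) :=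
  GrMod.ofPieces (DAmb M) iSup_grS (dPiece M t) (dPiece_indep M t)
    (smul_mem_of_X (dPiece M t) (dPiece_X M t))

/-- Every element of nonnegative degree is a multiple of one of squarefree degree. -/
lemma exists_squarefree {M : GrMod (grS k n)} (hM : IsSqS M) {b : Fin n → ℤ} (hb : 0 ≤ b) {m : M}
    (hm : m ∈ M.deg b) : ∃ c : Fin n →₀ ℕ, ∃ u ∈ M.deg (ind (supp b)),
      (MvPolynomial.monomial c (1 : k) : S k n) • u = m := by
  let F : Fin n →₀ ℕ := Finsupp.equivFunOnFinite.symm fun i => if i ∈ supp b then 1 else 0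
  let c : Fin n →₀ ℕ := Finsupp.equivFunOnFinite.symm fun i => (b i).toNat - 1
  have hF : toZ F = ind (supp b) := by
    ext i; simp [F, toZ, ind]
  have hFc : toZ F + toZ c = b := by
    ext i
    have := hb i
    simp only [Pi.zero_apply] at this
    by_cases hi : 0 < b i
    · simp [F, c, toZ, supp, hi]
    · simp [F, c, toZ, supp, hi]; omega
  have hs : supp (toZ F + toZ c) = supp (toZ F) := by
    rw [hFc, hF]; ext i; by_cases hi : 0 < b i <;> simp [supp, ind, hi]
  have := (hM.bij F c hs).surjOn
  rw [hFc, hF] at this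
  obtain ⟨u, hu, h⟩ := this hm
  exact ⟨c, u, hu, h⟩

/-- The exponents in degree `a + b` of elements of `ω` with `a, b ∈ ℕⁿ`. -/
lemma mem_of_nonneg {a b : Fin n → ℤ} {F : Finset (Fin n)} (ha : 0 ≤ a) (hb : 0 ≤ b)
    (h : ∀ l ∉ F, (a + b) l ≤ 0) {l : Fin n} (hl : a l ≠ 0) : l ∈ F := by
  by_contra hF
  have h1 := h l hF
  have h2 := ha l
  have h3 := hb l
  simp only [Pi.add_apply, Pi.zero_apply] at h1 h2 h3
  omega

lemma finite_dPiece (hM : isBounded _ M) (t : ℤ) (a : Fin n → ℤ) :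
    Module.Finite k (dPiece M t a) := by
  obtain ⟨N, hN⟩ := (isBounded_iff _).mp hM
  have h1 : ∀ j b, Module.Finite k ((M.X j).obj.deg b) := fun j b => (M.X j).property.finite b
  have h2 : ∀ (j : ℤ) (b : Fin n → ℤ), Module.Finite k (Om.piece k j b) := fun j b => Om.finite_piece j b
  let T : dPiece M t a →ₗ[k] ∀ j : Finset.Icc (-N) N, ∀ F : Finset (Fin n),
      ((M.X j).obj.deg (ind F) →ₗ[k] Om.piece k (t + j) (a + ind F)) :=
    { toFun := fun f j F => ((f.1 j).restrictScalars k).restrict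
        (fun m hm => dPiece_le t a f.2 j _ m hm)
      map_add' := fun _ _ => rfl
      map_smul' := fun _ _ => rfl }
  refine Module.Finite.of_injective T fun f g hfg => Subtype.ext (dAmb_ext M fun j b m hm => ?_)
  by_cases hj : N < |j|
  · rw [hN j hj m, map_zero, map_zero]
  rw [not_lt, abs_le] at hj
  by_cases hb : 0 ≤ b
  · obtain ⟨c, u, hu, rfl⟩ := exists_squarefree (M.X j).property hb hm
    rw [map_smul, map_smul]
    congr 1
    exact congrArg (fun g => (g ⟨j, Finset.mem_Icc.mpr hj⟩ (supp b) ⟨u, hu⟩).1) hfg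
  · rw [(M.X j).property.nonneg b hb, Submodule.mem_bot] at hm
    rw [hm, map_zero, map_zero]

lemma dMod_sq (hM : isBounded _ M) (t : ℤ) : IsSqS (dMod M t) := by
  refine ⟨fun a ha => ?_, fun a => GrMod.finite_deg (finite_dPiece M hM t a), fun a b hab => ?_⟩
  · rw [eq_bot_iff]
    rintro x (hx : x.1 ∈ dPiece M t a)
    rw [dPiece, if_neg ha, Submodule.mem_bot] at hx
    exact Subtype.ext hx
  · have ha : 0 ≤ toZ a := fun i => by simp [toZ]
    have hb0 : 0 ≤ toZ b := fun i => by simp [toZ]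
    have hab0 : 0 ≤ toZ a + toZ b := add_nonneg ha hb0
    have hb : ∀ l, b l ≠ 0 → toZ a l ≠ 0 := by
      intro l hl
      have : l ∈ supp (toZ a + toZ b) := by
        rw [supp, Finset.mem_filter]
        refine ⟨Finset.mem_univ _, ?_⟩
        simp only [toZ, Pi.add_apply]
        omega
      rw [hab] at this
      have h2 : 0 < toZ a l := by simpa [supp] using this
      omega
    refine ⟨fun x hx => GrMod.smul_mem _ (by simpa using monomial_mem_grS b 1) hx |> fun h => by
        rwa [add_comm] at h, ?_, ?_⟩
    · have key : ∀ x : DAmb M, x ∈ dPiece M t (toZ a) → ∀ j c, 0 ≤ c → ∀ m ∈ (M.X j).obj.deg c,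
          Om.divk b ((MvPolynomial.monomial b (1 : k) : S k n) • x j m) = x j m := by
        intro x hx j c hc m hm
        exact Om.divk_monk (fun F h3 l hl => mem_of_nonneg ha hc h3 (hb l hl))
          (dPiece_le t _ hx j c m hm)
      rintro x (hx : x.1 ∈ dPiece M t _) y (hy : y.1 ∈ dPiece M t _) hxy
      have h5 : (MvPolynomial.monomial b (1 : k) : S k n) • x.1 =
        (MvPolynomial.monomial b (1 : k) : S k n) • y.1 := congrArg Subtype.val hxy
      refine Subtype.ext (dAmb_ext M fun j c m hm => ?_)
      by_cases hc : 0 ≤ c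
      · rw [← key x.1 hx j c hc m hm, ← key y.1 hy j c hc m hm]
        have h6 : (MvPolynomial.monomial b (1 : k) : S k n) • x.1 j m =
          (MvPolynomial.monomial b (1 : k) : S k n) • y.1 j m :=
          LinearMap.congr_fun (congrFun h5 j) m
        rw [h6]
      · rw [(M.X j).property.nonneg c hc, Submodule.mem_bot] at hm
        rw [hm, map_zero, map_zero]
    · rintro y (hy : y.1 ∈ dPiece M t _)
      have hy2 := dPiece_le t _ hy
      let x : DAmb M := fun j => Om.div b ∘ₗ y.1 j
      have hx : x ∈ dPiece M t (toZ a) := by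
        rw [dPiece_pos ha]
        intro j c m hm
        refine Om.map_piece (f := Om.divk b) (fun F h2 h3 => ?_) (hy2 j c m hm)
        by_cases hF : ∀ l, b l ≠ 0 → l ∈ F
        · have e1 : toZ a + toZ b + c - toZ b = toZ a + c := by abel
          rw [Om.divk_pos hF, e1]
          refine Om.mon_mem h2 fun l hl => ?_
          have h4 : b l = 0 := by by_contra h0; exact hl (hF l h0)
          have := h3 l hl
          simpa [toZ, h4] using this
        · rw [Om.divk_neg hF]; exact Submodule.zero_mem _
      refine ⟨⟨x, GrMod.mem_pieces hx⟩, hx, Subtype.ext (dAmb_ext M fun j c m hm => ?_)⟩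
      by_cases hc : 0 ≤ c
      · refine Om.monk_divk (fun F h3 l hl => mem_of_nonneg hab0 hc h3 ?_) (hy2 j c m hm)
        have := hb l hl
        simp only [toZ, Pi.add_apply] at this ⊢
        omega
      · rw [(M.X j).property.nonneg c hc, Submodule.mem_bot] at hm
        rw [hm, map_zero, map_zero]

/-- The differential `d(f) = ((-1)ᵗ f_{j+1} δ_M^j + d_ω f_j)_j` of `Homᵗ_S(M, ω)`. -/
def dDiff (t : ℤ) : DAmb M →ₗ[S k n] DAmb M where
  toFun f j := (t.negOnePow : ℤ) • (f (j + 1) ∘ₗ (M.d j (j + 1)).hom.lin) + Om.d k n ∘ₗ f j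
  map_add' f g := funext fun j => by
    ext m
    simp
    abel
  map_smul' s f := funext fun j => by
    ext m
    simp [smul_comm s]

lemma dDiff_apply (t : ℤ) (f : DAmb M) (j : ℤ) (m : (M.X j).obj) : dDiff M t f j m =
    (t.negOnePow : ℤ) • f (j + 1) ((M.d j (j + 1)).hom.lin m) + Om.d k n (f j m) := rfl

lemma dDiff_mem (t : ℤ) (a : Fin n → ℤ) (f : DAmb M) (hf : f ∈ homPiece M t a) :
    dDiff M t f ∈ homPiece M (t + 1) a := by
  intro j b m hm
  rw [dDiff_apply, add_assoc t 1 j]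
  refine Submodule.add_mem _ (zsmul_mem ?_ _) ?_
  · rw [add_comm 1 j]
    exact hf (j + 1) b _ ((M.d j (j + 1)).hom.map_deg b m hm)
  · rw [add_comm 1 j, ← add_assoc t j 1]
    exact Om.d_mem (hf j b m hm)

lemma dDiff_dDiff (t : ℤ) (f : DAmb M) : dDiff M (t + 1) (dDiff M t f) = 0 := by
  funext j
  ext1 m
  rw [dDiff_apply, dDiff_apply, dDiff_apply, d_d, map_zero, smul_zero, zero_add, map_add, Om.d_d,
    add_zero, map_zsmul, Int.negOnePow_succ, Units.val_neg, neg_smul, neg_add_cancel]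
  rfl

/-- The map `f ↦ f ∘ φ` on the ambient modules. -/
def dMap {M N : Com (IsSqS (k := k) (n := n))} (φ : M ⟶ N) : DAmb N →ₗ[S k n] DAmb M where
  toFun f j := f j ∘ₗ (φ.f j).hom.lin
  map_add' _ _ := rfl
  map_smul' _ _ := rfl

lemma dMap_mem {M N : Com (IsSqS (k := k) (n := n))} (φ : M ⟶ N) (t : ℤ) (a : Fin n → ℤ)
    (f : DAmb N) (hf : f ∈ homPiece N t a) : dMap φ f ∈ homPiece M t a :=
  fun j b m hm => hf j b _ ((φ.f j).hom.map_deg b m hm)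

lemma dMap_dDiff {M N : Com (IsSqS (k := k) (n := n))} (φ : M ⟶ N) (t : ℤ) (f : DAmb N) :
    dDiff M t (dMap φ f) = dMap φ (dDiff N t f) := by
  funext j
  ext1 m
  change (t.negOnePow : ℤ) • f (j + 1) ((φ.f (j + 1)).hom.lin ((M.d j (j + 1)).hom.lin m)) +
    Om.d k n (f j ((φ.f j).hom.lin m)) = _
  rw [f_d]
  rfl

end Dual

/-- The squarefree module `D(M)ᵗ = 𝒩(Homᵗ_S(M, ω))` for a bounded complex `M`. -/
abbrev dObj (M : ComB (IsSqS (k := k) (n := n))) (t : ℤ) : SqS k n :=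
  ⟨dMod M.obj t, dMod_sq M.obj M.property t⟩

/-- The differential `D(M)ᵗ ⟶ D(M)ᵗ⁺¹`. -/
def dD (M : ComB (IsSqS (k := k) (n := n))) (t : ℤ) : dObj M t ⟶ dObj M (t + 1) :=
  ObjectProperty.homMk (GrMod.ofPiecesMap (hP := dPiece_indep M.obj t)
    (hQ := dPiece_indep M.obj (t + 1)) (dDiff M.obj t)
    fun a => map_dPiece (dDiff_mem M.obj t a))

/-- The morphism `D(N)ᵗ ⟶ D(M)ᵗ` induced by `φ : M ⟶ N`. -/
def dHom {M N : ComB (IsSqS (k := k) (n := n))} (φ : M ⟶ N) (t : ℤ) : dObj N t ⟶ dObj M t :=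
  ObjectProperty.homMk (GrMod.ofPiecesMap (hP := dPiece_indep N.obj t)
    (hQ := dPiece_indep M.obj t) (dMap φ.hom) fun a => map_dPiece (dMap_mem φ.hom t a))

lemma dObj_bounded (M : ComB (IsSqS (k := k) (n := n))) :
    ∃ b : ℤ, ∀ t, b < |t| → ∀ f : dMod M.obj t, f = 0 := by
  obtain ⟨N, hN⟩ := (isBounded_iff _).mp M.property
  refine ⟨N + n, fun t ht f => Subtype.ext ?_⟩
  have h1 : (⨆ a, dPiece M.obj t a) ≤ ⊥ := by
    refine iSup_le fun a f hf => dAmb_ext _ fun j b m hm => ?_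
    by_cases hj : N < |j|
    · rw [hN j hj m, map_zero, map_zero]
    · have h2 := dPiece_le t a hf j b m hm
      rw [Om.piece_eq_bot, Submodule.mem_bot] at h2
      · rw [h2]; rfl
      · rcases abs_cases t with h | h <;> rcases abs_cases j with h' | h' <;>
          rcases abs_cases (t + j) with h'' | h'' <;> omega
  exact h1 f.2

variable (k n) in
/-- The functor `D(M) = 𝒩(Hom_S(M, ω))` on bounded complexes of squarefree modules. -/
def dCom : (ComB (IsSqS (k := k) (n := n)))ᵒᵖ ⥤ ComB (IsSqS (k := k) (n := n)) where
  obj M := ⟨CochainComplex.of (dObj M.unop) (dD M.unop) fun t =>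
    ObjectProperty.hom_ext _
      (GrMod.hom_ext fun f => Subtype.ext (dDiff_dDiff M.unop.obj t f.1)),
    (isBounded_iff _).mpr (dObj_bounded M.unop)⟩
  map {M N} φ := ObjectProperty.homMk (CochainComplex.ofHom (fun t => dHom φ.unop t) fun t => by
    change dHom φ.unop t ≫ CochainComplex.of.d (dObj N.unop) (dD N.unop) t (t + 1) =
      CochainComplex.of.d (dObj M.unop) (dD M.unop) t (t + 1) ≫ dHom φ.unop (t + 1)
    rw [CochainComplex.of_d, CochainComplex.of_d]
    exact ObjectProperty.hom_ext _
      (GrMod.hom_ext fun f => Subtype.ext (dMap_dDiff φ.unop.hom t f.1)))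
  map_id M := ObjectProperty.hom_ext _ (HomologicalComplex.hom_ext _ _ fun _ => rfl)
  map_comp φ ψ := ObjectProperty.hom_ext _ (HomologicalComplex.hom_ext _ _ fun _ => rfl)

end

section

/-! ### Functors between derived categories -/

/-- The functor between localizations induced by a functor `F` that maps `W₁` into `W₂`. -/
abbrev derived {C₁ C₂ : Type*} [Category C₁] [Category C₂] {W₁ : MorphismProperty C₁}
    {W₂ : MorphismProperty C₂} (F : C₁ ⥤ C₂) (h : W₁ ≤ W₂.inverseImage F) :
    W₁.Localization ⥤ W₂.Localization :=
  LocalizerMorphism.localizedFunctor ⟨F, h⟩ W₁.Q W₂.Q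

/-- The contravariant functor between localizations induced by a contravariant functor `F`
that maps `W₁` into `W₂`. -/
abbrev derivedOp {C₁ C₂ : Type*} [Category C₁] [Category C₂] {W₁ : MorphismProperty C₁}
    {W₂ : MorphismProperty C₂} (F : C₁ᵒᵖ ⥤ C₂) (h : W₁.op ≤ W₂.inverseImage F) :
    W₁.Localizationᵒᵖ ⥤ W₂.Localization :=
  LocalizerMorphism.localizedFunctor ⟨F, h⟩ W₁.Q.op W₂.Q

section
variable {k : Type u} [Field k] {n : ℕ} {A : Type u} [Ring A] [Algebra k A]
  {𝒜 : (Fin n → ℤ) → Submodule k A} (P : ObjectProperty (GrMod 𝒜))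

/-- The translation functor `K ↦ K[m]` on bounded complexes. -/
def shiftCom (m : ℤ) : ComB P ⥤ ComB P :=
  ObjectProperty.lift _ ((isBounded P).ι ⋙ shiftFunctor (Com P) m) (by
    rintro ⟨K, a, b, h1, h2⟩
    exact ⟨a - m, b - m, K.isStrictlyGE_shift a m _ (by omega),
      K.isStrictlyLE_shift b m _ (by omega)⟩)

lemma shiftCom_qis (m : ℤ) : qisB P ≤ (qisB P).inverseImage (shiftCom P m) := by
  intro K L f hf a
  have h := ((compCom P a).commShiftIso m).hom.naturality f.hom
  have h1 : QuasiIso (((compCom P a).map f.hom)⟦m⟧') :=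
    (CochainComplex.quasiIso_shift_iff _ m).mpr (hf a)
  exact (quasiIso_iff_of_arrow_mk_iso _ _ (Arrow.isoMk
    (((compCom P a).commShiftIso m).app K.obj) (((compCom P a).commShiftIso m).app L.obj)
    h.symm)).mpr h1

/-- The translation functor `T^m` on the bounded derived category. -/
def shiftDer (m : ℤ) : DerB P ⥤ DerB P := derived (shiftCom P m) (shiftCom_qis P m)

/-- The functor `K ↦ Hⁱ(K)ₐ` on the derived category. -/
def cohomology (i : ℤ) (a : Fin n → ℤ) : Der P ⥤ ModuleCat.{u} k :=
  Localization.lift (compCom P a ⋙ HomologicalComplex.homologyFunctor _ _ i)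
    (show (qis P).IsInvertedBy _ from fun _ _ f hf => by
      have := hf a
      exact inferInstanceAs (IsIso (HomologicalComplex.homologyMap ((compCom P a).map f) i)))
    (qis P).Q

end

variable (k : Type u) [Field k] (n : ℕ)

lemma isSqE_le : (IsSqE : ObjectProperty (GrMod (grE k n))) ≤ IsFgE := fun _ h => h.1

instance : (ObjectProperty.ιOfLE (isSqE_le k n)).Additive where
  map_add := rfl

/-- The inclusion of bounded complexes of squarefree `E`-modules into complexes of finitely
generated graded `E`-modules. -/
def inclCom : ComB (IsSqE (k := k) (n := n)) ⥤ Com (IsFgE (k := k) (n := n)) :=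
  (isBounded _).ι ⋙ (ObjectProperty.ιOfLE (isSqE_le k n)).mapHomologicalComplex _

lemma inclCom_qis : qisB IsSqE ≤ (qis IsFgE).inverseImage (inclCom k n) :=
  fun _ _ _ hf a => hf a

/-- The canonical functor from the bounded derived category of squarefree `E`-modules to the
derived category of finitely generated graded `E`-modules. -/
def inclDer : DerB (IsSqE (k := k) (n := n)) ⥤ Der (IsFgE (k := k) (n := n)) :=
  derived (inclCom k n) (inclCom_qis k n)

/-- The objects of the derived category of finitely generated graded `E`-modules with bounded
cohomology and with squarefree cohomology: each `Hⁱ` is finite dimensional in each degree (as a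
subquotient of a finitely generated module) and is concentrated in the degrees `-F`, `F ⊆ [n]`. -/
def isDbSqE : ObjectProperty (Der (IsFgE (k := k) (n := n))) := fun X =>
  (∃ b : ℤ, ∀ i, b < |i| → ∀ a, IsZero ((cohomology _ i a).obj X)) ∧
  ∀ i a, Module.Finite k ((cohomology _ i a).obj X) ∧
    ((∀ F : Finset (Fin n), a ≠ -ind F) → IsZero ((cohomology _ i a).obj X))

end

end SqBGG

end

open SqBGG

noncomputable section

namespace SqBGG

/-! ### Cohomology of complexes of vector spaces in terms of elements -/

section ModuleCat

variable {k : Type u} [Field k] {K L : CochainComplex (ModuleCat.{u} k) ℤ}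

/-! The canonical functor. Since `E` lives in degrees `≤ 0`, the components of degree `≤ 0` of a
graded `E`-module form a submodule, and so do the components whose degree is not `≥ -𝟏`; the
squarefree degrees `-F` are exactly those in the box `-𝟏 ≤ a ≤ 0`. Together with the canonical
truncations at cohomological degrees `N` and `-N` this gives a natural zigzag `K ← trunc K → gTrunc
K` ending in a bounded complex of squarefree modules. Both arrows are quasi-isomorphisms as soon as
the cohomology of `K` is squarefree and concentrated between `-N` and `N`, which yields the
essential image. As `N` depends on the complex, there is no single quasi-inverse; full faithfulness
is proved for two objects at a time, by `bijective_map_of_zigzag`.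

The functor `ℛ`. An element `f` of degree `c` of `ℛ(M)` has values `f_j(e_T)` in the degree `-T + 𝟏
+ c` of `M^j`, so it vanishes unless `c ≥ -𝟏`. If some `c_l ≥ 1`, then `x_l` is invertible in all
the degrees that matter, and dividing by `x_l` contracts the component of degree `c`
(`rPiece_acyclic`). Hence the components of degree `≤ 0` form a quasi-isomorphic subcomplex `rSq` of
`ℛ(M)`, which is bounded and squarefree: this is the lift of `ℛ`. That `ℛ` preserves
quasi-isomorphisms follows by filtering by the number of exterior factors, since the graded pieces
only see the differential of `M` (`rMap_cone`).

The comparison. `𝒮(rSq M)[n]` and `D(A(M))` are already isomorphic as complexes, naturally in `M`.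
An `S`-linear map of degree `F` from a squarefree module to `*E(S/P_G)` is zero unless `F ⊆ G`, and
it amounts to a linear form on the component of degree `G`, because `x^{G∖B}` is injective on
`*E(S/P_G)`. For the source `A(M)^j` that component is the dual of `M^{-j}` in degree `Gᶜ`, so the
map is an element of `M^{-j}` of degree `Gᶜ`. On the other side this is where `g_{-j}(e_{G∖F})` lies
when `g` has degree `-F`. The map `theta` is this identification; the sign `sgn` makes it commute
with the variables and with the differentials (`theta_X`, `theta_d`), and bijectivity is
`theta_injective` and `theta_surjective`.

Exactness of `D`. The functors `𝒮` and `A` are exact in each degree. The comparison shows that `D ∘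
A` preserves quasi-isomorphisms, and as `A ∘ A` is isomorphic to the identity (`bidual`), so does
`D`. This argument does not use that `ω` is a complex of injectives. -/

lemma exists_lift_of_range_le {U V W : Type*} [AddCommGroup U] [Module k U] [AddCommGroup V]
    [Module k V] [AddCommGroup W] [Module k W] (f : V →ₗ[k] W) (g : U →ₗ[k] W)
    (h : ∀ u, ∃ v, f v = g u) : ∃ s : U →ₗ[k] V, ∀ u, f (s u) = g u := by
  obtain ⟨s, hs⟩ := Module.projective_lifting_property f.rangeRestrict
    (g.codRestrict (LinearMap.range f) fun u => h u) f.surjective_rangeRestrict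
  exact ⟨s, fun u => congrArg Subtype.val (LinearMap.congr_fun hs u)⟩

/-- Elements are maps from `k`, and a surjection onto `k` hits `1`, so the refinements in the
abstract criterion can be evaluated away. Conversely, vector spaces are projective, so the choice of
`z` can be made linearly and no refinement is needed. -/
lemma mono_homologyMap_iff (φ : K ⟶ L) (i : ℤ) :
    Mono (HomologicalComplex.homologyMap φ (i + 1)) ↔
      ∀ (x : K.X (i + 1)) (y : L.X i), (K.d (i + 1) (i + 1 + 1)).hom x = 0 →
        (φ.f (i + 1)).hom x = (L.d i (i + 1)).hom y → ∃ z, (K.d i (i + 1)).hom z = x := by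
  rw [HomologicalComplex.mono_homologyMap_iff_up_to_refinements φ i (i + 1) (i + 1 + 1)
    (by simp) (by simp)]
  constructor
  · intro h x y hx hxy
    obtain ⟨A, π, hπ, z, hz⟩ := h (A := ModuleCat.of k k)
      (ModuleCat.ofHom (LinearMap.toSpanSingleton k _ x))
      (by ext; simpa using hx) (ModuleCat.ofHom (LinearMap.toSpanSingleton k _ y))
      (by ext; simpa using hxy)
    obtain ⟨a, ha⟩ := (ModuleCat.epi_iff_surjective π).mp hπ (1 : k)
    refine ⟨z.hom a, ?_⟩
    have := congrArg (fun g => g.hom a) hz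
    simp only [ModuleCat.hom_comp, LinearMap.comp_apply] at this
    rw [← this]
    erw [ha]
    simp
  · intro h A x hx y hxy
    obtain ⟨s, hs⟩ := exists_lift_of_range_le (K.d i (i + 1)).hom x.hom fun u =>
      h _ (y.hom u) (congrArg (fun g => g.hom u) hx) (congrArg (fun g => g.hom u) hxy)
    exact ⟨A, 𝟙 A, inferInstance, ModuleCat.ofHom s, by ext u; exact (hs u).symm⟩

lemma epi_homologyMap_iff (φ : K ⟶ L) (i : ℤ) :
    Epi (HomologicalComplex.homologyMap φ (i + 1)) ↔
      ∀ y : L.X (i + 1), (L.d (i + 1) (i + 1 + 1)).hom y = 0 →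
        ∃ (x : K.X (i + 1)) (w : L.X i), (K.d (i + 1) (i + 1 + 1)).hom x = 0 ∧
          y = (φ.f (i + 1)).hom x + (L.d i (i + 1)).hom w := by
  rw [HomologicalComplex.epi_homologyMap_iff_up_to_refinements φ i (i + 1) (i + 1 + 1)
    (by simp) (by simp)]
  constructor
  · intro h y hy
    obtain ⟨A, π, hπ, x, hx, w, hw⟩ := h (A := ModuleCat.of k k)
      (ModuleCat.ofHom (LinearMap.toSpanSingleton k _ y)) (by ext; simpa using hy)
    obtain ⟨a, ha⟩ := (ModuleCat.epi_iff_surjective π).mp hπ (1 : k)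
    refine ⟨x.hom a, w.hom a, congrArg (fun g => g.hom a) hx, ?_⟩
    have := congrArg (fun g => g.hom a) hw
    simp only [ModuleCat.hom_comp, ModuleCat.hom_add, LinearMap.add_apply,
      LinearMap.comp_apply] at this
    rw [← this]
    erw [ha]
    simp
  · intro h A y hy
    obtain ⟨s, hs⟩ := exists_lift_of_range_le
      (((φ.f (i + 1)).hom ∘ₗ (LinearMap.ker (K.d (i + 1) (i + 1 + 1)).hom).subtype).coprod
        (L.d i (i + 1)).hom) y.hom fun u => by
        obtain ⟨x, w, hx, hw⟩ := h (y.hom u) (congrArg (fun g => g.hom u) hy)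
        exact ⟨(⟨x, hx⟩, w), hw.symm⟩
    refine ⟨A, 𝟙 A, inferInstance, ModuleCat.ofHom (Submodule.subtype _ ∘ₗ LinearMap.fst _ _ _ ∘ₗ s),
      ?_, ModuleCat.ofHom (LinearMap.snd _ _ _ ∘ₗ s), ?_⟩
    · ext u; exact (s u).1.2
    · ext u; exact (hs u).symm

lemma isZero_homology_iff (i : ℤ) : IsZero (K.homology (i + 1)) ↔
    ∀ x : K.X (i + 1), (K.d (i + 1) (i + 1 + 1)).hom x = 0 → ∃ z, (K.d i (i + 1)).hom z = x := by
  rw [← HomologicalComplex.exactAt_iff_isZero_homology,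
    K.exactAt_iff' i (i + 1) (i + 1 + 1) (by simp) (by simp), ShortComplex.moduleCat_exact_iff]
  rfl

lemma finite_homology (i : ℤ) (h : Module.Finite k (K.X i)) : Module.Finite k (K.homology i) := by
  have h1 : Module.Finite k (K.cycles i) := Module.Finite.of_injective (K.iCycles i).hom
    ((ModuleCat.mono_iff_injective _).mp inferInstance)
  exact Module.Finite.of_surjective (K.homologyπ i).hom
    ((ModuleCat.epi_iff_surjective _).mp inferInstance)

end ModuleCat

/-! ### Quasi-isomorphisms of complexes of graded modules in terms of elements -/

section Qis

variable {k : Type u} [Field k] {n : ℕ} {A : Type u} [Ring A] [Algebra k A]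
  {𝒜 : (Fin n → ℤ) → Submodule k A} {P : ObjectProperty (GrMod 𝒜)}

variable (P) in
/-- The functor `K ↦ Hⁱ(K)ₐ` on complexes. -/
abbrev coh (i : ℤ) (a : Fin n → ℤ) : Com P ⥤ ModuleCat.{u} k :=
  compCom P a ⋙ HomologicalComplex.homologyFunctor _ _ i

lemma qis_iff {K L : Com P} (f : K ⟶ L) : qis P f ↔ ∀ i a, IsIso ((coh P i a).map f) := by
  constructor
  · intro h i a
    have := h a
    exact inferInstanceAs (IsIso (HomologicalComplex.homologyMap ((compCom P a).map f) i))
  · intro h a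
    rw [quasiIso_iff]
    intro i
    rw [quasiIsoAt_iff_isIso_homologyMap]
    exact h i a

lemma isIso_coh_iff {K L : Com P} (f : K ⟶ L) (i : ℤ) (a : Fin n → ℤ) :
    IsIso ((coh P (i + 1) a).map f) ↔
      (∀ x ∈ (K.X (i + 1)).obj.deg a, ∀ y ∈ (L.X i).obj.deg a,
        (K.d (i + 1) (i + 1 + 1)).hom.lin x = 0 →
        (f.f (i + 1)).hom.lin x = (L.d i (i + 1)).hom.lin y →
          ∃ z ∈ (K.X i).obj.deg a, (K.d i (i + 1)).hom.lin z = x) ∧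
      (∀ y ∈ (L.X (i + 1)).obj.deg a, (L.d (i + 1) (i + 1 + 1)).hom.lin y = 0 →
        ∃ x ∈ (K.X (i + 1)).obj.deg a, ∃ w ∈ (L.X i).obj.deg a,
          (K.d (i + 1) (i + 1 + 1)).hom.lin x = 0 ∧
          y = (f.f (i + 1)).hom.lin x + (L.d i (i + 1)).hom.lin w) := by
  have h : IsIso ((coh P (i + 1) a).map f) ↔
      Mono (HomologicalComplex.homologyMap ((compCom P a).map f) (i + 1)) ∧
      Epi (HomologicalComplex.homologyMap ((compCom P a).map f) (i + 1)) := by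
    change IsIso (HomologicalComplex.homologyMap ((compCom P a).map f) (i + 1)) ↔ _
    constructor
    · intro h; exact ⟨inferInstance, inferInstance⟩
    · rintro ⟨h1, h2⟩; exact isIso_of_mono_of_epi _
  rw [h, mono_homologyMap_iff, epi_homologyMap_iff]
  refine and_congr ?_ ?_
  · constructor
    · intro h x hx y hy h1 h2
      obtain ⟨z, hz⟩ := h ⟨x, hx⟩ ⟨y, hy⟩ (Subtype.ext h1) (Subtype.ext h2)
      exact ⟨z.1, z.2, congrArg Subtype.val hz⟩
    · intro h x y h1 h2
      obtain ⟨z, hz, e⟩ := h x.1 x.2 y.1 y.2 (congrArg Subtype.val h1) (congrArg Subtype.val h2)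
      exact ⟨⟨z, hz⟩, Subtype.ext e⟩
  · constructor
    · intro h y hy h1
      obtain ⟨x, w, h2, h3⟩ := h ⟨y, hy⟩ (Subtype.ext h1)
      exact ⟨x.1, x.2, w.1, w.2, congrArg Subtype.val h2, congrArg Subtype.val h3⟩
    · intro h y h1
      obtain ⟨x, hx, w, hw, h2, h3⟩ := h y.1 y.2 (congrArg Subtype.val h1)
      exact ⟨⟨x, hx⟩, ⟨w, hw⟩, Subtype.ext h2, Subtype.ext h3⟩

lemma isZero_coh_iff (K : Com P) (i : ℤ) (a : Fin n → ℤ) :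
    IsZero ((coh P (i + 1) a).obj K) ↔
      ∀ x ∈ (K.X (i + 1)).obj.deg a, (K.d (i + 1) (i + 1 + 1)).hom.lin x = 0 →
        ∃ z ∈ (K.X i).obj.deg a, (K.d i (i + 1)).hom.lin z = x := by
  refine (isZero_homology_iff (K := (compCom P a).obj K) i).trans ?_
  constructor
  · intro h x hx h1
    obtain ⟨z, hz⟩ := h ⟨x, hx⟩ (Subtype.ext h1)
    exact ⟨z.1, z.2, congrArg Subtype.val hz⟩
  · intro h x h1
    obtain ⟨z, hz, e⟩ := h x.1 x.2 (congrArg Subtype.val h1)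
    exact ⟨⟨z, hz⟩, Subtype.ext e⟩

/-- Exactness of the mapping cone, in terms of elements. -/
lemma qis_iff_cone {K L : Com P} (f : K ⟶ L) : qis P f ↔ ∀ (i : ℤ) (a : Fin n → ℤ),
    ∀ x ∈ (K.X (i + 1 + 1)).obj.deg a, ∀ y ∈ (L.X (i + 1)).obj.deg a,
      (K.d (i + 1 + 1) (i + 1 + 1 + 1)).hom.lin x = 0 →
      (f.f (i + 1 + 1)).hom.lin x = (L.d (i + 1) (i + 1 + 1)).hom.lin y →
        ∃ z ∈ (K.X (i + 1)).obj.deg a, ∃ w ∈ (L.X i).obj.deg a,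
          (K.d (i + 1) (i + 1 + 1)).hom.lin z = x ∧
          y = (f.f (i + 1)).hom.lin z + (L.d i (i + 1)).hom.lin w := by
  rw [qis_iff]
  constructor
  · intro h i a x hx y hy h1 h2
    obtain ⟨z, hz, e⟩ := ((isIso_coh_iff f (i + 1) a).mp (h _ a)).1 x hx y hy h1 h2
    -- Injectivity on cohomology has produced `z` with `d z = x`. Now `y - f z` is a cycle, and
    -- surjectivity corrects `z` by a cycle `z'`.
    obtain ⟨z', hz', w, hw, e1, e2⟩ := ((isIso_coh_iff f i a).mp (h _ a)).2
      (y - (f.f (i + 1)).hom.lin z) (Submodule.sub_mem _ hy ((f.f _).hom.map_deg _ _ hz)) (by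
        rw [map_sub, ← f_d, e, h2, sub_self])
    refine ⟨z + z', Submodule.add_mem _ hz hz', w, hw, by rw [map_add, e, e1, add_zero], ?_⟩
    rw [map_add, add_assoc, ← e2, add_sub_cancel]
  · intro h i a
    obtain ⟨i, rfl⟩ : ∃ j, i = j + 1 := ⟨i - 1, by ring⟩
    rw [isIso_coh_iff]
    constructor
    · obtain ⟨i, rfl⟩ : ∃ j, i = j + 1 := ⟨i - 1, by ring⟩
      intro x hx y hy h1 h2
      -- Injectivity is the first half of the cone condition; surjectivity, below, is its case `x =
      -- 0`.
      obtain ⟨z, hz, -, -, e, -⟩ := h i a x hx y hy h1 h2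
      exact ⟨z, hz, e⟩
    · intro y hy h1
      obtain ⟨z, hz, w, hw, e1, e2⟩ := h i a 0 (Submodule.zero_mem _) y hy
        (map_zero _) (by rw [map_zero, h1])
      exact ⟨z, hz, w, hw, e1, e2⟩

lemma isZero_coh_of_deg_eq_bot {K : Com P} {i : ℤ} {a : Fin n → ℤ}
    (h : (K.X i).obj.deg a = ⊥) : IsZero ((coh P i a).obj K) := by
  obtain ⟨i, rfl⟩ : ∃ j, i = j + 1 := ⟨i - 1, by ring⟩
  rw [isZero_coh_iff]
  intro x hx _
  rw [h, Submodule.mem_bot] at hx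
  exact ⟨0, Submodule.zero_mem _, by rw [hx, map_zero]⟩

end Qis

/-! ### Homogeneous submodules and quotients -/

section Graded

variable {k : Type u} [Field k] {n : ℕ} {A : Type u} [Ring A] [Algebra k A]
  {𝒜 : (Fin n → ℤ) → Submodule k A}

namespace GrMod

variable (M : GrMod 𝒜)

/-- The isomorphism `⨁ₐ Mₐ ≅ M`. -/
def sumEquiv : DirectSum (Fin n → ℤ) (fun a => M.deg a) ≃ₗ[k] M :=
  LinearEquiv.ofBijective (DirectSum.coeLinearMap M.deg)
    (DirectSum.isInternal_submodule_of_iSupIndep_of_iSup_eq_top M.independent M.iSup_deg)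

/-- The linear map with prescribed restrictions to the homogeneous components. -/
def lift {W : Type*} [AddCommGroup W] [Module k W] (g : ∀ a, M.deg a →ₗ[k] W) : M →ₗ[k] W :=
  DirectSum.toModule k _ W g ∘ₗ M.sumEquiv.symm.toLinearMap

lemma lift_of_mem {W : Type*} [AddCommGroup W] [Module k W] (g : ∀ a, M.deg a →ₗ[k] W)
    {a : Fin n → ℤ} {m : M} (hm : m ∈ M.deg a) : M.lift g m = g a ⟨m, hm⟩ := by
  have h : M.sumEquiv (DirectSum.lof k _ (fun a => M.deg a) a ⟨m, hm⟩) = m :=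
    DirectSum.coeLinearMap_lof M.deg a ⟨m, hm⟩
  rw [lift, LinearMap.comp_apply]
  conv_lhs => rw [← h]
  rw [LinearEquiv.coe_coe, LinearEquiv.symm_apply_apply, DirectSum.toModule_lof]

/-- The projection to the component of degree `a`. -/
def proj (a : Fin n → ℤ) : M →ₗ[k] M := M.lift fun b => if b = a then (M.deg b).subtype else 0

lemma proj_same {a : Fin n → ℤ} {m : M} (hm : m ∈ M.deg a) : M.proj a m = m := by
  rw [proj, lift_of_mem _ _ hm, if_pos rfl]; rfl

lemma proj_ne {a b : Fin n → ℤ} (h : b ≠ a) {m : M} (hm : m ∈ M.deg b) : M.proj a m = 0 := by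
  rw [proj, lift_of_mem _ _ hm, if_neg h]; rfl

lemma proj_mem (a : Fin n → ℤ) (m : M) : M.proj a m ∈ M.deg a := by
  have : (⨆ b, M.deg b) ≤ (M.deg a).comap (M.proj a) := by
    refine iSup_le fun b x hx => ?_
    rw [Submodule.mem_comap]
    by_cases h : b = a
    · subst h; rwa [M.proj_same hx]
    · rw [M.proj_ne h hx]; exact Submodule.zero_mem _
  rw [M.iSup_deg] at this
  exact this trivial

variable {M}

lemma proj_mem_pieces {h𝒜 : ⨆ a, 𝒜 a = ⊤} {W : (Fin n → ℤ) → Submodule k M}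
    (hW : ∀ a, W a ≤ M.deg a)
    {hs : ∀ (a b : Fin n → ℤ) (s : A) (x : M), s ∈ 𝒜 a → x ∈ W b → s • x ∈ W (a + b)}
    {m : M} (hm : m ∈ piecesSub M h𝒜 W hs) (a : Fin n → ℤ) : M.proj a m ∈ W a := by
  have : (⨆ b, W b) ≤ (W a).comap (M.proj a) := by
    refine iSup_le fun b x hx => ?_
    rw [Submodule.mem_comap]
    by_cases h : b = a
    · subst h; rwa [M.proj_same (hW _ hx)]
    · rw [M.proj_ne h (hW _ hx)]; exact Submodule.zero_mem _
  exact this hm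

lemma mem_pieces_iff {h𝒜 : ⨆ a, 𝒜 a = ⊤} {W : (Fin n → ℤ) → Submodule k M}
    (hW : ∀ a, W a ≤ M.deg a)
    {hs : ∀ (a b : Fin n → ℤ) (s : A) (x : M), s ∈ 𝒜 a → x ∈ W b → s • x ∈ W (a + b)}
    {a : Fin n → ℤ} {m : M} (hm : m ∈ M.deg a) : m ∈ piecesSub M h𝒜 W hs ↔ m ∈ W a := by
  refine ⟨fun h => ?_, fun h => mem_pieces h⟩
  rw [← M.proj_same hm]
  exact proj_mem_pieces hW h a

variable (M)

/-- The quotient of `M` by the homogeneous submodule `⨁ₐ Wₐ`. -/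
def quot (h𝒜 : ⨆ a, 𝒜 a = ⊤) (W : (Fin n → ℤ) → Submodule k M) (hW : ∀ a, W a ≤ M.deg a)
    (hs : ∀ (a b : Fin n → ℤ) (s : A) (x : M), s ∈ 𝒜 a → x ∈ W b → s • x ∈ W (a + b)) :
    GrMod 𝒜 where
  carrier := M ⧸ piecesSub M h𝒜 W hs
  deg a := (M.deg a).map ((piecesSub M h𝒜 W hs).mkQ.restrictScalars k)
  independent a := by
    rw [Submodule.disjoint_def]
    rintro _ ⟨m, hm, rfl⟩ h2
    simp only [← Submodule.map_iSup] at h2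
    obtain ⟨m', hm', h3⟩ := h2
    -- The class of `m` is also the class of some `m'` with components in degrees other than `a`.
    -- The component of degree `a` of `m' - m` is `-m`, which therefore lies in `W a`.
    have h4 : m' - m ∈ piecesSub M h𝒜 W hs := (Submodule.Quotient.eq _).mp h3
    have h5 : M.proj a m' = 0 := by
      have : (⨆ j, ⨆ _ : j ≠ a, M.deg j) ≤ LinearMap.ker (M.proj a) :=
        iSup₂_le fun b hb x hx => M.proj_ne hb hx
      exact this hm'
    have h6 := proj_mem_pieces hW h4 a
    rw [map_sub, h5, M.proj_same hm, zero_sub, Submodule.neg_mem_iff] at h6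
    exact (Submodule.Quotient.mk_eq_zero _).mpr (mem_pieces h6)
  iSup_deg := by
    rw [← Submodule.map_iSup, M.iSup_deg, Submodule.map_top, LinearMap.range_eq_top]
    exact Submodule.mkQ_surjective _
  smul_mem := by
    rintro a b s _ hs' ⟨m, hm, rfl⟩
    exact ⟨s • m, M.smul_mem hs' hm, rfl⟩

variable {M} {N : GrMod 𝒜} {h𝒜 : ⨆ a, 𝒜 a = ⊤} {W : (Fin n → ℤ) → Submodule k M}
  {hW : ∀ a, W a ≤ M.deg a}
  {hs : ∀ (a b : Fin n → ℤ) (s : A) (x : M), s ∈ 𝒜 a → x ∈ W b → s • x ∈ W (a + b)}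
  {W' : (Fin n → ℤ) → Submodule k N} {hW' : ∀ a, W' a ≤ N.deg a}
  {hs' : ∀ (a b : Fin n → ℤ) (s : A) (x : N), s ∈ 𝒜 a → x ∈ W' b → s • x ∈ W' (a + b)}

/-- The map between quotients induced by a morphism of graded modules. -/
def quotMap (T : M ⟶ N) (hT : ∀ a, ∀ x ∈ W a, T.lin x ∈ W' a) :
    M.quot h𝒜 W hW hs ⟶ N.quot h𝒜 W' hW' hs' where
  lin := Submodule.mapQ (piecesSub M h𝒜 W hs) (piecesSub N h𝒜 W' hs') T.lin (fun x hx => by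
    have : (⨆ a, W a) ≤ (⨆ a, W' a).comap (T.lin.restrictScalars k) :=
      iSup_le fun a x hx => Submodule.mem_iSup_of_mem a (hT a x hx)
    exact this hx)
  map_deg := by
    rintro a _ ⟨m, hm, rfl⟩
    exact ⟨T.lin m, T.map_deg a m hm, rfl⟩

/-- The projection to the quotient. -/
def quotMk : M ⟶ M.quot h𝒜 W hW hs where
  lin := (piecesSub M h𝒜 W hs).mkQ
  map_deg _ m hm := ⟨m, hm, rfl⟩

lemma quotMk_eq_zero_iff {a : Fin n → ℤ} {m : M} (hm : m ∈ M.deg a) :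
    (quotMk : M ⟶ M.quot h𝒜 W hW hs).lin m = 0 ↔ m ∈ W a :=
  (Submodule.Quotient.mk_eq_zero _).trans (mem_pieces_iff hW hm)

end GrMod
end Graded

/-! ### Functorial subcomplexes -/

section SubFunctor

variable {k : Type u} [Field k] {n : ℕ} {A : Type u} [Ring A] [Algebra k A]
  {𝒜 : (Fin n → ℤ) → Submodule k A} {P : ObjectProperty (GrMod 𝒜)}
  {D : Type*} [Category D]

/-- A functorial family of graded subcomplexes of the complexes `F X`. -/
structure SubFunctor (F : D ⥤ Com P) where
  U : ∀ (X : D) (i : ℤ) (_ : Fin n → ℤ), Submodule k ((F.obj X).X i).obj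
  le : ∀ X i a, U X i a ≤ ((F.obj X).X i).obj.deg a
  smul : ∀ X i (a b : Fin n → ℤ) (s : A) (x : ((F.obj X).X i).obj),
    s ∈ 𝒜 a → x ∈ U X i b → s • x ∈ U X i (a + b)
  d : ∀ X i a, ∀ x ∈ U X i a, ((F.obj X).d i (i + 1)).hom.lin x ∈ U X (i + 1) a
  map : ∀ {X Y : D} (f : X ⟶ Y) i a, ∀ x ∈ U X i a, ((F.map f).f i).hom.lin x ∈ U Y i a

namespace SubFunctor

variable {F : D ⥤ Com P} (U : SubFunctor F) (h𝒜 : ⨆ a, 𝒜 a = ⊤)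

lemma d_mem (X : D) (i j : ℤ) (a : Fin n → ℤ) : ∀ x ∈ U.U X i a,
    ((F.obj X).d i j).hom.lin x ∈ U.U X j a := by
  intro x hx
  by_cases h : i + 1 = j
  · subst h; exact U.d X i a x hx
  · rw [(F.obj X).shape i j (by simpa using h)]
    exact Submodule.zero_mem _

/-- The terms of the subcomplex. -/
def subObj (X : D) (i : ℤ) : GrMod 𝒜 :=
  GrMod.ofPieces ((F.obj X).X i).obj h𝒜 (U.U X i)
    (((F.obj X).X i).obj.independent.mono (U.le X i)) (U.smul X i)

/-- The terms of the quotient complex. -/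
def quotObj (X : D) (i : ℤ) : GrMod 𝒜 :=
  ((F.obj X).X i).obj.quot h𝒜 (U.U X i) (U.le X i) (U.smul X i)

variable {Q : ObjectProperty (GrMod 𝒜)}

/-- The morphism of terms of subcomplexes induced by a morphism `T`. -/
def subMap {X Y : D} {i j : ℤ} (T : ((F.obj X).X i).obj ⟶ ((F.obj Y).X j).obj)
    (hT : ∀ a, ∀ x ∈ U.U X i a, T.lin x ∈ U.U Y j a) : U.subObj h𝒜 X i ⟶ U.subObj h𝒜 Y j :=
  GrMod.ofPiecesMap T.lin hT

/-- The morphism of terms of quotient complexes induced by a morphism `T`. -/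
def quotientMap {X Y : D} {i j : ℤ} (T : ((F.obj X).X i).obj ⟶ ((F.obj Y).X j).obj)
    (hT : ∀ a, ∀ x ∈ U.U X i a, T.lin x ∈ U.U Y j a) : U.quotObj h𝒜 X i ⟶ U.quotObj h𝒜 Y j :=
  GrMod.quotMap T hT

/-- The projection to the quotient. -/
def proj (X : D) (i : ℤ) : ((F.obj X).X i).obj ⟶ U.quotObj h𝒜 X i := GrMod.quotMk

lemma sub_ext {X Y : D} {i j : ℤ} {f g : U.subObj h𝒜 X i ⟶ U.subObj h𝒜 Y j}
    (h : ∀ x, (f.lin x).1 = (g.lin x).1) : f = g :=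
  GrMod.hom_ext fun x => Subtype.ext (h x)

lemma quot_ext {X : D} {i : ℤ} {N : GrMod 𝒜} {f g : U.quotObj h𝒜 X i ⟶ N}
    (h : ∀ x, f.lin ((U.proj h𝒜 X i).lin x) = g.lin ((U.proj h𝒜 X i).lin x)) : f = g :=
  GrMod.hom_ext fun x => by
    obtain ⟨x, rfl⟩ := Submodule.mkQ_surjective _ x
    exact h x

/-- The subcomplex as a functor. -/
def sub (hQ : ∀ X i, Q (U.subObj h𝒜 X i)) : D ⥤ Com Q where
  obj X :=
    { X := fun i => ⟨U.subObj h𝒜 X i, hQ X i⟩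
      d := fun i j => ObjectProperty.homMk (U.subMap h𝒜 ((F.obj X).d i j).hom (U.d_mem X i j))
      shape := fun i j h => by
        refine ObjectProperty.hom_ext _ (U.sub_ext h𝒜 fun x => ?_)
        change ((F.obj X).d i j).hom.lin x.1 = 0
        rw [(F.obj X).shape i j h]; rfl
      d_comp_d' := fun i j l _ _ => by
        refine ObjectProperty.hom_ext _ (U.sub_ext h𝒜 fun x => ?_)
        exact d_d (F.obj X) i j l x.1 }
  map {X Y} f :=
    { f := fun i => ObjectProperty.homMk (U.subMap h𝒜 ((F.map f).f i).hom (U.map f i))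
      comm' := fun i j _ => by
        refine ObjectProperty.hom_ext _ (U.sub_ext h𝒜 fun x => ?_)
        exact (f_d (F.map f) i j x.1).symm }
  map_id X := by
    refine HomologicalComplex.hom_ext _ _ fun i => ObjectProperty.hom_ext _
      (U.sub_ext h𝒜 fun x => ?_)
    change ((F.map (𝟙 X)).f i).hom.lin x.1 = x.1
    rw [F.map_id]; rfl
  map_comp {X Y Z} f g := by
    refine HomologicalComplex.hom_ext _ _ fun i => ObjectProperty.hom_ext _
      (U.sub_ext h𝒜 fun x => ?_)
    change ((F.map (f ≫ g)).f i).hom.lin x.1 =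
      ((F.map g).f i).hom.lin (((F.map f).f i).hom.lin x.1)
    rw [F.map_comp]; rfl

/-- The quotient complex as a functor. -/
def quot (hQ : ∀ X i, Q (U.quotObj h𝒜 X i)) : D ⥤ Com Q where
  obj X :=
    { X := fun i => ⟨U.quotObj h𝒜 X i, hQ X i⟩
      d := fun i j => ObjectProperty.homMk (U.quotientMap h𝒜 ((F.obj X).d i j).hom (U.d_mem X i j))
      shape := fun i j h => by
        refine ObjectProperty.hom_ext _ (U.quot_ext h𝒜 fun x => ?_)
        change (U.proj h𝒜 X j).lin (((F.obj X).d i j).hom.lin x) = 0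
        rw [(F.obj X).shape i j h]
        exact map_zero _
      d_comp_d' := fun i j l _ _ => by
        refine ObjectProperty.hom_ext _ (U.quot_ext h𝒜 fun x => ?_)
        change (U.proj h𝒜 X l).lin (((F.obj X).d j l).hom.lin (((F.obj X).d i j).hom.lin x)) = 0
        rw [d_d, map_zero] }
  map {X Y} f :=
    { f := fun i => ObjectProperty.homMk (U.quotientMap h𝒜 ((F.map f).f i).hom (U.map f i))
      comm' := fun i j _ => by
        refine ObjectProperty.hom_ext _ (U.quot_ext h𝒜 fun x => ?_)
        exact congrArg (U.proj h𝒜 Y j).lin (f_d (F.map f) i j x).symm }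
  map_id X := by
    refine HomologicalComplex.hom_ext _ _ fun i => ObjectProperty.hom_ext _
      (U.quot_ext h𝒜 fun x => ?_)
    change (U.proj h𝒜 X i).lin (((F.map (𝟙 X)).f i).hom.lin x) = (U.proj h𝒜 X i).lin x
    rw [F.map_id]; rfl
  map_comp {X Y Z} f g := by
    refine HomologicalComplex.hom_ext _ _ fun i => ObjectProperty.hom_ext _
      (U.quot_ext h𝒜 fun x => ?_)
    change (U.proj h𝒜 Z i).lin (((F.map (f ≫ g)).f i).hom.lin x) =
      (U.proj h𝒜 Z i).lin (((F.map g).f i).hom.lin (((F.map f).f i).hom.lin x))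
    rw [F.map_comp]; rfl

/-- An element of the subcomplex. -/
def elt {X : D} {i : ℤ} {a : Fin n → ℤ} {x : ((F.obj X).X i).obj} (hx : x ∈ U.U X i a) :
    U.subObj h𝒜 X i := ⟨x, GrMod.mem_pieces hx⟩

lemma proj_eq_zero_iff {X : D} {i : ℤ} {a : Fin n → ℤ} {x : ((F.obj X).X i).obj}
    (hx : x ∈ ((F.obj X).X i).obj.deg a) : (U.proj h𝒜 X i).lin x = 0 ↔ x ∈ U.U X i a :=
  GrMod.quotMk_eq_zero_iff hx

lemma exists_proj {X : D} {i : ℤ} {a : Fin n → ℤ} {x : U.quotObj h𝒜 X i}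
    (hx : x ∈ (U.quotObj h𝒜 X i).deg a) :
    ∃ m ∈ ((F.obj X).X i).obj.deg a, (U.proj h𝒜 X i).lin m = x := hx

end SubFunctor
end SubFunctor

/-! ### Truncation to bounded complexes of squarefree `E`-modules -/

section

variable {k : Type u} [Field k] {n : ℕ} {A : Type u} [Ring A] [Algebra k A]
  {𝒜 : (Fin n → ℤ) → Submodule k A}

lemma lin_smul {M N : GrMod 𝒜} (f : M ⟶ N) (c : k) (m : M) : f.lin (c • m) = c • f.lin m :=
  (f.lin.restrictScalars k).map_smul c m

end

section Trunc

variable {k : Type u} [Field k] {n : ℕ}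

/-- This one-sidedness makes both graded truncations stable under `E`: multiplication cannot leave
the degrees `≤ 0`, and it cannot enter the degrees `≥ -𝟏` from outside. -/
lemma nonpos_of_grE {a : Fin n → ℤ} {s : E k n} (hs : s ∈ grE k n a) : a ≤ 0 ∨ s = 0 := by
  by_cases h : ∃ F : Finset (Fin n), a = -ind F
  · obtain ⟨F, rfl⟩ := h
    left
    intro i
    simp only [ind, Pi.neg_apply, Pi.zero_apply]
    split_ifs <;> simp
  · right
    have : {x | ∃ F : Finset (Fin n), a = -ind F ∧ x = eF k n F} = ∅ := by
      ext x
      simp only [Set.mem_ofPred_eq, Set.mem_empty_iff_false, iff_false]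
      rintro ⟨F, h1, -⟩
      exact h ⟨F, h1⟩
    rw [grE, this, Submodule.span_empty, Submodule.mem_bot] at hs
    exact hs

/-- The squarefree degrees are the lattice points of a box, so they are cut out by one lower and one
upper truncation. -/
lemma exists_ind {a : Fin n → ℤ} (h0 : a ≤ 0) (h1 : -1 ≤ a) : ∃ F : Finset (Fin n), a = -ind F := by
  refine ⟨Finset.univ.filter fun i => a i ≠ 0, funext fun i => ?_⟩
  have := h0 i
  have := h1 i
  simp only [ind, Finset.mem_filter, Finset.mem_univ, true_and, Pi.neg_apply, Pi.zero_apply,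
    Pi.one_apply] at *
  split_ifs <;> omega

lemma neg_ind_nonpos (F : Finset (Fin n)) : -ind F ≤ 0 := by
  intro i
  simp only [ind, Pi.neg_apply, Pi.zero_apply]
  split_ifs <;> simp

lemma neg_one_le_neg_ind (F : Finset (Fin n)) : -1 ≤ -ind F := by
  intro i
  simp only [ind, Pi.neg_apply, Pi.one_apply]
  split_ifs <;> simp

variable {P : ObjectProperty (GrMod (grE k n))} {D : Type*} [Category D] (F : D ⥤ Com P)

section

variable {F}
variable (U : SubFunctor F)

lemma finite_subObj (hP : P ≤ IsFgE) (X : D) (i : ℤ) : IsFgE (U.subObj iSup_grE X i) := by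
  have := finite_of_finiteE _ (hP _ ((F.obj X).X i).property)
  have h : Module.Finite k (U.subObj iSup_grE X i) :=
    Module.Finite.of_injective (M := U.subObj iSup_grE X i) (N := ((F.obj X).X i).obj)
      (show U.subObj iSup_grE X i →ₗ[k] ((F.obj X).X i).obj from
        { toFun := fun x => x.1, map_add' := fun _ _ => rfl, map_smul' := fun _ _ => rfl })
      Subtype.val_injective
  exact Module.Finite.of_restrictScalars_finite k (E k n) _

lemma finite_quotObj (hP : P ≤ IsFgE) (X : D) (i : ℤ) : IsFgE (U.quotObj iSup_grE X i) := by
  have : Module.Finite (E k n) ((F.obj X).X i).obj := hP _ ((F.obj X).X i).property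
  exact Module.Finite.of_surjective (U.proj iSup_grE X i).lin (Submodule.mkQ_surjective _)

lemma subObj_sq (hP : P ≤ IsSqE) (X : D) (i : ℤ) : IsSqE (U.subObj iSup_grE X i) := by
  refine ⟨finite_subObj U (fun _ h => (hP _ h).1) X i, fun a ha => ?_⟩
  rw [eq_bot_iff]
  intro x hx
  have h := U.le X i a hx
  rw [(hP _ ((F.obj X).X i).property).2 a ha, Submodule.mem_bot] at h
  exact Subtype.ext h

end

variable (K : Com P)

/-- The elements of degree `a ≤ 0` in the canonical truncation `τ_{≤ N}`. -/
def truncU (N i : ℤ) (a : Fin n → ℤ) : Submodule k (K.X i).obj where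
  carrier := {x | x ∈ (K.X i).obj.deg a ∧ (¬ a ≤ 0 → x = 0) ∧ (N < i → x = 0) ∧
    (i = N → (K.d i (i + 1)).hom.lin x = 0)}
  add_mem' hx hy := ⟨Submodule.add_mem _ hx.1 hy.1,
    fun h => by rw [hx.2.1 h, hy.2.1 h, add_zero],
    fun h => by rw [hx.2.2.1 h, hy.2.2.1 h, add_zero],
    fun h => by rw [map_add, hx.2.2.2 h, hy.2.2.2 h, add_zero]⟩
  zero_mem' := ⟨Submodule.zero_mem _, fun _ => rfl, fun _ => rfl, fun _ => map_zero _⟩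
  smul_mem' c x hx := ⟨Submodule.smul_mem _ _ hx.1,
    fun h => by rw [hx.2.1 h, smul_zero], fun h => by rw [hx.2.2.1 h, smul_zero],
    fun h => by rw [lin_smul, hx.2.2.2 h, smul_zero]⟩

/-- The elements of degree `a` that vanish if `a ≥ -𝟏` in the canonical truncation `τ_{≥ -N}`. -/
def cotruncU (N i : ℤ) (a : Fin n → ℤ) : Submodule k (K.X i).obj where
  -- These are the elements to be killed: everything if `a` is not `≥ -𝟏` or if `i < -N`, the
  -- boundaries if `i = -N`, and nothing if `i > -N`.
  carrier := {x | x ∈ (K.X i).obj.deg a ∧ (-1 ≤ a → -N < i → x = 0) ∧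
    (-1 ≤ a → i = -N → ∃ z ∈ (K.X (i - 1)).obj.deg a, (K.d (i - 1) i).hom.lin z = x)}
  add_mem' hx hy := ⟨Submodule.add_mem _ hx.1 hy.1,
    fun h h' => by rw [hx.2.1 h h', hy.2.1 h h', add_zero],
    fun h h' => by
      obtain ⟨z, hz, e1⟩ := hx.2.2 h h'
      obtain ⟨w, hw, e2⟩ := hy.2.2 h h'
      exact ⟨z + w, Submodule.add_mem _ hz hw, by rw [map_add, e1, e2]⟩⟩
  zero_mem' := ⟨Submodule.zero_mem _, fun _ _ => rfl,
    fun _ _ => ⟨0, Submodule.zero_mem _, map_zero _⟩⟩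
  smul_mem' c x hx := ⟨Submodule.smul_mem _ _ hx.1,
    fun h h' => by rw [hx.2.1 h h', smul_zero],
    fun h h' => by
      obtain ⟨z, hz, e1⟩ := hx.2.2 h h'
      exact ⟨c • z, Submodule.smul_mem _ _ hz, by rw [lin_smul, e1]⟩⟩

variable {K}

lemma mem_truncU {N i : ℤ} {a : Fin n → ℤ} {x : (K.X i).obj} : x ∈ truncU K N i a ↔
    x ∈ (K.X i).obj.deg a ∧ (¬ a ≤ 0 → x = 0) ∧ (N < i → x = 0) ∧
      (i = N → (K.d i (i + 1)).hom.lin x = 0) := Iff.rfl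

lemma mem_cotruncU {N i : ℤ} {a : Fin n → ℤ} {x : (K.X i).obj} : x ∈ cotruncU K N i a ↔
    x ∈ (K.X i).obj.deg a ∧ (-1 ≤ a → -N < i → x = 0) ∧
    (-1 ≤ a → i = -N → ∃ z ∈ (K.X (i - 1)).obj.deg a, (K.d (i - 1) i).hom.lin z = x) := Iff.rfl

lemma truncU_smul (N i : ℤ) (a b : Fin n → ℤ) (s : E k n) (x : (K.X i).obj)
    (hs : s ∈ grE k n a) (hx : x ∈ truncU K N i b) : s • x ∈ truncU K N i (a + b) := by
  rcases nonpos_of_grE hs with h | rfl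
  · rw [mem_truncU] at hx ⊢
    refine ⟨GrMod.smul_mem _ hs hx.1, fun h1 => ?_, fun h1 => ?_, fun h1 => ?_⟩
    · rw [hx.2.1 fun h2 => h1 (add_nonpos h h2), smul_zero]
    · rw [hx.2.2.1 h1, smul_zero]
    · rw [map_smul, hx.2.2.2 h1, smul_zero]
  · rw [zero_smul]
    exact Submodule.zero_mem _

lemma truncU_d (N i : ℤ) (a : Fin n → ℤ) (x : (K.X i).obj) (hx : x ∈ truncU K N i a) :
    (K.d i (i + 1)).hom.lin x ∈ truncU K N (i + 1) a := by
  rw [mem_truncU] at hx ⊢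
  refine ⟨(K.d i (i + 1)).hom.map_deg _ _ hx.1, fun h => ?_, fun h => ?_, fun h => d_d K _ _ _ _⟩
  · rw [hx.2.1 h, map_zero]
  · rcases lt_or_eq_of_le (Int.lt_add_one_iff.mp h) with h | h
    · rw [hx.2.2.1 h, map_zero]
    · exact hx.2.2.2 h.symm

lemma truncU_map {K L : Com P} (f : K ⟶ L) (N i : ℤ) (a : Fin n → ℤ) (x : (K.X i).obj)
    (hx : x ∈ truncU K N i a) : (f.f i).hom.lin x ∈ truncU L N i a := by
  rw [mem_truncU] at hx ⊢
  refine ⟨(f.f i).hom.map_deg _ _ hx.1, fun h => ?_, fun h => ?_, fun h => ?_⟩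
  · rw [hx.2.1 h, map_zero]
  · rw [hx.2.2.1 h, map_zero]
  · rw [← f_d, hx.2.2.2 h, map_zero]

lemma cotruncU_smul (N i : ℤ) (a b : Fin n → ℤ) (s : E k n) (x : (K.X i).obj)
    (hs : s ∈ grE k n a) (hx : x ∈ cotruncU K N i b) : s • x ∈ cotruncU K N i (a + b) := by
  rcases nonpos_of_grE hs with h | rfl
  · have h0 : -1 ≤ a + b → -1 ≤ b := fun h1 => h1.trans (add_le_of_nonpos_left h)
    rw [mem_cotruncU] at hx ⊢
    refine ⟨GrMod.smul_mem _ hs hx.1, fun h1 h2 => ?_, fun h1 h2 => ?_⟩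
    · rw [hx.2.1 (h0 h1) h2, smul_zero]
    · obtain ⟨z, hz, e1⟩ := hx.2.2 (h0 h1) h2
      exact ⟨s • z, GrMod.smul_mem _ hs hz, by rw [map_smul, e1]⟩
  · rw [zero_smul]
    exact Submodule.zero_mem _

lemma cotruncU_d (N i : ℤ) (a : Fin n → ℤ) (x : (K.X i).obj) (hx : x ∈ cotruncU K N i a) :
    (K.d i (i + 1)).hom.lin x ∈ cotruncU K N (i + 1) a := by
  rw [mem_cotruncU] at hx ⊢
  refine ⟨(K.d i (i + 1)).hom.map_deg _ _ hx.1, fun h h' => ?_, fun h h' => ?_⟩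
  · rcases lt_or_eq_of_le (Int.lt_add_one_iff.mp h') with h' | h'
    · rw [hx.2.1 h h', map_zero]
    · obtain ⟨z, -, rfl⟩ := hx.2.2 h h'.symm
      exact d_d K _ _ _ _
  · have : ∃ z ∈ (K.X i).obj.deg a, (K.d i (i + 1)).hom.lin z =
      (K.d i (i + 1)).hom.lin x := ⟨x, hx.1, rfl⟩
    have e : i + 1 - 1 = i := add_sub_cancel_right _ _
    rwa [e]

lemma cotruncU_map {K L : Com P} (f : K ⟶ L) (N i : ℤ) (a : Fin n → ℤ) (x : (K.X i).obj)
    (hx : x ∈ cotruncU K N i a) : (f.f i).hom.lin x ∈ cotruncU L N i a := by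
  rw [mem_cotruncU] at hx ⊢
  refine ⟨(f.f i).hom.map_deg _ _ hx.1, fun h h' => ?_, fun h h' => ?_⟩
  · rw [hx.2.1 h h', map_zero]
  · obtain ⟨z, hz, rfl⟩ := hx.2.2 h h'
    exact ⟨_, (f.f (i - 1)).hom.map_deg _ _ hz, (f_d f _ _ _).symm⟩

/-- The functorial subcomplex of the elements of degree `≤ 0` in the canonical
truncation `τ_{≤ N}`. -/
def truncSub (N : ℤ) : SubFunctor F where
  U X := truncU (F.obj X) N
  le _ _ _ _ hx := (mem_truncU.mp hx).1
  smul _ := truncU_smul N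
  d _ := truncU_d N
  map f := truncU_map (F.map f) N

/-- The functorial kernel of the projection to the components of degree `≥ -𝟏` of the canonical
truncation `τ_{≥ -N}`. -/
def cotruncSub (N : ℤ) : SubFunctor F where
  U X := cotruncU (F.obj X) N
  le _ _ _ _ hx := (mem_cotruncU.mp hx).1
  smul _ := cotruncU_smul N
  d _ := cotruncU_d N
  map f := cotruncU_map (F.map f) N

section

variable (P)

/-- The truncation to degrees `≤ 0` and cohomological degrees `≤ N`. -/
def trunc (hP : ∀ (N : ℤ) (K : Com P) (i : ℤ), P ((truncSub (𝟭 _) N).subObj iSup_grE K i)) (N : ℤ) :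
    Com P ⥤ Com P :=
  (truncSub (𝟭 (Com P)) N).sub iSup_grE (hP N)

variable {P}
variable (hP : ∀ (N : ℤ) (K : Com P) (i : ℤ), P ((truncSub (𝟭 _) N).subObj iSup_grE K i)) (N : ℤ)

/-- The inclusion of the truncation. -/
def truncι : trunc P hP N ⟶ 𝟭 _ where
  app _ :=
    { f := fun _ => ObjectProperty.homMk
        { lin := Submodule.subtype _
          map_deg := fun _ _ hx => (mem_truncU.mp hx).1 }
      comm' := fun _ _ _ => rfl }
  naturality _ _ _ := rfl

/-- In degrees `a ≤ 0` the subcomplex contains all elements below `N` and all cycles in degree `N`,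
so it has the same cycles and the same boundaries up to `N`. -/
lemma isIso_truncι (K : Com P) {i : ℤ} (hi : i ≤ N) {a : Fin n → ℤ} (ha : a ≤ 0) :
    IsIso ((coh P i a).map ((truncι hP N).app K)) := by
  obtain ⟨i, rfl⟩ : ∃ j, i = j + 1 := ⟨i - 1, by ring⟩
  rw [isIso_coh_iff]
  constructor
  · intro x hx y hy h1 h2
    have hy' : y ∈ truncU K N i a := mem_truncU.mpr ⟨hy, fun h => absurd ha h,
      fun h => by omega, fun h => by omega⟩
    exact ⟨(truncSub (𝟭 (Com P)) N).elt iSup_grE hy', hy', Subtype.ext h2.symm⟩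
  · intro y hy h1
    have hy' : y ∈ truncU K N (i + 1) a := mem_truncU.mpr ⟨hy, fun h => absurd ha h,
      fun h => by omega, fun h => h1⟩
    exact ⟨(truncSub (𝟭 (Com P)) N).elt iSup_grE hy', hy', 0, Submodule.zero_mem _,
      Subtype.ext h1, by rw [map_zero, add_zero]; rfl⟩

lemma trunc_deg (K : Com P) {i : ℤ} {a : Fin n → ℤ} (h : ¬ (i ≤ N ∧ a ≤ 0)) :
    (((trunc P hP N).obj K).X i).obj.deg a = ⊥ := by
  rw [eq_bot_iff]
  intro x hx
  have hx' := mem_truncU.mp hx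
  by_cases ha : a ≤ 0
  · exact Subtype.ext (hx'.2.2.1 (by by_contra; exact h ⟨by omega, ha⟩))
  · exact Subtype.ext (hx'.2.1 ha)

end

end Trunc

lemma isIso_of_comm_sq {C : Type*} [Category C] {A B A' B' : C} {f : A ⟶ B} {g : A' ⟶ B'}
    {p : A ⟶ A'} {q : B ⟶ B'} (h : f ≫ q = p ≫ g) [IsIso p] [IsIso q] : IsIso f ↔ IsIso g := by
  constructor
  · intro _
    have : g = inv p ≫ f ≫ q := by rw [h, IsIso.inv_hom_id_assoc]
    rw [this]; infer_instance
  · intro _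
    have : f = p ≫ g ≫ inv q := by rw [← reassoc_of% h, IsIso.hom_inv_id, Category.comp_id]
    rw [this]; infer_instance

lemma isIso_of_isZero {C : Type*} [Category C] [HasZeroMorphisms C] {A B : C} (hA : IsZero A)
    (hB : IsZero B) (f : A ⟶ B) : IsIso f := ⟨0, hA.eq_of_src _ _, hB.eq_of_src _ _⟩

section

variable {k : Type u} [Field k] {n : ℕ} {A : Type u} [Ring A] [Algebra k A]
  {𝒜 : (Fin n → ℤ) → Submodule k A}

lemma GrMod.eq_zero_of_deg_eq_bot {M : GrMod 𝒜} (h : ∀ a, M.deg a = ⊥) (m : M) : m = 0 := by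
  have := M.iSup_deg
  simp only [h, iSup_bot] at this
  have h2 : m ∈ (⊤ : Submodule k M) := trivial
  rwa [← this, Submodule.mem_bot] at h2

lemma GrMod.deg_eq_bot {M : GrMod 𝒜} (h : ∀ m : M, m = 0) (a : Fin n → ℤ) : M.deg a = ⊥ := by
  rw [eq_bot_iff]; intro m _; exact h m

end

section Trunc

variable {k : Type u} [Field k] {n : ℕ}

lemma trunc_fg (N : ℤ) (K : Com (IsFgE (k := k) (n := n))) (i : ℤ) :
    IsFgE ((truncSub (𝟭 _) N).subObj iSup_grE K i) := finite_subObj _ le_rfl K i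

lemma trunc_sq (N : ℤ) (K : Com (IsSqE (k := k) (n := n))) (i : ℤ) :
    IsSqE ((truncSub (𝟭 _) N).subObj iSup_grE K i) := subObj_sq _ le_rfl K i

section
variable {P : ObjectProperty (GrMod (grE k n))}
  (hP : ∀ (N : ℤ) (K : Com P) (i : ℤ), P ((truncSub (𝟭 _) N).subObj iSup_grE K i)) (N : ℤ)

/-- No condition on the cohomology is needed: where the truncation is nonzero, the inclusion into
the full complex is an isomorphism on cohomology, and elsewhere both cohomologies vanish. -/
lemma trunc_qis : qis P ≤ (qis P).inverseImage (trunc P hP N) := by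
  intro K L f hf
  rw [MorphismProperty.inverseImage_iff, qis_iff]
  intro i a
  by_cases h : i ≤ N ∧ a ≤ 0
  · have := isIso_truncι hP N K h.1 h.2
    have := isIso_truncι hP N L h.1 h.2
    rw [isIso_of_comm_sq (p := (coh P i a).map ((truncι hP N).app K))
      (q := (coh P i a).map ((truncι hP N).app L)) (g := (coh P i a).map f)]
    · exact (qis_iff f).mp hf i a
    · rw [← Functor.map_comp, ← Functor.map_comp]
      exact congrArg _ ((truncι hP N).naturality f)
  · exact isIso_of_isZero (isZero_coh_of_deg_eq_bot (trunc_deg hP N K h))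
      (isZero_coh_of_deg_eq_bot (trunc_deg hP N L h)) _

lemma trunc_bounded {K : Com P} (hK : isBounded P K) : isBounded P ((trunc P hP N).obj K) := by
  obtain ⟨b, hb⟩ := (isBounded_iff _).mp hK
  exact (isBounded_iff _).mpr ⟨b, fun i hi x => Subtype.ext (hb i hi x.1)⟩

/-- The truncation of bounded complexes. -/
def truncB : ComB P ⥤ ComB P :=
  ObjectProperty.lift _ ((isBounded P).ι ⋙ trunc P hP N) fun K => trunc_bounded hP N K.property

/-- The inclusion of the truncation of bounded complexes. -/
def truncBι : truncB hP N ⟶ 𝟭 _ where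
  app K := ObjectProperty.homMk ((truncι hP N).app K.obj)
  naturality _ _ _ := rfl

lemma truncB_qis : qisB P ≤ (qisB P).inverseImage (truncB hP N) :=
  fun _ _ f hf => trunc_qis hP N f.hom hf

end

section

variable (k n) (N : ℤ)

/-- The functorial kernel of the projection of the truncation of a complex to a bounded complex of
squarefree modules. -/
abbrev gSub : SubFunctor (trunc (IsFgE (k := k) (n := n)) trunc_fg N) := cotruncSub _ N

lemma gSub_deg (K : Com (IsFgE (k := k) (n := n))) {i : ℤ} {a : Fin n → ℤ}
    (h : ¬ (-N ≤ i ∧ i ≤ N ∧ -1 ≤ a ∧ a ≤ 0)) :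
    ((gSub k n N).quotObj iSup_grE K i).deg a = ⊥ := by
  rw [eq_bot_iff]
  intro x hx
  obtain ⟨m, hm, rfl⟩ := (gSub k n N).exists_proj iSup_grE hx
  refine ((gSub k n N).proj_eq_zero_iff iSup_grE hm).mpr ?_
  by_cases h1 : i ≤ N ∧ a ≤ 0
  · refine mem_cotruncU.mpr ⟨hm, fun h2 h3 => ?_, fun h2 h3 => ?_⟩
    · exact absurd ⟨h3.le, h1.1, h2, h1.2⟩ h
    · exact absurd ⟨h3.ge, h1.1, h2, h1.2⟩ h
  · have hm' := hm
    rw [trunc_deg trunc_fg N K h1, Submodule.mem_bot] at hm'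
    rw [hm']
    exact Submodule.zero_mem _

lemma gSub_sq (K : Com (IsFgE (k := k) (n := n))) (i : ℤ) :
    IsSqE ((gSub k n N).quotObj iSup_grE K i) := by
  refine ⟨finite_quotObj _ le_rfl K i, fun a ha => gSub_deg k n N K ?_⟩
  rintro ⟨-, -, h1, h2⟩
  obtain ⟨F, hF⟩ := exists_ind h2 h1
  exact ha F hF

/-- The truncation of a complex of graded `E`-modules to a bounded complex of squarefree
modules. -/
def gTrunc : Com (IsFgE (k := k) (n := n)) ⥤ ComB (IsSqE (k := k) (n := n)) :=
  ObjectProperty.lift _ ((gSub k n N).quot iSup_grE (gSub_sq k n N)) fun K =>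
    (isBounded_iff _).mpr ⟨N, fun i hi => GrMod.eq_zero_of_deg_eq_bot fun a =>
      gSub_deg k n N K (by
        rintro ⟨h1, h2, -⟩
        rcases abs_cases i with h | h <;> omega)⟩

/-- The projection of the truncation to a bounded complex of squarefree modules. -/
def gTruncπ : trunc IsFgE trunc_fg N ⟶ gTrunc k n N ⋙ inclCom k n where
  app K :=
    { f := fun i => ObjectProperty.homMk ((gSub k n N).proj iSup_grE K i)
      comm' := fun _ _ _ => rfl }
  naturality _ _ _ := rfl

/-- The projection of the truncation of a bounded complex of squarefree modules. -/
def gTruncBπ : truncB trunc_sq N ⟶ inclCom k n ⋙ gTrunc k n N where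
  app K := ObjectProperty.homMk
    { f := fun i => ObjectProperty.homMk ((gSub k n N).proj iSup_grE ((inclCom k n).obj K) i)
      comm' := fun _ _ _ => rfl }
  naturality _ _ _ := rfl

/-- In degrees `a ≥ -𝟏` the kernel of the projection is zero above `-N` and consists of boundaries
at `-N`, so it does not affect the cohomology from `-N` on. -/
lemma isIso_gTruncπ (K : Com (IsFgE (k := k) (n := n))) {i : ℤ} (hi : -N ≤ i) {a : Fin n → ℤ}
    (ha : -1 ≤ a) : IsIso ((coh _ i a).map ((gTruncπ k n N).app K)) := by
  obtain ⟨i, rfl⟩ : ∃ j, i = j + 1 := ⟨i - 1, by ring⟩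
  rw [isIso_coh_iff]
  constructor
  · intro x hx y hy h1 h2
    obtain ⟨y, hy', rfl⟩ := (gSub k n N).exists_proj iSup_grE hy
    have h3 : ((gSub k n N).proj iSup_grE K (i + 1)).lin
        (x - (((trunc IsFgE trunc_fg N).obj K).d i (i + 1)).hom.lin y) = 0 := by
      rw [map_sub, sub_eq_zero]; exact h2
    rw [(gSub k n N).proj_eq_zero_iff iSup_grE (Submodule.sub_mem _ hx
      ((((trunc IsFgE trunc_fg N).obj K).d i (i + 1)).hom.map_deg _ _ hy'))] at h3
    obtain ⟨-, h4, h5⟩ := mem_cotruncU.mp h3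
    rcases lt_or_eq_of_le hi with hi | hi
    · exact ⟨y, hy', (sub_eq_zero.mp (h4 ha hi)).symm⟩
    -- In the lowest degree the difference `x - d y` need not vanish, but it is a boundary `d z`, so
    -- `x = d (y + z)`.
    · have h6 := h5 ha hi.symm
      have e : i + 1 - 1 = i := add_sub_cancel_right _ _
      rw [e] at h6
      obtain ⟨z, hz, e1⟩ := h6
      exact ⟨y + z, Submodule.add_mem _ hy' hz, by rw [map_add, e1, add_sub_cancel]⟩
  · intro y hy h1
    obtain ⟨y, hy', rfl⟩ := (gSub k n N).exists_proj iSup_grE hy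
    have h3 : ((gSub k n N).proj iSup_grE K (i + 1 + 1)).lin
        ((((trunc IsFgE trunc_fg N).obj K).d (i + 1) (i + 1 + 1)).hom.lin y) = 0 := h1
    rw [(gSub k n N).proj_eq_zero_iff iSup_grE
      ((((trunc IsFgE trunc_fg N).obj K).d (i + 1) (i + 1 + 1)).hom.map_deg _ _ hy')] at h3
    exact ⟨y, hy', 0, Submodule.zero_mem _, (mem_cotruncU.mp h3).2.1 ha (by omega),
      by rw [map_zero, add_zero]; rfl⟩

lemma gTrunc_qis : qis IsFgE ≤ (qisB IsSqE).inverseImage (gTrunc k n N) := by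
  intro K L f hf
  change qis IsFgE ((gTrunc k n N ⋙ inclCom k n).map f)
  rw [qis_iff]
  intro i a
  by_cases h : -N ≤ i ∧ i ≤ N ∧ -1 ≤ a ∧ a ≤ 0
  · have := isIso_gTruncπ k n N K h.1 h.2.2.1
    have := isIso_gTruncπ k n N L h.1 h.2.2.1
    rw [← isIso_of_comm_sq (p := (coh _ i a).map ((gTruncπ k n N).app K))
      (q := (coh _ i a).map ((gTruncπ k n N).app L))
      (f := (coh _ i a).map ((trunc IsFgE trunc_fg N).map f))]
    · exact (qis_iff _).mp (trunc_qis trunc_fg N f hf) i a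
    · rw [← Functor.map_comp, ← Functor.map_comp]
      exact congrArg _ ((gTruncπ k n N).naturality f)
  · exact isIso_of_isZero (isZero_coh_of_deg_eq_bot (gSub_deg k n N K h))
      (isZero_coh_of_deg_eq_bot (gSub_deg k n N L h)) _

/-- Complexes with squarefree cohomology in cohomological degrees between `-N` and `N`. -/
def hasSqCoh (K : Com (IsFgE (k := k) (n := n))) : Prop :=
  ∀ i a, ¬ (-N ≤ i ∧ i ≤ N ∧ -1 ≤ a ∧ a ≤ 0) → IsZero ((coh _ i a).obj K)

variable {k n N}

lemma truncι_qis {K : Com (IsFgE (k := k) (n := n))} (hK : hasSqCoh k n N K) :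
    qis _ ((truncι trunc_fg N).app K) := by
  rw [qis_iff]
  intro i a
  by_cases h : i ≤ N ∧ a ≤ 0
  · exact isIso_truncι _ N K h.1 h.2
  · exact isIso_of_isZero (isZero_coh_of_deg_eq_bot (trunc_deg _ N K h))
      (hK i a fun h2 => h ⟨h2.2.1, h2.2.2.2⟩) _

lemma gTruncπ_qis {K : Com (IsFgE (k := k) (n := n))} (hK : hasSqCoh k n N K) :
    qis _ ((gTruncπ k n N).app K) := by
  rw [qis_iff]
  intro i a
  by_cases h : -N ≤ i ∧ -1 ≤ a
  · exact isIso_gTruncπ k n N K h.1 h.2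
  · have h2 : ¬ (-N ≤ i ∧ i ≤ N ∧ -1 ≤ a ∧ a ≤ 0) := fun h2 => h ⟨h2.1, h2.2.2.1⟩
    -- Outside the range the target of the projection has no cohomology, and neither has its source,
    -- whose cohomology is that of `K`.
    have h3 := (qis_iff _).mp (truncι_qis hK) i a
    exact isIso_of_isZero ((hK i a h2).of_iso (asIso ((coh _ i a).map
      ((truncι trunc_fg N).app K)))) (isZero_coh_of_deg_eq_bot (gSub_deg k n N K h2)) _

lemma truncBι_qis {K : ComB (IsSqE (k := k) (n := n))} (hK : hasSqCoh k n N ((inclCom k n).obj K)) :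
    qisB _ ((truncBι trunc_sq N).app K) := truncι_qis hK

lemma gTruncBπ_qis {K : ComB (IsSqE (k := k) (n := n))}
    (hK : hasSqCoh k n N ((inclCom k n).obj K)) :
    qisB _ ((gTruncBπ k n N).app K) := gTruncπ_qis hK

/-- All larger bounds are allowed, so that two complexes can be treated with a common bound. -/
lemma exists_hasSqCoh (K : ComB (IsSqE (k := k) (n := n))) :
    ∃ N, ∀ N', N ≤ N' → hasSqCoh k n N' ((inclCom k n).obj K) := by
  obtain ⟨b, hb⟩ := (isBounded_iff _).mp K.property
  refine ⟨b, fun N hN i a h => isZero_coh_of_deg_eq_bot ?_⟩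
  by_cases hi : b < |i|
  · exact GrMod.deg_eq_bot (hb i hi) a
  · refine (K.obj.X i).property.2 a ?_
    rintro F rfl
    refine h ⟨?_, ?_, neg_one_le_neg_ind F, neg_ind_nonpos F⟩
    · rcases abs_cases i with h | h <;> omega
    · rcases abs_cases i with h | h <;> omega

end
end Trunc

/-! ### Natural transformations between functors on localizations -/

section Localization

variable {C₁ C₂ C₃ : Type*} [Category C₁] [Category C₂] [Category C₃] {W₁ : MorphismProperty C₁}
  {W₂ : MorphismProperty C₂} {W₃ : MorphismProperty C₃}

/-- The functor induced by `F` on localizations is compatible with `F`. -/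
def derivedFac (F : C₁ ⥤ C₂) (h : W₁ ≤ W₂.inverseImage F) :
    W₁.Q ⋙ derived F h ≅ F ⋙ W₂.Q := Localization.fac (F ⋙ W₂.Q) _ W₁.Q

/-- The composition of two functors induced on localizations is compatible with the
composition. -/
def compFac {F : C₁ ⥤ C₂} {F' : W₁.Localization ⥤ W₂.Localization} (e : W₁.Q ⋙ F' ≅ F ⋙ W₂.Q)
    {G : C₂ ⥤ C₃} {G' : W₂.Localization ⥤ W₃.Localization} (e' : W₂.Q ⋙ G' ≅ G ⋙ W₃.Q) :
    W₁.Q ⋙ F' ⋙ G' ≅ (F ⋙ G) ⋙ W₃.Q :=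
  Functor.isoWhiskerRight e G' ≪≫ Functor.isoWhiskerLeft F e'

/-- The identity functor of the localization is compatible with the identity functor. -/
def idFac (W : MorphismProperty C₁) : W.Q ⋙ 𝟭 _ ≅ 𝟭 _ ⋙ W.Q := Iso.refl _

section
variable {F G : C₁ ⥤ C₂} {F' G' : W₁.Localization ⥤ W₂.Localization}
  (eF : W₁.Q ⋙ F' ≅ F ⋙ W₂.Q) (eG : W₁.Q ⋙ G' ≅ G ⋙ W₂.Q)

/-- The natural transformation on localizations induced by a natural transformation. -/
def natDer (τ : F ⟶ G) : F' ⟶ G' :=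
  (Localization.fullyFaithfulWhiskeringLeft W₁.Q W₁ _).preimage
    (eF.hom ≫ Functor.whiskerRight τ W₂.Q ≫ eG.inv)

lemma natDer_app (τ : F ⟶ G) (X : C₁) : (natDer eF eG τ).app (W₁.Q.obj X) =
    eF.hom.app X ≫ W₂.Q.map (τ.app X) ≫ eG.inv.app X := by
  have := (Localization.fullyFaithfulWhiskeringLeft W₁.Q W₁ W₂.Localization).map_preimage
    (eF.hom ≫ Functor.whiskerRight τ W₂.Q ≫ eG.inv)
  exact congrArg (fun σ => σ.app X) this

lemma exists_Q_obj (W : MorphismProperty C₁) (X : W.Localization) : ∃ Y, W.Q.obj Y = X :=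
  (Localization.Construction.objEquiv W).surjective X

lemma isIso_natDer_app (τ : F ⟶ G) (X : C₁) (h : W₂ (τ.app X)) :
    IsIso ((natDer eF eG τ).app (W₁.Q.obj X)) := by
  rw [natDer_app]
  have := Localization.inverts W₂.Q W₂ _ h
  infer_instance

/-- The natural isomorphism on localizations induced by a natural transformation `τ` such that
`τ X` belongs to the inverted class of morphisms for all `X`. -/
def isoDer (τ : F ⟶ G) (h : ∀ X, W₂ (τ.app X)) : F' ≅ G' :=
  have : IsIso (natDer eF eG τ) := by
    rw [NatTrans.isIso_iff_isIso_app]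
    intro X
    obtain ⟨X, rfl⟩ := exists_Q_obj W₁ X
    exact isIso_natDer_app eF eG τ X (h X)
  asIso (natDer eF eG τ)

end

end Localization

/-- A criterion for the bijectivity of `J` on morphisms, in terms of an inverse `t` of `J` up to
zigzags of natural transformations that are isomorphisms at the objects in question. -/
lemma bijective_map_of_zigzag {C D : Type*} [Category C] [Category D] (J : C ⥤ D) (t : D ⥤ C)
    (S : D ⥤ D) (a : S ⟶ 𝟭 D) (b : S ⟶ t ⋙ J) (S' : C ⥤ C) (a' : S' ⟶ 𝟭 C) (b' : S' ⟶ J ⋙ t)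
    (X Y : C) (h1 : ∀ Z, Z = X ∨ Z = Y → IsIso (a.app (J.obj Z)))
    (h2 : ∀ Z, Z = X ∨ Z = Y → IsIso (b.app (J.obj Z)))
    (h1' : ∀ Z, Z = X ∨ Z = Y → IsIso (a'.app Z))
    (h2' : ∀ Z, Z = X ∨ Z = Y → IsIso (b'.app Z)) :
    Function.Bijective (J.map : (X ⟶ Y) → _) := by
  have := h1 X (Or.inl rfl)
  have := h2 Y (Or.inr rfl)
  have := h1' X (Or.inl rfl)
  have := h1' Y (Or.inr rfl)
  have := h2' X (Or.inl rfl)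
  have := h2' Y (Or.inr rfl)
  constructor
  · intro f g h
    have e1 : S'.map f = S'.map g := by
      rw [← cancel_mono (b'.app Y), b'.naturality, b'.naturality, Functor.comp_map,
        Functor.comp_map, h]
    have e2 := a'.naturality f
    rw [e1, a'.naturality g] at e2
    exact ((cancel_epi _).mp e2).symm
  -- The functor `t` is injective on these morphisms: `t ⋙ J` is isomorphic to the identity at `J X`
  -- and `J Y` through `S`.
  · have ht : ∀ f g : J.obj X ⟶ J.obj Y, t.map f = t.map g → f = g := by
      intro f g h
      have e1 : S.map f = S.map g := by
        rw [← cancel_mono (b.app (J.obj Y)), b.naturality, b.naturality, Functor.comp_map,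
          Functor.comp_map, h]
      have e2 := a.naturality f
      rw [e1, a.naturality g] at e2
      exact ((cancel_epi _).mp e2).symm
    intro g
    -- The candidate is `t g`, carried back to `X ⟶ Y` along the zigzag from `J ⋙ t` to the
    -- identity. Naturality then gives `t (J f) = t g`, and `ht` concludes.
    let f : X ⟶ Y := inv (a'.app X) ≫ b'.app X ≫ t.map g ≫ inv (b'.app Y) ≫ a'.app Y
    refine ⟨f, ht _ _ ?_⟩
    have e1 : S'.map f = b'.app X ≫ t.map g ≫ inv (b'.app Y) := by
      have := a'.naturality f
      rw [Functor.id_map] at this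
      rw [← cancel_mono (a'.app Y), this]
      simp [f]
    have e2 := b'.naturality f
    rw [e1] at e2
    simp only [Category.assoc, IsIso.inv_hom_id, Category.comp_id, Functor.comp_map] at e2
    exact ((cancel_epi _).mp e2).symm

/-! ### Full faithfulness and essential image of the canonical functor -/

section Incl

variable {k : Type u} [Field k] {n : ℕ}

section
variable {A : Type u} [Ring A] [Algebra k A] {𝒜 : (Fin n → ℤ) → Submodule k A}
  (P : ObjectProperty (GrMod 𝒜))

/-- The cohomology of a complex computes the cohomology functor on the derived category. -/
def cohIso (i : ℤ) (a : Fin n → ℤ) (K : Com P) :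
    (cohomology P i a).obj ((qis P).Q.obj K) ≅ (coh P i a).obj K :=
  (Localization.fac (W := qis P) (coh P i a) _ (qis P).Q).app K

end

lemma isDbSqE_of_iso {X Y : Der (IsFgE (k := k) (n := n))} (e : X ≅ Y) (h : isDbSqE k n X) :
    isDbSqE k n Y := by
  have e' := fun i a => (cohomology (IsFgE (k := k) (n := n)) i a).mapIso e
  obtain ⟨⟨b, hb⟩, h2⟩ := h
  refine ⟨⟨b, fun i hi a => (hb i hi a).of_iso (e' i a).symm⟩, fun i a => ⟨?_, fun h =>
    ((h2 i a).2 h).of_iso (e' i a).symm⟩⟩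
  have := (h2 i a).1
  exact Module.Finite.equiv (e' i a).toLinearEquiv

lemma isDbSqE_inclDer (X : DerB (IsSqE (k := k) (n := n))) : isDbSqE k n ((inclDer k n).obj X) := by
  obtain ⟨K, rfl⟩ := exists_Q_obj _ X
  refine isDbSqE_of_iso ((derivedFac (inclCom k n) (inclCom_qis k n)).app K).symm ?_
  have e := fun i a => cohIso IsFgE i a ((inclCom k n).obj K)
  obtain ⟨N, hN⟩ := exists_hasSqCoh K
  refine ⟨⟨N, fun i hi a => (hN N le_rfl i a ?_).of_iso (e i a)⟩, fun i a => ⟨?_, fun h =>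
    (hN N le_rfl i a ?_).of_iso (e i a)⟩⟩
  · rintro ⟨h1, h2, -⟩
    rcases abs_cases i with h | h <;> omega
  · have h1 := finite_of_finiteE _ (K.obj.X i).property.1
    have : Module.Finite k ((coh IsFgE i a).obj ((inclCom k n).obj K)) :=
      finite_homology i (inferInstanceAs (Module.Finite k ((K.obj.X i).obj.deg a)))
    exact Module.Finite.equiv (e i a).symm.toLinearEquiv
  · rintro ⟨-, -, h1, h2⟩
    obtain ⟨F, hF⟩ := exists_ind h2 h1
    exact h F hF

lemma exists_hasSqCoh_of_isDbSqE {K : Com (IsFgE (k := k) (n := n))}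
    (h : isDbSqE k n ((qis _).Q.obj K)) : ∃ N, hasSqCoh k n N K := by
  obtain ⟨⟨b, hb⟩, h2⟩ := h
  refine ⟨b, fun i a h => ?_⟩
  by_cases hi : b < |i|
  · exact (hb i hi a).of_iso (cohIso _ i a K).symm
  · refine ((h2 i a).2 ?_).of_iso (cohIso _ i a K).symm
    rintro F rfl
    refine h ⟨?_, ?_, neg_one_le_neg_ind F, neg_ind_nonpos F⟩
    · rcases abs_cases i with h | h <;> omega
    · rcases abs_cases i with h | h <;> omega

variable (k n)

/-- A common bound `N` for the cohomology of both complexes is fixed. The functor induced by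
`gTrunc` then inverts the canonical functor at these two objects, through the zigzags of `trunc` and
`truncB`. -/
lemma inclDer_bijective (X Y : DerB (IsSqE (k := k) (n := n))) :
    Function.Bijective ((inclDer k n).map : (X ⟶ Y) → _) := by
  obtain ⟨K, rfl⟩ := exists_Q_obj _ X
  obtain ⟨L, rfl⟩ := exists_Q_obj _ Y
  obtain ⟨N₁, h₁⟩ := exists_hasSqCoh K
  obtain ⟨N₂, h₂⟩ := exists_hasSqCoh L
  let N := max N₁ N₂
  let eJ := derivedFac (inclCom k n) (inclCom_qis k n)
  let eG := derivedFac (gTrunc k n N) (gTrunc_qis k n N)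
  let eT := derivedFac (trunc IsFgE trunc_fg N) (trunc_qis (k := k) (n := n) trunc_fg N)
  let eB := derivedFac (truncB trunc_sq N) (truncB_qis (k := k) (n := n) trunc_sq N)
  have key : ∀ Z, Z = (qisB IsSqE).Q.obj K ∨ Z = (qisB IsSqE).Q.obj L →
      ∃ M : ComB (IsSqE (k := k) (n := n)), Z = (qisB IsSqE).Q.obj M ∧
        hasSqCoh k n N ((inclCom k n).obj M) := by
    rintro Z (rfl | rfl)
    · exact ⟨K, rfl, h₁ _ (le_max_left _ _)⟩
    · exact ⟨L, rfl, h₂ _ (le_max_right _ _)⟩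
  -- The image of `Q M` under the induced functor is only isomorphic to `Q` of the underlying
  -- complex of `M`, so invertibility is transported along that isomorphism.
  have aux : ∀ {S T : Der (IsFgE (k := k) (n := n)) ⥤ Der (IsFgE (k := k) (n := n))} (τ : S ⟶ T)
      (M : ComB (IsSqE (k := k) (n := n))),
      IsIso (τ.app ((qis _).Q.obj ((inclCom k n).obj M))) →
      IsIso (τ.app ((inclDer k n).obj ((qisB _).Q.obj M))) := by
    intro S T τ M h
    exact (isIso_of_comm_sq (τ.naturality (eJ.hom.app M)).symm).mpr h
  refine bijective_map_of_zigzag (inclDer k n) _ _ (natDer eT (idFac _) (truncι trunc_fg N))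
    (natDer eT (compFac eG eJ) (gTruncπ k n N)) _ (natDer eB (idFac _) (truncBι trunc_sq N))
    (natDer eB (compFac eJ eG) (gTruncBπ k n N)) _ _ ?_ ?_ ?_ ?_
  all_goals
    intro Z hZ
    obtain ⟨M, rfl, hM⟩ := key Z hZ
  · exact aux _ M (isIso_natDer_app _ _ _ _ (truncι_qis hM))
  · exact aux _ M (isIso_natDer_app _ _ _ _ (gTruncπ_qis hM))
  · exact isIso_natDer_app _ _ _ _ (truncBι_qis hM)
  · exact isIso_natDer_app _ _ _ _ (gTruncBπ_qis hM)

instance : (inclDer k n).Full where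
  map_surjective := (inclDer_bijective k n _ _).2

instance : (inclDer k n).Faithful where
  map_injective h := (inclDer_bijective k n _ _).1 h

/-- A complex with bounded squarefree cohomology is linked by the two truncation arrows, both
quasi-isomorphisms, to a bounded complex of squarefree modules. -/
lemma essImage_inclDer : (inclDer k n).essImage = isDbSqE k n := by
  ext X
  constructor
  · rintro ⟨Y, ⟨e⟩⟩
    exact isDbSqE_of_iso e (isDbSqE_inclDer Y)
  · intro hX
    obtain ⟨K, rfl⟩ := exists_Q_obj _ X
    obtain ⟨N, hN⟩ := exists_hasSqCoh_of_isDbSqE hX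
    have h1 := Localization.inverts (qis IsFgE).Q (qis (IsFgE (k := k) (n := n))) _ (truncι_qis hN)
    have h2 := Localization.inverts (qis IsFgE).Q (qis (IsFgE (k := k) (n := n))) _ (gTruncπ_qis hN)
    exact ⟨(qisB _).Q.obj ((gTrunc k n N).obj K),
      ⟨(derivedFac (inclCom k n) (inclCom_qis k n)).app _ ≪≫ (asIso ((qis IsFgE).Q.map
        ((gTruncπ k n N).app K))).symm ≪≫ asIso ((qis IsFgE).Q.map ((truncι trunc_fg N).app K))⟩⟩

end Incl

/-! ### Multiplication of monomials in the exterior algebra -/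

section Exterior

variable {k : Type u} [Field k] {n : ℕ}

lemma eF_eq_prod (T : Finset (Fin n)) : eF k n T = ((T.sort (· ≤ ·)).map (e k n)).prod := by
  rw [eF, ExteriorAlgebra.basis_apply_ofCard (n := T.card) _ rfl]
  simp only [ExteriorAlgebra.ιMulti_family, ExteriorAlgebra.ιMulti_apply,
    Set.powersetCard.ofFinEmbEquiv_symm_apply]
  congr 1
  refine List.ext_getElem (by simp) fun i h1 h2 => ?_
  simp [e, Finset.orderEmbOfFin_apply, Set.powersetCard.ofCard]

lemma eF_empty : eF k n ∅ = 1 := by simp [eF_eq_prod]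

lemma e_mul_eF_of_lt {l : Fin n} {T : Finset (Fin n)} (h : ∀ m ∈ T, l < m) :
    e k n l * eF k n T = eF k n (insert l T) := by
  rw [eF_eq_prod, eF_eq_prod, Finset.sort_insert _ (fun m hm => (h m hm).le)
    (fun hl => lt_irrefl _ (h l hl)), List.map_cons, List.prod_cons]

lemma alpha_eq_zero {l : Fin n} {T : Finset (Fin n)} (h : ∀ m ∈ T, l < m) : alpha l T = 0 := by
  rw [alpha, Finset.card_eq_zero, Finset.filter_eq_empty_iff]
  exact fun m hm => (h m hm).not_gt

/-- Induction by inserting a smallest element `m`: if `l < m`, the product is already ordered;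
otherwise `e_l` passes `e_m` at the cost of one sign, which is the contribution of `m` to `α(l, T)`.
-/
lemma e_mul_eF (l : Fin n) (T : Finset (Fin n)) (h : l ∉ T) :
    e k n l * eF k n T = (-1 : k) ^ alpha l T • eF k n (insert l T) := by
  induction T using Finset.induction_on_min with
  | empty => rw [e_mul_eF_of_lt (by simp), alpha_eq_zero (by simp), pow_zero, one_smul]
  | insert m T hm ih =>
    have hmT : m ∉ T := fun h => lt_irrefl _ (hm m h)
    have hlT : l ∉ T := fun h' => h (Finset.mem_insert_of_mem h')
    have hlm : l ≠ m := fun h' => h (h' ▸ Finset.mem_insert_self _ _)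
    rcases lt_or_gt_of_ne hlm with h1 | h1
    · have h2 : ∀ p ∈ insert m T, l < p := by
        intro p hp
        rcases Finset.mem_insert.mp hp with rfl | hp
        · exact h1
        · exact h1.trans (hm p hp)
      rw [e_mul_eF_of_lt h2, alpha_eq_zero h2, pow_zero, one_smul]
    · have h2 : ∀ p ∈ insert l T, m < p := by
        intro p hp
        rcases Finset.mem_insert.mp hp with rfl | hp
        · exact h1
        · exact hm p hp
      rw [← e_mul_eF_of_lt hm, ← mul_assoc, e_anti, neg_mul, mul_assoc, ih hlT, mul_smul_comm,
        e_mul_eF_of_lt h2, alpha_insert hmT, if_pos h1, pow_succ, mul_neg_one, neg_smul,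
        Finset.insert_comm]

lemma e_mul_eF_of_mem (l : Fin n) (T : Finset (Fin n)) (h : l ∈ T) : e k n l * eF k n T = 0 := by
  have h1 := e_mul_eF (k := k) l (T.erase l) (Finset.notMem_erase _ _)
  rw [Finset.insert_erase h] at h1
  have h2 : eF k n T = (-1 : k) ^ alpha l (T.erase l) • (e k n l * eF k n (T.erase l)) := by
    rw [h1, smul_smul, ← mul_pow]; simp
  rw [h2, mul_smul_comm, ← mul_assoc, e_sq, zero_mul, smul_zero]

/-- The product `e_l e_T` is a multiple of `e_{T ∪ {l}}`. -/
lemma exists_e_mul_eF (l : Fin n) (T : Finset (Fin n)) :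
    ∃ c : k, e k n l * eF k n T = c • eF k n (insert l T) ∧ (l ∈ T → c = 0) := by
  by_cases h : l ∈ T
  · exact ⟨0, by rw [e_mul_eF_of_mem l T h, zero_smul], fun _ => rfl⟩
  · exact ⟨_, e_mul_eF l T h, fun h' => absurd h' h⟩

/-- The factor `e_l` anticommutes past each of the `|T|` factors. The case `l ∈ T` needs no
distinction. -/
lemma eF_mul_e (l : Fin n) (T : Finset (Fin n)) :
    eF k n T * e k n l = (-1 : k) ^ T.card • (e k n l * eF k n T) := by
  induction T using Finset.induction_on_min with
  | empty => simp [eF_empty]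
  | insert m T hm ih =>
    have hmT : m ∉ T := fun h => lt_irrefl _ (hm m h)
    rw [← e_mul_eF_of_lt hm, mul_assoc, ih, mul_smul_comm, ← mul_assoc, e_anti m l, neg_mul,
      Finset.card_insert_of_notMem hmT, pow_succ, mul_neg_one, neg_smul, smul_neg, mul_assoc]

end Exterior

/-! ### Multiplication by variables on squarefree modules -/

section Squarefree

variable {k : Type u} [Field k] {n : ℕ}

lemma exists_toZ {a : Fin n → ℤ} (h : 0 ≤ a) : ∃ b : Fin n →₀ ℕ, toZ b = a :=
  ⟨Finsupp.equivFunOnFinite.symm fun i => (a i).toNat, funext fun i => by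
    have := h i
    simp only [Pi.zero_apply] at this
    simp [toZ, this]⟩

/-- As `a_l ≥ 1`, adding `ε_l` does not change the support. If `a` is not in `ℕⁿ`, then `a + ε_l` is
not either, and both components are zero. -/
lemma IsSqS.bijOn_X {M : GrMod (grS k n)} (hM : IsSqS M) (l : Fin n) {a : Fin n → ℤ}
    (ha : 1 ≤ a l) : Set.BijOn (fun y : M => (MvPolynomial.X l : S k n) • y)
      (M.deg a) (M.deg (a + eps l)) := by
  by_cases h : 0 ≤ a
  · obtain ⟨b, rfl⟩ := exists_toZ h
    have := hM.bij b (Finsupp.single l 1) (by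
      rw [toZ_single]
      exact supp_add_eps_ne (by omega))
    rwa [toZ_single] at this
  · have h2 : ¬ 0 ≤ a + eps l := by
      intro h2
      refine h fun i => ?_
      by_cases hi : i = l
      · subst hi; simp only [Pi.zero_apply]; omega
      · simpa [hi] using h2 i
    rw [hM.nonneg a h, hM.nonneg _ h2]
    simp [Set.bijOn_singleton]

/-- The inverses of `x_l` in the single degrees are glued along the direct sum to one linear map, so
that division by `x_l` can be applied to whole equations. -/
lemma exists_divX {M : GrMod (grS k n)} (hM : IsSqS M) (l : Fin n) : ∃ r : M →ₗ[k] M,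
    ∀ a : Fin n → ℤ, 1 ≤ a l → ∀ u ∈ M.deg a, r ((MvPolynomial.X l : S k n) • u) = u := by
  have key : ∀ b : Fin n → ℤ, ∃ g : M.deg b →ₗ[k] M, 2 ≤ b l → ∀ u ∈ M.deg (b - eps l),
      ∀ h : (MvPolynomial.X l : S k n) • u ∈ M.deg b, g ⟨_, h⟩ = u := by
    intro b
    by_cases hb : 2 ≤ b l
    · have h1 := hM.bijOn_X l (a := b - eps l) (by simp; omega)
      rw [sub_add_cancel] at h1
      let φ : M.deg (b - eps l) →ₗ[k] M.deg b := (mulX M l).restrict h1.mapsTo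
      have hφ : Function.Bijective φ := by
        constructor
        · intro x y hxy
          exact Subtype.ext (h1.injOn x.2 y.2 (congrArg Subtype.val hxy))
        · intro y
          obtain ⟨x, hx, e1⟩ := h1.surjOn y.2
          exact ⟨⟨x, hx⟩, Subtype.ext e1⟩
      refine ⟨(M.deg (b - eps l)).subtype ∘ₗ (LinearEquiv.ofBijective φ hφ).symm.toLinearMap,
        fun _ u hu h => ?_⟩
      have : (LinearEquiv.ofBijective φ hφ) ⟨u, hu⟩ = ⟨_, h⟩ := rfl
      simp [← this]
    · exact ⟨0, fun h => absurd h hb⟩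
  choose g hg using key
  refine ⟨M.lift g, fun a ha u hu => ?_⟩
  have h1 := X_smul_mem M l hu
  rw [M.lift_of_mem _ h1]
  refine hg (a + eps l) (by simp; omega) u ?_ h1
  rwa [add_sub_cancel_right]

end Squarefree

/-! ### Elements of `ℛ(M)` by their values on monomials -/

section BGG

variable {k : Type u} [Field k] {n : ℕ} {M N : Com (IsSqS (k := k) (n := n))}

lemma coind_ext {V : Type u} [AddCommGroup V] [Module k V] {f g : CoInd k n V}
    (h : ∀ T, f (eF k n T) = g (eF k n T)) : f = g := (eF k n).ext h

lemma rAmb_ext {f g : RAmb M} (h : ∀ j T, f j (eF k n T) = g j (eF k n T)) : f = g :=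
  funext fun j => coind_ext (h j)

lemma mem_rPiece {i : ℤ} {c : Fin n → ℤ} {f : RAmb M} : f ∈ rPiece M i c ↔
    ∀ j T, f j (eF k n T) ∈ (M.X j).obj.deg (-ind T + 1 + c) ∧
      (j + tot (-ind T + 1 + c) ≠ i → f j (eF k n T) = 0) := by
  constructor
  · intro h j T
    exact h j _ _ (eF_mem T)
  · intro h j b s hs
    induction hs using Submodule.span_induction with
    | zero => simp
    | mem x hx => obtain ⟨T, rfl, rfl⟩ := hx; exact h j T
    | add x y _ _ h1 h2 =>
      rw [map_add]
      exact ⟨Submodule.add_mem _ h1.1 h2.1, fun h => by rw [h1.2 h, h2.2 h, add_zero]⟩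
    | smul r x _ h1 =>
      rw [map_smul]
      exact ⟨Submodule.smul_mem _ _ h1.1, fun h => by rw [h1.2 h, smul_zero]⟩

/-- The element of `∏_j Hom_k(E, M^j)` with prescribed values on monomials. -/
def rOf (g : ∀ j : ℤ, Finset (Fin n) → (M.X j).obj) : RAmb M :=
  fun j => ((eF k n).constr k (g j) : E k n →ₗ[k] (M.X j).obj)

lemma rOf_apply (g : ∀ j : ℤ, Finset (Fin n) → (M.X j).obj) (j : ℤ) (T : Finset (Fin n)) :
    rOf g j (eF k n T) = g j T := (eF k n).constr_basis k (g j) T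

lemma rDiff_apply (i : ℤ) (f : RAmb M) (j : ℤ) (s : E k n) :
    rDiff M i f j s = ∑ l, (MvPolynomial.X l : S k n) • f j (e k n l * s) +
      (i.negOnePow : ℤ) • (M.d (j - 1) j).hom.lin (f (j - 1) s) := rFun_apply M i f j s

/-- The value at `e_T` has degree `-T + 𝟏 + c`, whose `l`-th entry is negative when `c_l ≤ -2`. -/
lemma rPiece_eq_bot (i : ℤ) {c : Fin n → ℤ} (hc : ¬ -1 ≤ c) : rPiece M i c = ⊥ := by
  rw [eq_bot_iff]
  intro f hf
  refine rAmb_ext fun j T => ?_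
  have h1 := (mem_rPiece.mp hf j T).1
  rw [(M.X j).property.nonneg, Submodule.mem_bot] at h1
  · exact h1
  · intro h
    refine hc fun l => ?_
    have := h l
    simp only [ind, Pi.add_apply, Pi.neg_apply, Pi.one_apply, Pi.zero_apply] at this ⊢
    split_ifs at this <;> omega

/-! #### Acyclicity in the degrees that are not squarefree -/

lemma neg_ind_insert {T : Finset (Fin n)} {l : Fin n} (h : l ∉ T) (c : Fin n → ℤ) :
    -ind (insert l T) + 1 + c + eps l = -ind T + 1 + c := by
  rw [ind_insert h]; abel

/-- Since `c_l ≥ 1`, all values of `f` lie in degrees with `l`-th entry at least `1`, and at least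
`2` on the `e_T` with `l ∉ T`; there `x_l` can be divided out. Setting `g(e_l e_T) = x_l⁻¹ f(e_T)`
for `l ∉ T`, and `g = 0` on the monomials without `e_l`, inverts the summand `x_l f(e_l ·)` of the
differential. -/
lemma rPiece_acyclic (i : ℤ) {c : Fin n → ℤ} {l : Fin n} (hc : 1 ≤ c l) {f : RAmb M}
    (hf : f ∈ rPiece M (i + 1) c) (hd : rDiff M (i + 1) f = 0) :
    ∃ g ∈ rPiece M i c, rDiff M i g = f := by
  choose r hr using fun j => exists_divX (M.X j).property l
  have hf' := mem_rPiece.mp hf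
  -- the values of `f` in which `l` does not occur are divisible by `x_l`
  have hdiv : ∀ j T, l ∉ T → ∃ u ∈ (M.X j).obj.deg (-ind (insert l T) + 1 + c),
      (MvPolynomial.X l : S k n) • u = f j (eF k n T) := by
    intro j T hT
    have h1 := (M.X j).property.bijOn_X l (a := -ind (insert l T) + 1 + c) (by
      simp [ind]; omega)
    rw [neg_ind_insert hT] at h1
    exact h1.surjOn (hf' j T).1
  have hl : ∀ T : Finset (Fin n), 1 ≤ (-ind T + 1 + c) l := by
    intro T
    simp only [ind, Pi.add_apply, Pi.neg_apply, Pi.one_apply]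
    split_ifs <;> omega
  -- The sign is that of `e_l e_{T∖l} = ± e_T`, so that `g(e_l e_T) = x_l⁻¹ f(e_T)` holds without a
  -- sign.
  let g : RAmb M := rOf fun j T =>
    if l ∈ T then (-1 : k) ^ alpha l (T.erase l) • r j (f j (eF k n (T.erase l))) else 0
  have hg0 : ∀ j T, l ∉ T → g j (eF k n T) = 0 := fun j T hT => by
    rw [rOf_apply, if_neg hT]
  have hg1 : ∀ j T, l ∉ T → g j (eF k n (insert l T)) =
      (-1 : k) ^ alpha l T • r j (f j (eF k n T)) := fun j T hT => by
    rw [rOf_apply, if_pos (Finset.mem_insert_self _ _), Finset.erase_insert hT]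
  have hg2 : ∀ j T, l ∉ T → g j (e k n l * eF k n T) = r j (f j (eF k n T)) := fun j T hT => by
    rw [e_mul_eF l T hT, map_smul, hg1 j T hT, smul_smul, ← mul_pow]
    simp
  refine ⟨g, mem_rPiece.mpr fun j T => ?_, ?_⟩
  · by_cases hT : l ∈ T
    · obtain ⟨T, hT', rfl⟩ : ∃ T', l ∉ T' ∧ T = insert l T' :=
        ⟨T.erase l, Finset.notMem_erase _ _, (Finset.insert_erase hT).symm⟩
      obtain ⟨u, hu, e1⟩ := hdiv j T hT'
      rw [hg1 j T hT', ← e1, hr j _ (hl _) u hu]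
      refine ⟨Submodule.smul_mem _ _ hu, fun h => ?_⟩
      have h2 := (hf' j T).2 (by
        rw [← neg_ind_insert hT', tot_add _ (eps l), tot_eps]
        omega)
      rw [← hr j _ (hl _) u hu, e1, h2, map_zero, smul_zero]
    · rw [hg0 j T hT]
      exact ⟨Submodule.zero_mem _, fun _ => rfl⟩
  · refine rAmb_ext fun j T => ?_
    by_cases hT : l ∈ T
    · obtain ⟨T, hT', rfl⟩ : ∃ T', l ∉ T' ∧ T = insert l T' :=
        ⟨T.erase l, Finset.notMem_erase _ _, (Finset.insert_erase hT).symm⟩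
      -- Exchanging `e_m` and `e_l` produces the sign, and multiplication by `x_m` commutes with
      -- division by `x_l`.
      have h1 : ∀ m, m ≠ l → (MvPolynomial.X m : S k n) • g j (e k n m * (e k n l * eF k n T)) =
          -r j ((MvPolynomial.X m : S k n) • f j (e k n m * eF k n T)) := by
        intro m hm
        obtain ⟨x, e1, -⟩ := exists_e_mul_eF (k := k) m T
        have h2 : l ∉ insert m T := by simp [Ne.symm hm, hT']
        obtain ⟨u, hu, e2⟩ := hdiv j _ h2
        have h3 : 1 ≤ (-ind (insert l (insert m T)) + 1 + c + eps m) l := by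
          have h4 := hl (insert l (insert m T))
          have h5 : (eps m : Fin n → ℤ) l = 0 := Pi.single_eq_of_ne (Ne.symm hm) 1
          rw [Pi.add_apply _ (eps m), h5, add_zero]
          exact h4
        have h4 : f j (e k n m * eF k n T) = x • ((MvPolynomial.X l : S k n) • u) := by
          rw [e1, map_smul, e2]
        have h5 : g j (e k n m * (e k n l * eF k n T)) = -(x • u) := by
          rw [← mul_assoc, e_anti, neg_mul, mul_assoc, e1, mul_smul_comm, map_neg, map_smul,
            hg2 j _ h2, ← e2, hr j _ (hl _) u hu]
        have h6 : (MvPolynomial.X m : S k n) • x • (MvPolynomial.X l : S k n) • u =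
            x • (MvPolynomial.X l : S k n) • (MvPolynomial.X m : S k n) • u := by
          rw [smul_comm _ x, smul_comm (MvPolynomial.X m : S k n)]
        rw [h5, h4, h6, (r j).map_smul, hr j _ h3 _ (X_smul_mem _ m hu), smul_neg, smul_comm _ x]
      have h2 : (M.d (j - 1) j).hom.lin (g (j - 1) (e k n l * eF k n T)) =
          r j ((M.d (j - 1) j).hom.lin (f (j - 1) (eF k n T))) := by
        obtain ⟨u, hu, e2⟩ := hdiv (j - 1) T hT'
        rw [hg2 _ T hT', ← e2, hr _ _ (hl _) u hu, map_smul, hr j _ (hl _) _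
          ((M.d (j - 1) j).hom.map_deg _ _ hu)]
      -- The equation `(d f)(e_T) = 0` is divided by `x_l`. Its summand for `l` becomes `f(e_l
      -- e_T)`, and the remaining terms are, up to sign, those of `(d g)(e_l e_T)`; the signs agree
      -- because the differentials of `f` and `g` sit in consecutive cohomological degrees.
      have h3 := congrArg (r j) (congrArg (fun F : RAmb M => F j (eF k n T)) hd)
      have h4 : f j (e k n l * eF k n T) ∈ (M.X j).obj.deg (-ind (insert l T) + 1 + c) := by
        rw [e_mul_eF l T hT', map_smul]
        exact Submodule.smul_mem _ _ (hf' j _).1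
      simp only [rDiff_apply, map_add, map_sum, map_zsmul, Pi.zero_apply, CoInd.zero_apply,
        map_zero] at h3
      rw [← Finset.add_sum_erase _ _ (Finset.mem_univ l), hr j _ (hl _) _ h4, Int.negOnePow_succ,
        Units.val_neg, neg_smul, add_neg_eq_zero] at h3
      have h5 : rDiff M i g j (e k n l * eF k n T) = f j (e k n l * eF k n T) := by
        rw [rDiff_apply, h2, ← h3, ← Finset.add_sum_erase _ _ (Finset.mem_univ l), ← mul_assoc,
          e_sq, zero_mul, map_zero, smul_zero, zero_add,
          Finset.sum_congr rfl fun m hm => h1 m (Finset.ne_of_mem_erase hm),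
          Finset.sum_neg_distrib]
        abel
      have h6 : eF k n (insert l T) = (-1 : k) ^ alpha l T • (e k n l * eF k n T) := by
        rw [e_mul_eF l T hT', smul_smul, ← mul_pow]; simp
      rw [h6, map_smul, map_smul, h5]
    -- For `l ∉ T` only the summand `x_l g(e_l e_T) = f(e_T)` survives, since `g` vanishes on
    -- monomials not involving `e_l`.
    · rw [rDiff_apply, Finset.sum_eq_single l, hg2 j T hT, hg0 _ T hT, map_zero, smul_zero, add_zero]
      · obtain ⟨u, hu, e1⟩ := hdiv j T hT
        rw [← e1, hr j _ (hl _) u hu]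
      · intro m _ hm
        obtain ⟨x, e1, -⟩ := exists_e_mul_eF (k := k) m T
        rw [e1, map_smul, hg0 j _ (by simp [Ne.symm hm, hT]), smul_zero, smul_zero]
      · simp

end BGG

/-! #### The functor `ℛ` preserves quasi-isomorphisms -/

section BGG

variable {k : Type u} [Field k] {n : ℕ} {M N : Com (IsSqS (k := k) (n := n))}

lemma rDiff_apply_succ (i : ℤ) (f : RAmb M) (j : ℤ) (s : E k n) :
    rDiff M i f (j + 1) s = ∑ l, (MvPolynomial.X l : S k n) • f (j + 1) (e k n l * s) +
      (i.negOnePow : ℤ) • (M.d j (j + 1)).hom.lin (f j s) := by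
  rw [rDiff_apply]
  have : ∀ j', j' = j → (M.d j' (j + 1)).hom.lin (f j' s) = (M.d j (j + 1)).hom.lin (f j s) := by
    rintro _ rfl; rfl
  rw [this _ (add_sub_cancel_right j 1)]

/-- On monomials of maximal degree the differential of `ℛ(M)` is that of `M`, up to sign. -/
lemma rDiff_top {p : ℕ} {f : RAmb M} (hf : ∀ j T, p + 1 ≤ T.card → f j (eF k n T) = 0) (i j : ℤ)
    {T : Finset (Fin n)} (hT : p ≤ T.card) :
    rDiff M i f (j + 1) (eF k n T) =
      (i.negOnePow : ℤ) • (M.d j (j + 1)).hom.lin (f j (eF k n T)) := by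
  rw [rDiff_apply_succ, Finset.sum_eq_zero, zero_add]
  intro l _
  obtain ⟨x, e1, h⟩ := exists_e_mul_eF (k := k) l T
  rw [e1, map_smul]
  by_cases hl : l ∈ T
  · rw [h hl, zero_smul, smul_zero]
  · rw [hf, smul_zero, smul_zero]
    rw [Finset.card_insert_of_notMem hl]
    omega

lemma negOnePow_smul_smul {V : Type*} [AddCommGroup V] (i : ℤ) (v : V) :
    (i.negOnePow : ℤ) • (i.negOnePow : ℤ) • v = v := by
  rw [smul_smul, ← Units.val_mul, Int.units_mul_self, Units.val_one, one_smul]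

/-- This is exactness of the cone of `ℛ(φ)`, for cycles `(x, y)` that vanish on all `e_T` with `|T|
≥ p`. On the `e_T` with `|T| = p` the part of the differential involving the variables drops out, so
the values there form a cycle of the cone of `φ`. Solving in that cone and subtracting the boundary
lowers `p`. -/
lemma rMap_cone (φ : M ⟶ N) (hφ : qis IsSqS φ) (i : ℤ) (c : Fin n → ℤ) (p : ℕ) :
    ∀ x ∈ rPiece M (i + 1 + 1) c, ∀ y ∈ rPiece N (i + 1) c,
      (∀ j T, p ≤ T.card → x j (eF k n T) = 0) → (∀ j T, p ≤ T.card → y j (eF k n T) = 0) →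
      rDiff M (i + 1 + 1) x = 0 → rMap φ x = rDiff N (i + 1) y →
      ∃ z ∈ rPiece M (i + 1) c, ∃ w ∈ rPiece N i c,
        rDiff M (i + 1) z = x ∧ y = rMap φ z + rDiff N i w := by
  induction p with
  | zero =>
    intro x _ y _ hx hy _ _
    refine ⟨0, Submodule.zero_mem _, 0, Submodule.zero_mem _, ?_, ?_⟩
    · rw [map_zero]
      exact (rAmb_ext fun j T => hx j T (Nat.zero_le _)).symm
    · rw [map_zero, map_zero, add_zero]
      exact rAmb_ext fun j T => hy j T (Nat.zero_le _)
  | succ p ih =>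
    intro x hx y hy hx0 hy0 hdx hxy
    -- In `ℛⁱ`, the value at `e_T` can be nonzero only for `j = i - ‖-T + 𝟏 + c‖`, so each `T`
    -- involves a single complex degree.
    let q : Finset (Fin n) → ℤ := fun T => i - tot (-ind T + 1 + c)
    have key : ∀ T : Finset (Fin n), T.card = p →
        ∃ z ∈ (M.X (q T + 1)).obj.deg (-ind T + 1 + c), ∃ w ∈ (N.X (q T)).obj.deg (-ind T + 1 + c),
          (M.d (q T + 1) (q T + 1 + 1)).hom.lin z =
            ((i + 1).negOnePow : ℤ) • x (q T + 1 + 1) (eF k n T) ∧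
          y (q T + 1) (eF k n T) = (φ.f (q T + 1)).hom.lin z + (N.d (q T) (q T + 1)).hom.lin w := by
      intro T hT
      refine (qis_iff_cone φ).mp hφ _ _ _ (zsmul_mem (mem_rPiece.mp hx _ T).1 _) _
        (mem_rPiece.mp hy _ T).1 ?_ ?_
      · have h1 := rDiff_top hx0 (i + 1 + 1) (q T + 1 + 1) hT.ge
        rw [hdx] at h1
        have h2 := congrArg (((i + 1 + 1).negOnePow : ℤ) • ·) h1.symm
        simp only [negOnePow_smul_smul] at h2
        rw [map_zsmul, h2]
        change _ • _ • (0 : (M.X _).obj) = 0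
        rw [smul_zero, smul_zero]
      · have h1 := rDiff_top hy0 (i + 1) (q T + 1) hT.ge
        rw [← hxy, rMap_apply] at h1
        rw [map_zsmul, h1, negOnePow_smul_smul]
    choose z hz w hw e1 e2 using key
    -- The solutions found for the single `T` with `|T| = p` are placed in the only possible degree
    -- `j` and extended by zero. The signs compensate those in the differential of `ℛ`.
    let Z : RAmb M := rOf fun j T => if h : T.card = p then
      Pi.single (M := fun j => (M.X j).obj) (q T + 1) (z T h) j else 0
    let W : RAmb N := rOf fun j T => if h : T.card = p then
      Pi.single (M := fun j => (N.X j).obj) (q T) ((i.negOnePow : ℤ) • w T h) j else 0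
    have hZ : Z ∈ rPiece M (i + 1) c := mem_rPiece.mpr fun j T => by
      rw [rOf_apply]
      split_ifs with h
      · by_cases hj : j = q T + 1
        · subst hj
          rw [Pi.single_eq_same]
          refine ⟨hz T h, fun h1 => absurd ?_ h1⟩
          simp only [q]; ring
        · rw [Pi.single_eq_of_ne hj]
          exact ⟨Submodule.zero_mem _, fun _ => rfl⟩
      · exact ⟨Submodule.zero_mem _, fun _ => rfl⟩
    have hW : W ∈ rPiece N i c := mem_rPiece.mpr fun j T => by
      rw [rOf_apply]
      split_ifs with h
      · by_cases hj : j = q T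
        · subst hj
          rw [Pi.single_eq_same]
          refine ⟨zsmul_mem (hw T h) _, fun h1 => absurd ?_ h1⟩
          simp only [q]; ring
        · rw [Pi.single_eq_of_ne hj]
          exact ⟨Submodule.zero_mem _, fun _ => rfl⟩
      · exact ⟨Submodule.zero_mem _, fun _ => rfl⟩
    have hZ0 : ∀ j T, p + 1 ≤ T.card → Z j (eF k n T) = 0 := fun j T hT => by
      rw [rOf_apply, dif_neg (by omega)]
    have hW0 : ∀ j T, p + 1 ≤ T.card → W j (eF k n T) = 0 := fun j T hT => by
      rw [rOf_apply, dif_neg (by omega)]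
    have hx' : x - rDiff M (i + 1) Z ∈ rPiece M (i + 1 + 1) c :=
      Submodule.sub_mem _ hx (rDiff_mem _ _ _ _ hZ)
    have hy' : y - rMap φ Z - rDiff N i W ∈ rPiece N (i + 1) c :=
      Submodule.sub_mem _ (Submodule.sub_mem _ hy (rMap_mem _ _ _ _ hZ)) (rDiff_mem _ _ _ _ hW)
    obtain ⟨z', hz', w', hw', e3, e4⟩ := ih _ hx' _ hy' (fun j T hT => by
        by_cases hj : j + tot (-ind T + 1 + c) = i + 1 + 1
        · obtain rfl : j = q T + 1 + 1 := by simp only [q]; omega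
          change x _ _ - rDiff M (i + 1) Z _ _ = 0
          rw [rDiff_top hZ0 _ _ hT, sub_eq_zero]
          by_cases h : T.card = p
          · rw [rOf_apply, dif_pos h, Pi.single_eq_same, e1, negOnePow_smul_smul]
          · rw [rOf_apply, dif_neg h, map_zero, smul_zero, hx0 _ _ (by omega)]
        · exact (mem_rPiece.mp hx' j T).2 hj) (fun j T hT => by
        by_cases hj : j + tot (-ind T + 1 + c) = i + 1
        · obtain rfl : j = q T + 1 := by simp only [q]; omega
          change y _ _ - rMap φ Z _ _ - rDiff N i W _ _ = 0
          rw [rDiff_top hW0 _ _ hT, rMap_apply]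
          by_cases h : T.card = p
          · rw [rOf_apply, dif_pos h, Pi.single_eq_same, rOf_apply, dif_pos h, Pi.single_eq_same,
              map_zsmul, negOnePow_smul_smul, e2 T h]
            abel
          · rw [rOf_apply, dif_neg h, rOf_apply, dif_neg h, map_zero, map_zero, smul_zero,
              hy0 _ _ (by omega), sub_zero, sub_zero]
        · exact (mem_rPiece.mp hy' j T).2 hj)
      (by rw [map_sub, hdx, rDiff_rDiff, sub_zero])
      (by rw [map_sub, map_sub, map_sub, hxy, rDiff_rDiff, rMap_rDiff, sub_zero])
    refine ⟨Z + z', Submodule.add_mem _ hZ hz', W + w', Submodule.add_mem _ hW hw', ?_, ?_⟩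
    · rw [map_add, e3]; abel
    · rw [map_add, map_add, add_add_add_comm, ← e4]; abel

lemma rCom_d (M : ComB (IsSqS (k := k) (n := n))) (i : ℤ) :
    ((rCom k n).obj M).d i (i + 1) = rD M i := CochainComplex.of_d _ _ _

lemma rCom_qis : qisB IsSqS ≤ (qis IsFgE).inverseImage (rCom k n) := by
  intro M N φ hφ
  refine (qis_iff_cone _).mpr fun i a x hx y hy h1 h2 => ?_
  rw [rCom_d] at h1 h2
  -- For `p = n + 1` the vanishing conditions of `rMap_cone` are vacuous.
  have h3 : ∀ T : Finset (Fin n), ¬ n + 1 ≤ T.card := fun T hT => by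
    have := Finset.card_le_univ T
    rw [Fintype.card_fin] at this
    omega
  obtain ⟨z, hz, w, hw, e1, e2⟩ := rMap_cone φ.hom hφ i a (n + 1) x.1 hx y.1 hy
    (fun _ T hT => absurd hT (h3 T)) (fun _ T hT => absurd hT (h3 T))
    (congrArg Subtype.val h1) (congrArg Subtype.val h2)
  refine ⟨⟨z, GrMod.mem_pieces hz⟩, hz, ⟨w, GrMod.mem_pieces hw⟩, hw, ?_, ?_⟩
  · rw [rCom_d]
    exact Subtype.ext e1
  · rw [rCom_d]
    exact Subtype.ext e2

end BGG

/-! #### The squarefree part of `ℛ` -/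

section BGG

variable {k : Type u} [Field k] {n : ℕ}

variable (k n) in
/-- The subcomplex of the components of degree `≤ 0` of `ℛ(M)`. -/
def rNonpos : SubFunctor (rCom k n) where
  U M i a :=
    { carrier := {x | x ∈ (rMod M.obj i).deg a ∧ (¬ a ≤ 0 → x = 0)}
      add_mem' := fun hx hy => ⟨Submodule.add_mem _ hx.1 hy.1,
        fun h => by rw [hx.2 h, hy.2 h, add_zero]⟩
      zero_mem' := ⟨Submodule.zero_mem _, fun _ => rfl⟩
      smul_mem' := fun c x hx => ⟨Submodule.smul_mem _ _ hx.1, fun h => by rw [hx.2 h, smul_zero]⟩ }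
  le _ _ _ _ hx := hx.1
  smul M i a b s x hs hx := by
    rcases nonpos_of_grE hs with h | rfl
    · exact ⟨GrMod.smul_mem _ hs hx.1, fun h1 => by
        rw [hx.2 fun h2 => h1 (add_nonpos h h2), smul_zero]⟩
    · rw [zero_smul]
      exact Submodule.zero_mem _
  d M i a x hx := ⟨(((rCom k n).obj M).d i (i + 1)).hom.map_deg a x hx.1,
    fun h => by rw [hx.2 h]; exact map_zero _⟩
  map f i a x hx := ⟨(((rCom k n).map f).f i).hom.map_deg a x hx.1,
    fun h => by rw [hx.2 h]; exact map_zero _⟩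

lemma rNonpos_sq (M : ComB (IsSqS (k := k) (n := n))) (i : ℤ) :
    IsSqE ((rNonpos k n).subObj iSup_grE M i) := by
  refine ⟨finite_subObj _ le_rfl M i, fun a ha => ?_⟩
  rw [eq_bot_iff]
  rintro x ⟨hx1, hx2⟩
  refine Subtype.ext ?_
  by_cases h : a ≤ 0
  · have h1 : ¬ -1 ≤ a := fun h1 => by
      obtain ⟨F, hF⟩ := exists_ind h h1
      exact ha F hF
    have h2 : x.1.1 ∈ rPiece M.obj i a := hx1
    rw [rPiece_eq_bot i h1, Submodule.mem_bot] at h2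
    exact Subtype.ext h2
  · exact hx2 h

lemma tot_le {a : Fin n → ℤ} (h : a ≤ 1) : tot a ≤ n := by
  refine (Finset.sum_le_sum fun i _ => h i).trans ?_
  simp

lemma tot_nonneg {a : Fin n → ℤ} (h : 0 ≤ a) : 0 ≤ tot a := Finset.sum_nonneg fun i _ => h i

lemma rNonpos_bounded (M : ComB (IsSqS (k := k) (n := n))) :
    ∃ b : ℤ, ∀ i, b < |i| → ∀ x : (rNonpos k n).subObj iSup_grE M i, x = 0 := by
  obtain ⟨N, hN⟩ := (isBounded_iff _).mp M.property
  refine ⟨N + n, fun i hi x => ?_⟩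
  refine ((rNonpos k n).subObj iSup_grE M i).eq_zero_of_deg_eq_bot (fun a => ?_) x
  rw [eq_bot_iff]
  rintro x ⟨hx1, hx2⟩
  refine Subtype.ext ?_
  by_cases h : a ≤ 0
  · refine Subtype.ext (rAmb_ext fun j T => ?_)
    change x.1.1 j (eF k n T) = 0
    obtain ⟨h1, h2⟩ := mem_rPiece.mp (show x.1.1 ∈ rPiece M.obj i a from hx1) j T
    by_cases hj : N < |j|
    · exact hN j hj _
    by_cases h0 : 0 ≤ -ind T + 1 + a
    · refine h2 fun h3 => ?_
      have h4 := tot_nonneg h0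
      -- With `a ≤ 0` the degree `-T + 𝟏 + a` lies between `0` and `𝟏`, so `i` differs from `j` by
      -- at most `n`.
      have h5 : tot (-ind T + 1 + a) ≤ n := tot_le (by
        rw [add_right_comm]
        exact add_le_of_nonpos_left (add_nonpos (neg_ind_nonpos T) h))
      rcases abs_cases i with h6 | h6 <;> rcases abs_cases j with h7 | h7 <;> omega
    · rw [(M.obj.X j).property.nonneg _ h0, Submodule.mem_bot] at h1
      exact h1
  · exact hx2 h

variable (k n) in
/-- The functor to bounded complexes of squarefree `E`-modules given by the squarefree
part of `ℛ`. -/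
def rSq : ComB (IsSqS (k := k) (n := n)) ⥤ ComB (IsSqE (k := k) (n := n)) :=
  ObjectProperty.lift _ ((rNonpos k n).sub iSup_grE rNonpos_sq) fun M =>
    (isBounded_iff _).mpr (rNonpos_bounded M)

variable (k n) in
/-- The inclusion of the squarefree part of `ℛ`. -/
def rSqι : rSq k n ⋙ inclCom k n ⟶ rCom k n where
  app _ :=
    { f := fun _ => ObjectProperty.homMk
        { lin := Submodule.subtype _
          map_deg := fun _ _ hx => hx.1 }
      comm' := fun _ _ _ => rfl }
  naturality _ _ _ := rfl

/-- In degrees `a ≤ 0` the two complexes agree. Otherwise some `a_l ≥ 1`: the subcomplex is zero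
there, and `ℛ(M)` is acyclic by `rPiece_acyclic`. -/
lemma rSqι_qis (M : ComB (IsSqS (k := k) (n := n))) : qis IsFgE ((rSqι k n).app M) := by
  rw [qis_iff]
  intro i a
  by_cases ha : a ≤ 0
  · obtain ⟨i, rfl⟩ : ∃ j, i = j + 1 := ⟨i - 1, by ring⟩
    have elt : ∀ (i : ℤ) (y : (((rCom k n).obj M).X i).obj),
        y ∈ (((rCom k n).obj M).X i).obj.deg a → y ∈ (rNonpos k n).U M i a :=
      fun i y hy => ⟨hy, fun h => absurd ha h⟩
    rw [isIso_coh_iff]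
    constructor
    · intro x hx y hy h1 h2
      exact ⟨(rNonpos k n).elt iSup_grE (elt _ y hy), elt _ y hy, Subtype.ext h2.symm⟩
    · intro y hy h1
      exact ⟨(rNonpos k n).elt iSup_grE (elt _ y hy), elt _ y hy, 0, Submodule.zero_mem _,
        Subtype.ext h1, by rw [map_zero, add_zero]; rfl⟩
  · refine isIso_of_isZero (C := ModuleCat.{u} k) ?_ ?_ _
    · refine isZero_coh_of_deg_eq_bot ?_
      rw [eq_bot_iff]
      rintro x ⟨hx1, hx2⟩
      exact Subtype.ext (hx2 ha)
    · obtain ⟨i, rfl⟩ : ∃ j, i = j + 1 := ⟨i - 1, by ring⟩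
      obtain ⟨l, hl⟩ : ∃ l, 1 ≤ a l := by
        by_contra! h
        exact ha fun l => Int.lt_add_one_iff.mp (h l)
      rw [isZero_coh_iff]
      intro x hx h1
      rw [rCom_d] at h1
      obtain ⟨g, hg, e1⟩ := rPiece_acyclic i hl (show x.1 ∈ rPiece M.obj (i + 1) a from hx)
        (congrArg Subtype.val h1)
      refine ⟨⟨g, GrMod.mem_pieces hg⟩, hg, ?_⟩
      rw [rCom_d]
      exact Subtype.ext e1

/-- This is inherited from `ℛ` through the natural quasi-isomorphism `rSqι`. -/
lemma rSq_qis : qisB IsSqS ≤ (qisB IsSqE).inverseImage (rSq k n) := by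
  intro M N φ hφ
  refine (qis_iff ((rSq k n).map φ).hom).mpr fun i a => ?_
  have h1 := (qis_iff _).mp (rCom_qis φ hφ) i a
  have h2 := (qis_iff _).mp (rSqι_qis M) i a
  have h3 := (qis_iff _).mp (rSqι_qis N) i a
  have h4 := congrArg (coh IsFgE i a).map ((rSqι k n).naturality φ)
  rw [Functor.map_comp, Functor.map_comp] at h4
  exact (isIso_of_comm_sq h4).mpr h1

end BGG

/-! ### The functors `𝒮` and `A` preserve quasi-isomorphisms -/

section

variable {k : Type u} [Field k] {n : ℕ} {A : Type u} [Ring A] [Algebra k A]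
  {𝒜 : (Fin n → ℤ) → Submodule k A} {P : ObjectProperty (GrMod 𝒜)}

/-- The indices are free variables so that the cone condition can also be used at positions such as
`-(i + 1)`, which occur for the contravariant functor `A`. -/
lemma qis.exists_cone {K L : Com P} {f : K ⟶ L} (hf : qis P f) {i j l m : ℤ} (hij : i + 1 = j)
    (hjl : j + 1 = l) (hlm : l + 1 = m) {a : Fin n → ℤ} {x : (K.X l).obj}
    (hx : x ∈ (K.X l).obj.deg a) {y : (L.X j).obj} (hy : y ∈ (L.X j).obj.deg a)
    (h1 : (K.d l m).hom.lin x = 0) (h2 : (f.f l).hom.lin x = (L.d j l).hom.lin y) :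
    ∃ z ∈ (K.X j).obj.deg a, ∃ w ∈ (L.X i).obj.deg a, (K.d j l).hom.lin z = x ∧
      y = (f.f j).hom.lin z + (L.d i j).hom.lin w := by
  subst hij hjl hlm
  exact (qis_iff_cone f).mp hf i a x hx y hy h1 h2

namespace GrMod

variable (M : GrMod 𝒜) (a : Fin n → ℤ)

/-- The projection to the component of degree `a`. -/
def toDeg : M →ₗ[k] M.deg a := (M.proj a).codRestrict _ (M.proj_mem a)

/-- The extension by zero of a linear form on `Mₐ`. -/
def extDual (φ : Module.Dual k (M.deg a)) : Module.Dual k M := φ ∘ₗ M.toDeg a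

variable {M a}

lemma toDeg_of_mem {m : M} (hm : m ∈ M.deg a) : M.toDeg a m = ⟨m, hm⟩ :=
  Subtype.ext (M.proj_same hm)

lemma extDual_of_mem (φ : Module.Dual k (M.deg a)) {m : M} (hm : m ∈ M.deg a) :
    M.extDual a φ m = φ ⟨m, hm⟩ := by
  rw [extDual, LinearMap.comp_apply, toDeg_of_mem hm]

lemma extDual_mem (φ : Module.Dual k (M.deg a)) : M.extDual a φ ∈ M.dualDeg a := by
  intro b hb m hm
  have : M.toDeg a m = 0 := Subtype.ext (M.proj_ne hb hm)
  rw [extDual, LinearMap.comp_apply, this, map_zero]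

lemma eq_of_mem_dualDeg {φ ψ : Module.Dual k M} (hφ : φ ∈ M.dualDeg a) (hψ : ψ ∈ M.dualDeg a)
    (h : ∀ m ∈ M.deg a, φ m = ψ m) : φ = ψ :=
  M.lin_ext fun b m hm => by
    by_cases hb : b = a
    · subst hb; exact h m hm
    · rw [hφ b hb m hm, hψ b hb m hm]

lemma eq_zero_of_dualDeg {m : M} (hm : m ∈ M.deg a) (h : ∀ φ ∈ M.dualDeg a, φ m = 0) : m = 0 := by
  have : (⟨m, hm⟩ : M.deg a) = 0 := by
    rw [← Module.forall_dual_apply_eq_zero_iff k]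
    intro φ
    rw [← extDual_of_mem φ hm]
    exact h _ (extDual_mem φ)
  exact congrArg Subtype.val this

/-- Linear forms on `(Mₐ)*` are given by elements of `Mₐ` if `Mₐ` is finite dimensional. -/
lemma exists_eval (h : Module.Finite k (M.deg a)) (ℓ : M.dualDeg a →ₗ[k] k) :
    ∃ m ∈ M.deg a, ∀ φ (hφ : φ ∈ M.dualDeg a), ℓ ⟨φ, hφ⟩ = φ m := by
  obtain ⟨m, hm⟩ := (Module.evalEquiv k (M.deg a)).surjective
    (ℓ ∘ₗ (M.toDeg a).dualMap.codRestrict (M.dualDeg a) extDual_mem)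
  refine ⟨m.1, m.2, fun φ hφ => ?_⟩
  have h1 := LinearMap.congr_fun hm (φ ∘ₗ (M.deg a).subtype)
  have h2 : (M.toDeg a).dualMap.codRestrict (M.dualDeg a) extDual_mem
      (φ ∘ₗ (M.deg a).subtype) = ⟨φ, hφ⟩ :=
    Subtype.ext (eq_of_mem_dualDeg (a := a) (extDual_mem (φ ∘ₗ (M.deg a).subtype)) hφ fun m hm =>
      extDual_of_mem (φ ∘ₗ (M.deg a).subtype) hm)
  rw [LinearMap.comp_apply, h2] at h1
  exact h1.symm

end GrMod

end

variable {k : Type u} [Field k] {n : ℕ}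

/-! #### Homogeneous elements of `𝒮(N)` and of `A(M)` -/

namespace BoolRep

variable {ρ : BoolRep k n}

/-- The element of the squarefree module of `ρ` given by `v ∈ U (supp₊ a)`. -/
def elt (ρ : BoolRep k n) {a : Fin n → ℤ} (ha : 0 ≤ a) {v : ρ.V} (hv : v ∈ ρ.U (supp a)) :
    ρ.toSq.obj :=
  ⟨ρ.inc a v, GrMod.mem_pieces (mem_piece.mpr ⟨v, hv, rfl, Or.inl ha⟩)⟩

/-- The coefficient in degree `a` of an element of the ambient module. -/
def ambCoef (ρ : BoolRep k n) (a : Fin n → ℤ) : ρ.Amb →ₗ[k] ρ.V :=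
  (Finsupp.lapply a : ((Fin n → ℤ) →₀ ρ.V) →ₗ[k] ρ.V)

lemma ambCoef_inc (a : Fin n → ℤ) (v : ρ.V) : ρ.ambCoef a (ρ.inc a v) = v :=
  Finsupp.single_eq_same

lemma ambCoef_inc_of_ne {a b : Fin n → ℤ} (h : b ≠ a) (v : ρ.V) :
    ρ.ambCoef a (ρ.inc b v) = 0 := Finsupp.single_eq_of_ne h.symm

/-- The coefficient in degree `a`. -/
def coef (ρ : BoolRep k n) (a : Fin n → ℤ) : ρ.toSq.obj →ₗ[k] ρ.V where
  toFun x := ρ.ambCoef a x.1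
  map_add' _ _ := rfl
  map_smul' _ _ := rfl

lemma elt_mem {a : Fin n → ℤ} (ha : 0 ≤ a) {v : ρ.V} (hv : v ∈ ρ.U (supp a)) :
    ρ.elt ha hv ∈ ρ.toSq.obj.deg a := mem_piece.mpr ⟨v, hv, rfl, Or.inl ha⟩

lemma exists_elt {a : Fin n → ℤ} (ha : 0 ≤ a) {x : ρ.toSq.obj} (hx : x ∈ ρ.toSq.obj.deg a) :
    ∃ v, ∃ hv : v ∈ ρ.U (supp a), x = ρ.elt ha hv := by
  obtain ⟨v, hv, e, -⟩ := mem_piece.mp hx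
  exact ⟨v, hv, Subtype.ext e.symm⟩

lemma coef_elt {a : Fin n → ℤ} (ha : 0 ≤ a) {v : ρ.V} (hv : v ∈ ρ.U (supp a)) :
    ρ.coef a (ρ.elt ha hv) = v := ambCoef_inc a v

lemma coef_of_ne {a b : Fin n → ℤ} (h : b ≠ a) {x : ρ.toSq.obj} (hx : x ∈ ρ.toSq.obj.deg b) :
    ρ.coef a x = 0 := by
  obtain ⟨v, hv, e, -⟩ := mem_piece.mp hx
  exact (congrArg (ρ.ambCoef a) e.symm).trans (ambCoef_inc_of_ne h v)

lemma elt_inj {a : Fin n → ℤ} (ha : 0 ≤ a) {v w : ρ.V} {hv : v ∈ ρ.U (supp a)}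
    {hw : w ∈ ρ.U (supp a)} (h : ρ.elt ha hv = ρ.elt ha hw) : v = w :=
  ρ.inc_inj (congrArg Subtype.val h)

lemma elt_congr {a : Fin n → ℤ} (ha : 0 ≤ a) {v w : ρ.V} {hv : v ∈ ρ.U (supp a)}
    {hw : w ∈ ρ.U (supp a)} (h : v = w) : ρ.elt ha hv = ρ.elt ha hw := by
  subst h; rfl

lemma elt_add {a : Fin n → ℤ} (ha : 0 ≤ a) {v w : ρ.V} (hv : v ∈ ρ.U (supp a))
    (hw : w ∈ ρ.U (supp a)) : ρ.elt ha hv + ρ.elt ha hw = ρ.elt ha (Submodule.add_mem _ hv hw) :=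
  Subtype.ext ((ρ.inc a).map_add v w).symm

lemma elt_eq_zero {a : Fin n → ℤ} (ha : 0 ≤ a) {v : ρ.V} {hv : v ∈ ρ.U (supp a)} :
    ρ.elt ha hv = 0 ↔ v = 0 :=
  ⟨fun h => ρ.inc_inj ((congrArg Subtype.val h).trans ((ρ.inc a).map_zero).symm),
    fun h => Subtype.ext ((congrArg (ρ.inc a) h).trans ((ρ.inc a).map_zero))⟩

end BoolRep

section

variable {N N' : SqE k n} {a : Fin n → ℤ} (ha : 0 ≤ a)

/-- The element of `𝒮(N)` of degree `a` given by `z ∈ N_{-supp₊ a}`. -/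
def sElt {z : N.obj} (hz : z ∈ N.obj.deg (-ind (supp a))) : ((fS k n).obj N).obj :=
  (extRep N).elt ha hz

variable {ha}

lemma sElt_mem {z : N.obj} (hz : z ∈ N.obj.deg (-ind (supp a))) :
    sElt ha hz ∈ ((fS k n).obj N).obj.deg a := BoolRep.elt_mem (ρ := extRep N) ha hz

lemma exists_sElt (ha : 0 ≤ a) {x : ((fS k n).obj N).obj} (hx : x ∈ ((fS k n).obj N).obj.deg a) :
    ∃ z, ∃ hz : z ∈ N.obj.deg (-ind (supp a)), x = sElt ha hz :=
  BoolRep.exists_elt (ρ := extRep N) ha hx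

lemma fS_map_sElt (f : N ⟶ N') {z : N.obj} (hz : z ∈ N.obj.deg (-ind (supp a))) :
    ((fS k n).map f).hom.lin (sElt ha hz) = sElt ha (f.hom.map_deg _ _ hz) :=
  Subtype.ext (BoolRep.mapAmb_inc (ρ := extRep N) (σ := extRep N') _ a z)

end

section

variable {M M' : SqS k n} {a : Fin n → ℤ} (ha : 0 ≤ a)

/-- The element of `A(M)` of degree `a` given by a linear form on the component of
degree `[n] ∖ supp₊ a` of `M`. -/
def aElt {φ : Module.Dual k M.obj} (hφ : φ ∈ M.obj.dualDeg (ind (supp a)ᶜ)) :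
    ((alex k n).obj (Opposite.op M)).obj :=
  (alexRep M).elt ha hφ

variable {ha}

lemma aElt_mem {φ : Module.Dual k M.obj} (hφ : φ ∈ M.obj.dualDeg (ind (supp a)ᶜ)) :
    aElt ha hφ ∈ ((alex k n).obj (Opposite.op M)).obj.deg a :=
  BoolRep.elt_mem (ρ := alexRep M) ha hφ

lemma exists_aElt (ha : 0 ≤ a) {x : ((alex k n).obj (Opposite.op M)).obj}
    (hx : x ∈ ((alex k n).obj (Opposite.op M)).obj.deg a) :
    ∃ φ, ∃ hφ : φ ∈ M.obj.dualDeg (ind (supp a)ᶜ), x = aElt ha hφ :=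
  BoolRep.exists_elt (ρ := alexRep M) ha hx

lemma comp_mem_dualDeg (f : M ⟶ M') {b : Fin n → ℤ} {φ : Module.Dual k M'.obj}
    (hφ : φ ∈ M'.obj.dualDeg b) : φ ∘ₗ f.hom.lin.restrictScalars k ∈ M.obj.dualDeg b :=
  fun c hc m hm => hφ c hc _ (f.hom.map_deg c m hm)

lemma alex_map_aElt (f : M ⟶ M') {φ : Module.Dual k M'.obj}
    (hφ : φ ∈ M'.obj.dualDeg (ind (supp a)ᶜ)) :
    ((alex k n).map f.op).hom.lin (aElt ha hφ) = aElt ha (comp_mem_dualDeg f hφ) :=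
  Subtype.ext (BoolRep.mapAmb_inc (ρ := alexRep M') (σ := alexRep M) _ a φ)

end

-- The component of `𝒮(N)` in degree `a ≥ 0` is that of `N` in degree `-supp₊ a`, with the same
-- maps, so the cone condition carries over verbatim.
variable (k n) in
lemma fSCom_qis : qisB IsSqE ≤ (qisB IsSqS).inverseImage (fSCom k n) := by
  intro K L f hf
  refine (qis_iff_cone _).mpr fun i a x hx y hy h1 h2 => ?_
  by_cases ha : 0 ≤ a
  · obtain ⟨v, hv, rfl⟩ := exists_sElt ha hx
    obtain ⟨w, hw, rfl⟩ := exists_sElt ha hy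
    have e1 := (fS_map_sElt (K.obj.d (i + 1 + 1) (i + 1 + 1 + 1)) hv).symm.trans h1
    have e2 := ((fS_map_sElt (f.hom.f (i + 1 + 1)) hv).symm.trans h2).trans
      (fS_map_sElt (L.obj.d (i + 1) (i + 1 + 1)) hw)
    obtain ⟨z, hz, t, ht, e3, e4⟩ := (qis_iff_cone f.hom).mp hf i (-ind (supp a)) v hv w hw
      ((BoolRep.elt_eq_zero ha).mp e1) (BoolRep.elt_inj ha e2)
    refine ⟨sElt ha hz, sElt_mem hz, sElt ha ht, sElt_mem ht, ?_, ?_⟩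
    · exact (fS_map_sElt (K.obj.d (i + 1) (i + 1 + 1)) hz).trans (BoolRep.elt_congr ha e3)
    · refine Eq.trans ?_ (congrArg₂ (· + ·) (fS_map_sElt (f.hom.f (i + 1)) hz)
        (fS_map_sElt (L.obj.d i (i + 1)) ht)).symm
      exact (BoolRep.elt_congr ha e4).trans (BoolRep.elt_add (ρ := extRep _) ha _ _).symm
  · rw [IsSqS.nonneg (ObjectProperty.FullSubcategory.property _) a ha, Submodule.mem_bot] at hx hy
    exact ⟨0, Submodule.zero_mem _, 0, Submodule.zero_mem _, by rw [map_zero, hx],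
      by rw [map_zero, map_zero, add_zero, hy]⟩

/-- Exactness of the dual of the mapping cone of a quasi-isomorphism. -/
lemma qis.exists_dual {M N : Com (IsSqS (k := k) (n := n))} {φ : M ⟶ N} (hφ : qis IsSqS φ)
    {i j l m : ℤ} (hij : i + 1 = j) (hjl : j + 1 = l) (hlm : l + 1 = m) {b : Fin n → ℤ}
    {ξ : Module.Dual k (N.X j).obj} (hξ : ξ ∈ (N.X j).obj.dualDeg b)
    {η : Module.Dual k (M.X l).obj} (hη : η ∈ (M.X l).obj.dualDeg b)
    (h1 : ∀ v, ξ ((N.d i j).hom.lin v) = 0)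
    (h2 : ∀ v, ξ ((φ.f j).hom.lin v) = η ((M.d j l).hom.lin v)) :
    ∃ ζ ∈ (N.X l).obj.dualDeg b, ∃ ω ∈ (M.X m).obj.dualDeg b,
      (∀ v, ζ ((N.d j l).hom.lin v) = ξ v) ∧
      ∀ v, η v = ζ ((φ.f l).hom.lin v) + ω ((M.d l m).hom.lin v) := by
  let δM : (M.X l).obj.deg b →ₗ[k] (M.X m).obj.deg b :=
    ((M.d l m).hom.lin.restrictScalars k).restrict ((M.d l m).hom.map_deg b)
  let δN : (N.X j).obj.deg b →ₗ[k] (N.X l).obj.deg b :=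
    ((N.d j l).hom.lin.restrictScalars k).restrict ((N.d j l).hom.map_deg b)
  let φl : (M.X l).obj.deg b →ₗ[k] (N.X l).obj.deg b :=
    ((φ.f l).hom.lin.restrictScalars k).restrict ((φ.f l).hom.map_deg b)
  -- Up to signs, `T` is a differential of the mapping cone of `φ` in degree `b`, and `F` is the
  -- linear form given by the dual cycle `(η, ξ)`.
  let T : (M.X l).obj.deg b × (N.X j).obj.deg b →ₗ[k] (M.X m).obj.deg b × (N.X l).obj.deg b :=
    (δM ∘ₗ LinearMap.fst _ _ _).prod (φl.coprod δN)
  let F : Module.Dual k ((M.X l).obj.deg b × (N.X j).obj.deg b) :=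
    (η ∘ₗ Submodule.subtype _).coprod (ξ ∘ₗ Submodule.subtype _)
  -- Over a field, a linear form factors through `T` if and only if it vanishes on the kernel of
  -- `T`. By exactness of the cone that kernel consists of boundaries, and on these `F` vanishes
  -- because it is a cycle.
  have hF : F ∈ LinearMap.range T.dualMap := by
    rw [LinearMap.range_dualMap_eq_dualAnnihilator_ker, Submodule.mem_dualAnnihilator]
    rintro ⟨⟨x, hx⟩, ⟨y, hy⟩⟩ hxy
    have e1 : (M.d l m).hom.lin x = 0 := congrArg (fun p => p.1.1) hxy
    have e2 : (φ.f l).hom.lin x + (N.d j l).hom.lin y = 0 := congrArg (fun p => p.2.1) hxy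
    obtain ⟨z, hz, w, hw, e3, e4⟩ := hφ.exists_cone hij hjl hlm hx
      (Submodule.neg_mem _ hy) e1 (by rw [map_neg]; exact eq_neg_of_add_eq_zero_left e2)
    change η x + ξ y = 0
    have e5 : y = -((φ.f j).hom.lin z + (N.d i j).hom.lin w) := by rw [← e4, neg_neg]
    rw [← e3, ← h2, e5, map_neg, map_add, h1, add_zero, add_neg_cancel]
  obtain ⟨G, hG⟩ := hF
  have hG' : ∀ x y, G (T (x, y)) = η x.1 + ξ y.1 := fun x y => LinearMap.congr_fun hG (x, y)
  obtain ⟨ζ, hζ, eζ⟩ : ∃ ζ ∈ (N.X l).obj.dualDeg b, ∀ v (hv : v ∈ (N.X l).obj.deg b),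
      ζ v = G (0, ⟨v, hv⟩) := ⟨GrMod.extDual _ b (G ∘ₗ LinearMap.inr k _ _), GrMod.extDual_mem _,
    fun v hv => GrMod.extDual_of_mem (G ∘ₗ LinearMap.inr k _ _) hv⟩
  obtain ⟨ω, hω, eω⟩ : ∃ ω ∈ (M.X m).obj.dualDeg b, ∀ v (hv : v ∈ (M.X m).obj.deg b),
      ω v = G (⟨v, hv⟩, 0) := ⟨GrMod.extDual _ b (G ∘ₗ LinearMap.inl k _ _), GrMod.extDual_mem _,
    fun v hv => GrMod.extDual_of_mem (G ∘ₗ LinearMap.inl k _ _) hv⟩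
  refine ⟨ζ, hζ, ω, hω, ?_, ?_⟩
  · refine LinearMap.congr_fun (GrMod.eq_of_mem_dualDeg (a := b)
      (φ := ζ ∘ₗ (N.d j l).hom.lin.restrictScalars k)
      (fun c hc v hv => hζ c hc _ ((N.d j l).hom.map_deg c v hv)) hξ fun v hv => ?_)
    refine (eζ _ ((N.d j l).hom.map_deg b v hv)).trans ?_
    have := hG' 0 ⟨v, hv⟩
    rw [Submodule.coe_zero, map_zero, zero_add] at this
    rw [← this]
    refine congrArg G (Prod.ext (map_zero δM).symm ?_)
    refine Eq.trans ?_ (congrArg (· + δN ⟨v, hv⟩) (map_zero φl).symm)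
    exact (zero_add _).symm
  · refine LinearMap.congr_fun (GrMod.eq_of_mem_dualDeg (a := b) hη
      (ψ := ζ ∘ₗ (φ.f l).hom.lin.restrictScalars k + ω ∘ₗ (M.d l m).hom.lin.restrictScalars k)
      (Submodule.add_mem _
        (fun c hc v hv => hζ c hc _ ((φ.f l).hom.map_deg c v hv))
        (fun c hc v hv => hω c hc _ ((M.d l m).hom.map_deg c v hv)))
      fun v hv => ?_)
    refine Eq.trans ?_ (congrArg₂ (· + ·) (eζ _ ((φ.f l).hom.map_deg b v hv))
      (eω _ ((M.d l m).hom.map_deg b v hv))).symm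
    have := hG' ⟨v, hv⟩ 0
    rw [Submodule.coe_zero, map_zero, add_zero] at this
    rw [← this, ← map_add]
    refine congrArg G (Prod.ext (zero_add _).symm ?_)
    exact (congrArg (φl ⟨v, hv⟩ + ·) (map_zero δN)).trans rfl

-- In degree `a ≥ 0`, `A` is the dual of the component of degree `(supp₊ a)ᶜ`; the claim is
-- exactness of dualization, in the form of `qis.exists_dual`.
variable (k n) in
lemma alexCom_qis : (qisB IsSqS).op ≤ (qisB IsSqS).inverseImage (alexCom k n) := by
  intro K L f hf
  refine (qis_iff_cone _).mpr fun i a x hx y hy h1 h2 => ?_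
  by_cases ha : 0 ≤ a
  · obtain ⟨v, hv, rfl⟩ := exists_aElt ha hx
    obtain ⟨w, hw, rfl⟩ := exists_aElt ha hy
    have e1 := (alex_map_aElt (K.unop.obj.d (-(i + 1 + 1 + 1)) (-(i + 1 + 1))) hv).symm.trans h1
    have e2 := ((alex_map_aElt (f.unop.hom.f (-(i + 1 + 1))) hv).symm.trans h2).trans
      (alex_map_aElt (L.unop.obj.d (-(i + 1 + 1)) (-(i + 1))) hw)
    have e1' := (BoolRep.elt_eq_zero ha).mp e1
    have e2' := BoolRep.elt_inj ha e2
    obtain ⟨z, hz, t, ht, e3, e4⟩ := qis.exists_dual (show qis IsSqS f.unop.hom from hf)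
      (i := -(i + 1 + 1 + 1)) (j := -(i + 1 + 1)) (l := -(i + 1)) (m := -i) (by ring) (by ring)
      (by ring) hv hw (fun v => LinearMap.congr_fun e1' v) (fun v => LinearMap.congr_fun e2' v)
    refine ⟨aElt ha hz, aElt_mem hz, aElt ha ht, aElt_mem ht, ?_, ?_⟩
    · exact (alex_map_aElt (K.unop.obj.d (-(i + 1 + 1)) (-(i + 1))) hz).trans
        (BoolRep.elt_congr ha (LinearMap.ext e3))
    · refine Eq.trans ?_ (congrArg₂ (· + ·) (alex_map_aElt (f.unop.hom.f (-(i + 1))) hz)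
        (alex_map_aElt (L.unop.obj.d (-(i + 1)) (-i)) ht)).symm
      exact (BoolRep.elt_congr ha (LinearMap.ext e4)).trans
        (BoolRep.elt_add (ρ := alexRep _) ha _ _).symm
  · rw [IsSqS.nonneg (ObjectProperty.FullSubcategory.property _) a ha, Submodule.mem_bot] at hx hy
    exact ⟨0, Submodule.zero_mem _, 0, Submodule.zero_mem _, by rw [map_zero, hx],
      by rw [map_zero, map_zero, add_zero, hy]⟩

/-! ### Morphisms of squarefree modules in terms of the squarefree components -/

variable {k : Type u} [Field k] {n : ℕ}

lemma mem_supp {a : Fin n → ℤ} {l : Fin n} : l ∈ supp a ↔ 0 < a l := by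
  rw [supp, Finset.mem_filter]
  simp

lemma supp_ind (F : Finset (Fin n)) : supp (ind F) = F := by
  ext l
  rw [mem_supp]
  by_cases h : l ∈ F <;> simp [ind, h]

lemma ind_nonneg (F : Finset (Fin n)) : 0 ≤ ind F := fun l => by
  by_cases h : l ∈ F <;> simp [ind, h]

lemma toZ_injective : Function.Injective (toZ (n := n)) := fun b c h =>
  Finsupp.ext fun l => by
    have := congrFun h l
    simpa [toZ] using this

lemma supp_ind_add {F : Finset (Fin n)} {d : Fin n →₀ ℕ} (h : ∀ l, d l ≠ 0 → l ∈ F) :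
    supp (ind F + toZ d) = F := by
  ext l
  rw [mem_supp]
  by_cases hl : l ∈ F
  · simp [ind, hl, toZ]; omega
  · have : d l = 0 := by by_contra h0; exact hl (h l h0)
    simp [ind, hl, toZ, this]

lemma exists_ind_add {b : Fin n → ℤ} (hb : 0 ≤ b) :
    ∃ d : Fin n →₀ ℕ, (∀ l, d l ≠ 0 → l ∈ supp b) ∧ ind (supp b) + toZ d = b := by
  refine ⟨Finsupp.equivFunOnFinite.symm fun i => (b i).toNat - 1, fun l hl => ?_, ?_⟩
  · simp only [Finsupp.equivFunOnFinite_symm_apply_apply] at hl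
    rw [mem_supp]
    omega
  · ext i
    have := hb i
    simp only [Pi.zero_apply] at this
    by_cases hi : 0 < b i
    · simp [toZ, supp, hi, ind]
    · simp [toZ, supp, hi, ind]; omega

namespace IsSqS

variable {M : GrMod (grS k n)}

lemma bijOn_monomial (hM : IsSqS M) {F : Finset (Fin n)} {d : Fin n →₀ ℕ} (h : ∀ l, d l ≠ 0 → l ∈ F) :
    Set.BijOn (fun y : M => (MvPolynomial.monomial d (1 : k) : S k n) • y)
      (M.deg (ind F)) (M.deg (ind F + toZ d)) := by
  have h1 : toZ (Finsupp.equivFunOnFinite.symm fun i => if i ∈ F then 1 else 0) = ind F := by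
    ext i; simp [toZ, ind]
  have := hM.bij (Finsupp.equivFunOnFinite.symm fun i => if i ∈ F then 1 else 0) d (by
    rw [h1, supp_ind, supp_ind_add h])
  rwa [h1] at this

lemma exists_monomial (hM : IsSqS M) {b : Fin n → ℤ} (hb : 0 ≤ b) {m : M} (hm : m ∈ M.deg b) :
    ∃ d : Fin n →₀ ℕ, (∀ l, d l ≠ 0 → l ∈ supp b) ∧ ind (supp b) + toZ d = b ∧
      ∃ u ∈ M.deg (ind (supp b)), (MvPolynomial.monomial d (1 : k) : S k n) • u = m := by
  obtain ⟨d, hd, e⟩ := exists_ind_add hb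
  refine ⟨d, hd, e, ?_⟩
  have := (hM.bijOn_monomial hd).surjOn
  rw [e] at this
  exact this hm

variable {W : Type*} [AddCommGroup W] [Module k W] [Module (S k n) W] [IsScalarTower k (S k n) W]

/-- `S`-linear maps on a squarefree module are determined on the squarefree components. -/
lemma lin_ext (hM : IsSqS M) {f g : M →ₗ[S k n] W} (h : ∀ F, ∀ m ∈ M.deg (ind F), f m = g m) : f = g := by
  have : f.restrictScalars k = g.restrictScalars k := GrMod.lin_ext M fun b m hm => by
    by_cases hb : 0 ≤ b
    · obtain ⟨d, -, -, u, hu, rfl⟩ := hM.exists_monomial hb hm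
      change f (_ • u) = g (_ • u)
      rw [map_smul, map_smul, h _ u hu]
    · rw [hM.nonneg b hb, Submodule.mem_bot] at hm
      rw [hm, map_zero, map_zero]
  exact LinearMap.ext fun m => LinearMap.congr_fun this m

/-- `S`-linear maps on a squarefree module are given by compatible maps on the squarefree
components. -/
lemma exists_lin (hM : IsSqS M) (T : ∀ F, M.deg (ind F) →ₗ[k] W)
    (hT : ∀ F l (hl : l ∉ F) (m : M.deg (ind F)),
      T (insert l F) ⟨(MvPolynomial.X l : S k n) • m.1, ind_insert hl ▸ X_smul_mem M l m.2⟩ =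
        (MvPolynomial.X l : S k n) • T F m) :
    ∃ f : M →ₗ[S k n] W, ∀ F (m : M.deg (ind F)), f m.1 = T F m := by
  -- In degree `a ≥ 0` every element is `x^d u` for a unique `u` of degree `supp₊ a`, where `d = a -
  -- supp₊ a`, and linearity forces the value `x^d T(u)`. In the other degrees the map is zero.
  have key : ∀ a, ∃ g : M.deg a →ₗ[k] W, ∀ d : Fin n →₀ ℕ, (∀ l, d l ≠ 0 → l ∈ supp a) →
      ind (supp a) + toZ d = a → ∀ (m : M.deg (ind (supp a)))
        (h : (MvPolynomial.monomial d (1 : k) : S k n) • m.1 ∈ M.deg a),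
        g ⟨_, h⟩ = (MvPolynomial.monomial d (1 : k) : S k n) • T (supp a) m := by
    intro a
    by_cases h : ∃ d : Fin n →₀ ℕ, (∀ l, d l ≠ 0 → l ∈ supp a) ∧ ind (supp a) + toZ d = a
    · obtain ⟨d, hd, e⟩ := h
      have hb := hM.bijOn_monomial hd
      rw [e] at hb
      let μ : M.deg (ind (supp a)) →ₗ[k] M.deg a :=
        (((LinearMap.lsmul (S k n) M (MvPolynomial.monomial d 1)).restrictScalars k)).restrict
          fun m hm => hb.mapsTo hm
      let ε := LinearEquiv.ofBijective μ
        ⟨fun x y hxy => Subtype.ext (hb.injOn x.2 y.2 (congrArg Subtype.val hxy)), fun y => by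
          obtain ⟨x, hx, e⟩ := hb.surjOn y.2
          exact ⟨⟨x, hx⟩, Subtype.ext e⟩⟩
      refine ⟨(LinearMap.lsmul (S k n) W (MvPolynomial.monomial d 1)).restrictScalars k ∘ₗ
        T (supp a) ∘ₗ ε.symm.toLinearMap, fun d' _ e' m h => ?_⟩
      obtain rfl : d' = d := toZ_injective (add_left_cancel (e'.trans e.symm))
      have h2 : ε.symm ⟨_, h⟩ = m := by
        rw [LinearEquiv.symm_apply_eq]
        rfl
      change (MvPolynomial.monomial d' (1 : k) : S k n) • T (supp a) (ε.symm ⟨_, h⟩) = _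
      rw [h2]
    · exact ⟨0, fun d hd e => absurd ⟨d, hd, e⟩ h⟩
  choose g hg using key
  have hf : ∀ F (d : Fin n →₀ ℕ), (∀ l, d l ≠ 0 → l ∈ F) → ∀ m : M.deg (ind F),
      M.lift g ((MvPolynomial.monomial d (1 : k) : S k n) • m.1) =
        (MvPolynomial.monomial d (1 : k) : S k n) • T F m := by
    intro F d hd m
    have h1 := (hM.bijOn_monomial hd).mapsTo m.2
    generalize e : ind F + toZ d = a at h1
    obtain rfl : supp a = F := by rw [← e, supp_ind_add hd]
    exact (M.lift_of_mem g h1).trans (hg a d hd e m h1)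
  have hX : ∀ l x, M.lift g ((MvPolynomial.X l : S k n) • x) =
      (MvPolynomial.X l : S k n) • M.lift g x := by
    intro l
    refine LinearMap.congr_fun (f := M.lift g ∘ₗ mulX M l)
      (g := (LinearMap.lsmul (S k n) W (MvPolynomial.X l)).restrictScalars k ∘ₗ M.lift g)
      (GrMod.lin_ext M fun a m hm => ?_)
    change M.lift g ((MvPolynomial.X l : S k n) • m) = (MvPolynomial.X l : S k n) • M.lift g m
    by_cases ha : 0 ≤ a
    · obtain ⟨d, hd, -, u, hu, rfl⟩ := hM.exists_monomial ha hm
      rw [hf _ d hd ⟨u, hu⟩]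
      -- If `l` is in the support, `x_l` is absorbed into the monomial. If not, it enlarges the
      -- support, and the compatibility `hT` is used.
      by_cases hl : l ∈ supp a
      · have e1 : MvPolynomial.X l * MvPolynomial.monomial d (1 : k) =
            MvPolynomial.monomial (d + Finsupp.single l 1) 1 := by
          rw [MvPolynomial.X, MvPolynomial.monomial_mul, one_mul, add_comm]
        rw [smul_smul, smul_smul, e1]
        refine hf _ _ (fun m hm => ?_) ⟨u, hu⟩
        by_cases hml : m = l
        · rwa [hml]
        · exact hd m (by simpa [Finsupp.single_apply, Ne.symm hml] using hm)
      · rw [smul_comm, smul_comm (MvPolynomial.X l : S k n), ← hT _ l hl]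
        exact hf _ d (fun m hm => Finset.mem_insert_of_mem (hd m hm)) ⟨_, _⟩
    · rw [hM.nonneg a ha, Submodule.mem_bot] at hm
      rw [hm, smul_zero, map_zero, smul_zero]
  refine ⟨{ M.lift g with map_smul' := isLinear_of_X _ hX }, fun F m => ?_⟩
  have := hf F 0 (fun l hl => absurd rfl hl) m
  have e1 : MvPolynomial.monomial (0 : Fin n →₀ ℕ) (1 : k) = 1 := rfl
  rw [e1, one_smul, one_smul] at this
  exact this

variable {N : GrMod (grS k n)}

lemma map_deg_of_ind (hM : IsSqS M) {f : M →ₗ[S k n] N} (hf : ∀ F, ∀ m ∈ M.deg (ind F), f m ∈ N.deg (ind F))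
    (a : Fin n → ℤ) (m : M) (hm : m ∈ M.deg a) : f m ∈ N.deg a := by
  by_cases ha : 0 ≤ a
  · obtain ⟨d, -, e, u, hu, rfl⟩ := hM.exists_monomial ha hm
    rw [map_smul]
    have := N.smul_mem (monomial_mem_grS d 1) (hf _ u hu)
    rwa [add_comm, e] at this
  · rw [hM.nonneg a ha, Submodule.mem_bot] at hm
    rw [hm, map_zero]
    exact Submodule.zero_mem _

lemma bijOn_of_ind (hM : IsSqS M) (hN : IsSqS N) {f : M ⟶ N}
    (hf : ∀ F, Set.BijOn f.lin (M.deg (ind F)) (N.deg (ind F))) (a : Fin n → ℤ) :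
    Set.BijOn f.lin (M.deg a) (N.deg a) := by
  by_cases ha : 0 ≤ a
  · obtain ⟨d, hd, e⟩ := exists_ind_add ha
    have h1 := hM.bijOn_monomial hd
    have h2 := hN.bijOn_monomial hd
    rw [e] at h1 h2
    refine ⟨fun m hm => f.map_deg a m hm, fun x hx y hy hxy => ?_, fun y hy => ?_⟩
    · obtain ⟨u, hu, rfl⟩ := h1.surjOn hx
      obtain ⟨v, hv, rfl⟩ := h1.surjOn hy
      dsimp only at hxy ⊢
      rw [map_smul, map_smul] at hxy
      rw [(hf _).injOn hu hv (h2.injOn (f.map_deg _ _ hu) (f.map_deg _ _ hv) hxy)]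
    · obtain ⟨v, hv, rfl⟩ := h2.surjOn hy
      obtain ⟨u, hu, rfl⟩ := (hf _).surjOn hv
      exact ⟨_, h1.mapsTo hu, map_smul _ _ _⟩
  · rw [hM.nonneg a ha, hN.nonneg a ha]
    simp

end IsSqS

section

variable {A : Type u} [Ring A] [Algebra k A] {𝒜 : (Fin n → ℤ) → Submodule k A}

lemma GrMod.bijective_of_bijOn {M N : GrMod 𝒜} {f : M ⟶ N}
    (h : ∀ a, Set.BijOn f.lin (M.deg a) (N.deg a)) : Function.Bijective f.lin := by
  choose ι hι using fun a (y : N.deg a) => (h a).surjOn y.2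
  let g : ∀ a, N.deg a →ₗ[k] M := fun a =>
    { toFun := ι a
      map_add' := fun x y => (h a).injOn (hι a _).1
        (Submodule.add_mem _ (hι a x).1 (hι a y).1) (by
          rw [(hι a _).2, map_add, (hι a x).2, (hι a y).2]; rfl)
      map_smul' := fun c x => (h a).injOn (hι a _).1
        (Submodule.smul_mem _ c (hι a x).1) (by
          rw [(hι a _).2, RingHom.id_apply, lin_smul, (hι a x).2]; rfl) }
  have h1 : ∀ y, f.lin (N.lift g y) = y := LinearMap.congr_fun
    (f := f.lin.restrictScalars k ∘ₗ N.lift g) (g := LinearMap.id) (N.lin_ext fun a y hy => by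
      change f.lin (N.lift g y) = y
      rw [N.lift_of_mem g hy]
      exact (hι a ⟨y, hy⟩).2)
  have h2 : ∀ x, N.lift g (f.lin x) = x := LinearMap.congr_fun
    (f := N.lift g ∘ₗ f.lin.restrictScalars k) (g := LinearMap.id) (M.lin_ext fun a x hx => by
      change N.lift g (f.lin x) = x
      rw [N.lift_of_mem g (f.map_deg a x hx)]
      exact (h a).injOn (hι a _).1 hx (hι a ⟨_, f.map_deg a x hx⟩).2)
  exact Function.bijective_iff_has_inverse.mpr ⟨_, h2, h1⟩

lemma GrMod.isIso_of_bijOn {M N : GrMod 𝒜} {f : M ⟶ N}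
    (h : ∀ a, Set.BijOn f.lin (M.deg a) (N.deg a)) : IsIso f := by
  let ε := LinearEquiv.ofBijective f.lin (GrMod.bijective_of_bijOn h)
  refine ⟨⟨ε.symm.toLinearMap, fun a y hy => ?_⟩, GrMod.hom_ext ε.symm_apply_apply,
    GrMod.hom_ext ε.apply_symm_apply⟩
  obtain ⟨x, hx, rfl⟩ := (h a).surjOn hy
  have : ε.symm (f.lin x) = x := ε.symm_apply_apply x
  rw [LinearEquiv.coe_coe, this]
  exact hx

lemma qis_of_bijOn {P : ObjectProperty (GrMod 𝒜)} {K L : Com P} {f : K ⟶ L}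
    (h : ∀ i a, Set.BijOn (f.f i).hom.lin ((K.X i).obj.deg a) ((L.X i).obj.deg a)) : qis P f := by
  refine (qis_iff_cone f).mpr fun i a x hx y hy _ h2 => ?_
  obtain ⟨z, hz, rfl⟩ := (h _ a).surjOn hy
  refine ⟨z, hz, 0, Submodule.zero_mem _, ?_, by rw [map_zero, add_zero]⟩
  refine (h _ a).injOn ((K.d _ _).hom.map_deg _ _ hz) hx ?_
  rw [f_d, h2]

end

variable {k : Type u} [Field k] {n : ℕ}

section

variable {M N : SqS k n}

lemma sq_hom_ext {f g : M ⟶ N} (h : ∀ F, ∀ m ∈ M.obj.deg (ind F), f.hom.lin m = g.hom.lin m) :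
    f = g :=
  ObjectProperty.hom_ext _ (GrMod.Hom.ext (M.property.lin_ext h))

/-- The morphism of squarefree modules with prescribed restrictions to the squarefree
components. -/
def sqHom (T : ∀ F, M.obj.deg (ind F) →ₗ[k] N.obj) (hN : ∀ F m, T F m ∈ N.obj.deg (ind F))
    (hT : ∀ F l (hl : l ∉ F) (m : M.obj.deg (ind F)),
      T (insert l F) ⟨(MvPolynomial.X l : S k n) • m.1, ind_insert hl ▸ X_smul_mem M.obj l m.2⟩ =
        (MvPolynomial.X l : S k n) • T F m) : M ⟶ N :=
  ObjectProperty.homMk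
    { lin := (M.property.exists_lin T hT).choose
      map_deg := M.property.map_deg_of_ind fun F m hm => by
        rw [(M.property.exists_lin T hT).choose_spec F ⟨m, hm⟩]
        exact hN F ⟨m, hm⟩ }

lemma sqHom_apply (T : ∀ F, M.obj.deg (ind F) →ₗ[k] N.obj) (hN : ∀ F m, T F m ∈ N.obj.deg (ind F))
    (hT : ∀ F l (hl : l ∉ F) (m : M.obj.deg (ind F)),
      T (insert l F) ⟨(MvPolynomial.X l : S k n) • m.1, ind_insert hl ▸ X_smul_mem M.obj l m.2⟩ =
        (MvPolynomial.X l : S k n) • T F m) {F : Finset (Fin n)} {m : M.obj}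
    (hm : m ∈ M.obj.deg (ind F)) : (sqHom T hN hT).hom.lin m = T F ⟨m, hm⟩ :=
  (M.property.exists_lin T hT).choose_spec F ⟨m, hm⟩

lemma sq_isIso_of_bijOn {f : M ⟶ N}
    (h : ∀ F, Set.BijOn f.hom.lin (M.obj.deg (ind F)) (N.obj.deg (ind F))) : IsIso f := by
  have : IsIso ((ObjectProperty.ι _).map f) :=
    GrMod.isIso_of_bijOn (M.property.bijOn_of_ind N.property h)
  exact isIso_of_fully_faithful (ObjectProperty.ι _) f

end

/-! #### Elements of squarefree degree -/

namespace BoolRep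

variable (ρ : BoolRep k n)

/-- The element of degree `F` of the squarefree module of `ρ` given by `v ∈ U F`. -/
def sq (F : Finset (Fin n)) {v : ρ.V} (hv : v ∈ ρ.U F) : ρ.toSq.obj :=
  ρ.elt (ind_nonneg F) ((supp_ind F).symm ▸ hv)

variable {ρ} {F : Finset (Fin n)}

lemma sq_mem {v : ρ.V} (hv : v ∈ ρ.U F) : ρ.sq F hv ∈ ρ.toSq.obj.deg (ind F) := elt_mem _ _

lemma exists_sq {x : ρ.toSq.obj} (hx : x ∈ ρ.toSq.obj.deg (ind F)) :
    ∃ v, ∃ hv : v ∈ ρ.U F, x = ρ.sq F hv := by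
  obtain ⟨v, hv, e⟩ := exists_elt (ind_nonneg F) hx
  have hv' := hv
  rw [supp_ind] at hv'
  exact ⟨v, hv', e⟩

lemma coef_sq {v : ρ.V} (hv : v ∈ ρ.U F) : ρ.coef (ind F) (ρ.sq F hv) = v := coef_elt _ _

lemma sq_add {v w : ρ.V} (hv : v ∈ ρ.U F) (hw : w ∈ ρ.U F) :
    ρ.sq F (Submodule.add_mem _ hv hw) = ρ.sq F hv + ρ.sq F hw :=
  Subtype.ext ((ρ.inc _).map_add v w)

lemma sq_smul (c : k) {v : ρ.V} (hv : v ∈ ρ.U F) :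
    ρ.sq F (Submodule.smul_mem _ c hv) = c • ρ.sq F hv :=
  Subtype.ext ((ρ.inc _).map_smul c v)

lemma X_smul_sq {l : Fin n} (hl : l ∉ F) {v : ρ.V} (hv : v ∈ ρ.U F) :
    (MvPolynomial.X l : S k n) • ρ.sq F hv = ρ.sq (insert l F) (ρ.mapU F l v hl hv) := by
  refine Subtype.ext ?_
  change (MvPolynomial.X l : S k n) • ρ.inc (ind F) v = ρ.inc (ind (insert l F)) (ρ.t l F v)
  rw [X_smul, op_single_zero _ (by simp [ind, hl]), supp_ind, ind_insert hl]

end BoolRep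

section

variable {M M' : SqS k n} {F : Finset (Fin n)}

/-- The element of degree `F` of `A(M)` given by a linear form on the component of
degree `[n] ∖ F` of `M`. -/
def aSq (F : Finset (Fin n)) {φ : Module.Dual k M.obj} (hφ : φ ∈ M.obj.dualDeg (ind Fᶜ)) :
    ((alex k n).obj (Opposite.op M)).obj := (alexRep M).sq F hφ

lemma aSq_mem {φ : Module.Dual k M.obj} (hφ : φ ∈ M.obj.dualDeg (ind Fᶜ)) :
    aSq F hφ ∈ ((alex k n).obj (Opposite.op M)).obj.deg (ind F) :=
  BoolRep.sq_mem (ρ := alexRep M) hφ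

lemma exists_aSq {x : ((alex k n).obj (Opposite.op M)).obj}
    (hx : x ∈ ((alex k n).obj (Opposite.op M)).obj.deg (ind F)) :
    ∃ φ, ∃ hφ : φ ∈ M.obj.dualDeg (ind Fᶜ), x = aSq F hφ :=
  BoolRep.exists_sq (ρ := alexRep M) hx

lemma aSq_congr {φ ψ : Module.Dual k M.obj} {hφ : φ ∈ M.obj.dualDeg (ind Fᶜ)}
    {hψ : ψ ∈ M.obj.dualDeg (ind Fᶜ)} (h : φ = ψ) : aSq F hφ = aSq F hψ := by subst h; rfl

lemma aSq_add {φ ψ : Module.Dual k M.obj} (hφ : φ ∈ M.obj.dualDeg (ind Fᶜ))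
    (hψ : ψ ∈ M.obj.dualDeg (ind Fᶜ)) :
    aSq F (Submodule.add_mem _ hφ hψ) = aSq F hφ + aSq F hψ :=
  BoolRep.sq_add (ρ := alexRep M) hφ hψ

lemma aSq_smul (c : k) {φ : Module.Dual k M.obj} (hφ : φ ∈ M.obj.dualDeg (ind Fᶜ)) :
    aSq F (Submodule.smul_mem _ c hφ) = c • aSq F hφ :=
  BoolRep.sq_smul (ρ := alexRep M) c hφ

lemma alex_map_aSq (f : M ⟶ M') {φ : Module.Dual k M'.obj} (hφ : φ ∈ M'.obj.dualDeg (ind Fᶜ)) :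
    ((alex k n).map f.op).hom.lin (aSq F hφ) = aSq F (comp_mem_dualDeg f hφ) :=
  Subtype.ext (BoolRep.mapAmb_inc (ρ := alexRep M') (σ := alexRep M) _ _ φ)

lemma comp_mulX_mem_dualDeg {l : Fin n} (hl : l ∉ F) {φ : Module.Dual k M.obj}
    (hφ : φ ∈ M.obj.dualDeg (ind Fᶜ)) : φ ∘ₗ mulX M.obj l ∈ M.obj.dualDeg (ind (insert l F)ᶜ) :=
  (alexRep M).mapU F l φ hl hφ

lemma X_smul_aSq {l : Fin n} (hl : l ∉ F) {φ : Module.Dual k M.obj}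
    (hφ : φ ∈ M.obj.dualDeg (ind Fᶜ)) :
    (MvPolynomial.X l : S k n) • aSq F hφ = aSq (insert l F) (comp_mulX_mem_dualDeg hl hφ) :=
  BoolRep.X_smul_sq (ρ := alexRep M) hl hφ

variable (M) in
/-- The linear form on the component of degree `[n] ∖ F` of `M` that is the coefficient of
degree `F` of an element of `A(M)`. -/
def aCoef (F : Finset (Fin n)) : ((alex k n).obj (Opposite.op M)).obj →ₗ[k] Module.Dual k M.obj :=
  (alexRep M).coef (ind F)

lemma aCoef_aSq {φ : Module.Dual k M.obj} (hφ : φ ∈ M.obj.dualDeg (ind Fᶜ)) :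
    aCoef M F (aSq F hφ) = φ := BoolRep.coef_sq (ρ := alexRep M) hφ

lemma aCoef_of_ne {b : Fin n → ℤ} (h : b ≠ ind F) {x : ((alex k n).obj (Opposite.op M)).obj}
    (hx : x ∈ ((alex k n).obj (Opposite.op M)).obj.deg b) : aCoef M F x = 0 :=
  BoolRep.coef_of_ne (ρ := alexRep M) h hx

end

/-! #### Biduality for `A` -/

section

variable (M : SqS k n)

/-- Evaluation of linear forms at an element of degree `F`. -/
def evA (F : Finset (Fin n)) :
    M.obj →ₗ[k] Module.Dual k ((alex k n).obj (Opposite.op M)).obj := (aCoef M Fᶜ).flip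

variable {M}

lemma evA_apply (F : Finset (Fin n)) (m : M.obj) (y : ((alex k n).obj (Opposite.op M)).obj) :
    evA M F m y = aCoef M Fᶜ y m := rfl

lemma evA_mem (F : Finset (Fin n)) (m : M.obj) :
    evA M F m ∈ ((alex k n).obj (Opposite.op M)).obj.dualDeg (ind Fᶜ) := by
  intro b hb y hy
  rw [evA_apply, aCoef_of_ne hb hy]
  rfl

lemma evA_X {F : Finset (Fin n)} {l : Fin n} (hl : l ∉ F) (m : M.obj) :
    evA M (insert l F) ((MvPolynomial.X l : S k n) • m) = evA M F m ∘ₗ mulX _ l := by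
  refine GrMod.eq_of_mem_dualDeg (evA_mem _ _) (comp_mulX_mem_dualDeg hl (evA_mem F m))
    fun y hy => ?_
  obtain ⟨φ, hφ, rfl⟩ := exists_aSq hy
  have hl' : l ∉ (insert l F)ᶜ := by simp
  have e1 : insert l (insert l F)ᶜ = Fᶜ := by
    ext m; by_cases h : m = l <;> simp_all
  rw [evA_apply, aCoef_aSq, LinearMap.comp_apply, mulX_apply, X_smul_aSq hl', evA_apply]
  have : ∀ (G : Finset (Fin n)) (hG : insert l (insert l F)ᶜ = G),
      aCoef M G (aSq _ (comp_mulX_mem_dualDeg hl' hφ)) = φ ∘ₗ mulX M.obj l := by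
    rintro _ rfl
    exact aCoef_aSq _
  rw [this _ e1]
  rfl

variable (M) in
/-- The component of degree `F` of the morphism `M → A(A(M))`. -/
def bidualLin (F : Finset (Fin n)) : M.obj.deg (ind F) →ₗ[k]
    ((alex k n).obj (Opposite.op ((alex k n).obj (Opposite.op M)))).obj where
  toFun m := aSq F (evA_mem F m.1)
  map_add' x y := (aSq_congr ((evA M F).map_add x.1 y.1)).trans (aSq_add _ _)
  map_smul' c x := (aSq_congr ((evA M F).map_smul c x.1)).trans (aSq_smul c _)

lemma bidualLin_X {F : Finset (Fin n)} {l : Fin n} (hl : l ∉ F) (m : M.obj.deg (ind F)) :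
    bidualLin M (insert l F)
      ⟨(MvPolynomial.X l : S k n) • m.1, ind_insert hl ▸ X_smul_mem M.obj l m.2⟩ =
        (MvPolynomial.X l : S k n) • bidualLin M F m := by
  refine Eq.trans ?_ (X_smul_aSq hl (evA_mem F m.1)).symm
  exact aSq_congr (hφ := evA_mem _ _) (evA_X hl m.1)

variable (M) in
/-- The morphism `M → A(A(M))`. -/
def bidual : M ⟶ (alex k n).obj (Opposite.op ((alex k n).obj (Opposite.op M))) :=
  sqHom (bidualLin M) (fun F m => aSq_mem (evA_mem F m.1)) fun _ _ => bidualLin_X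

lemma bidual_apply {F : Finset (Fin n)} {m : M.obj} (hm : m ∈ M.obj.deg (ind F)) :
    (bidual M).hom.lin m = aSq F (evA_mem F m) :=
  sqHom_apply (bidualLin M) _ _ hm

lemma bidual_naturality {M N : SqS k n} (f : M ⟶ N) :
    f ≫ bidual N = bidual M ≫ (alex k n).map ((alex k n).map f.op).op := by
  refine sq_hom_ext fun F m hm => ?_
  change (bidual N).hom.lin (f.hom.lin m) =
    ((alex k n).map ((alex k n).map f.op).op).hom.lin ((bidual M).hom.lin m)
  rw [bidual_apply hm, bidual_apply (f.hom.map_deg _ _ hm), alex_map_aSq]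
  refine aSq_congr (GrMod.eq_of_mem_dualDeg (evA_mem _ _) (comp_mem_dualDeg _ (evA_mem _ _))
    fun y hy => ?_)
  obtain ⟨φ, hφ, rfl⟩ := exists_aSq hy
  rw [evA_apply, aCoef_aSq, LinearMap.comp_apply]
  refine Eq.trans ?_ (congrArg (evA M F m) (alex_map_aSq f hφ)).symm
  rw [evA_apply, aCoef_aSq]
  rfl

/-- In each squarefree degree this is the map of a vector space to its double dual. Injectivity
holds because linear forms separate points, and surjectivity because the components are finite
dimensional. -/
instance : IsIso (bidual M) := by
  refine sq_isIso_of_bijOn fun F => ⟨fun m hm => (bidual M).hom.map_deg _ m hm, ?_, ?_⟩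
  · intro x hx y hy hxy
    rw [bidual_apply hx, bidual_apply hy] at hxy
    have h1 : evA M F x = evA M F y := by
      have := congrArg (aCoef _ F) hxy
      rwa [aCoef_aSq, aCoef_aSq] at this
    rw [← sub_eq_zero]
    refine GrMod.eq_zero_of_dualDeg (Submodule.sub_mem _ hx hy) fun φ hφ => ?_
    have hφ' : φ ∈ M.obj.dualDeg (ind (Fᶜ)ᶜ) := by rwa [compl_compl]
    have h2 := LinearMap.congr_fun h1 (aSq Fᶜ hφ')
    rw [evA_apply, evA_apply, aCoef_aSq] at h2
    rw [map_sub, h2, sub_self]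
  · intro y hy
    obtain ⟨Ψ, hΨ, rfl⟩ := exists_aSq hy
    have hmem : ∀ φ ∈ M.obj.dualDeg (ind F), φ ∈ M.obj.dualDeg (ind (Fᶜ)ᶜ) := fun φ hφ => by
      rwa [compl_compl]
    let ℓ : M.obj.dualDeg (ind F) →ₗ[k] k :=
      { toFun := fun φ => Ψ (aSq Fᶜ (hmem φ.1 φ.2))
        map_add' := fun φ ψ => by
          rw [← map_add]
          exact congrArg Ψ (aSq_add (hmem φ.1 φ.2) (hmem ψ.1 ψ.2))
        map_smul' := fun c φ => by
          rw [RingHom.id_apply, ← map_smul]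
          exact congrArg Ψ (aSq_smul c (hmem φ.1 φ.2)) }
    obtain ⟨m, hm, e⟩ := GrMod.exists_eval (M.property.finite (ind F)) ℓ
    refine ⟨m, hm, ?_⟩
    rw [bidual_apply hm]
    refine aSq_congr (GrMod.eq_of_mem_dualDeg (evA_mem _ _) hΨ fun y hy => ?_)
    obtain ⟨φ, hφ, rfl⟩ := exists_aSq hy
    rw [evA_apply, aCoef_aSq]
    exact (e φ (by rwa [compl_compl] at hφ)).symm

end

variable {k : Type u} [Field k] {n : ℕ}

/-- The terms of the morphism `M → A(A(M))` for complexes. -/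
def bidualX (K : Com (IsSqS (k := k) (n := n))) (i : ℤ) :
    K.X i ⟶ (alex k n).obj (Opposite.op ((alex k n).obj (Opposite.op (K.X (- -i))))) :=
  (K.XIsoOfEq (neg_neg i).symm).hom ≫ bidual (K.X (- -i))

lemma bidualX_d (K : Com (IsSqS (k := k) (n := n))) (i j : ℤ) :
    bidualX K i ≫ (alex k n).map ((alex k n).map (K.d (- -i) (- -j)).op).op =
      K.d i j ≫ bidualX K j := by
  rw [bidualX, bidualX, Category.assoc, ← bidual_naturality, ← Category.assoc, ← Category.assoc,
    HomologicalComplex.XIsoOfEq_hom_comp_d, HomologicalComplex.d_comp_XIsoOfEq_hom]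

lemma bidualX_naturality {K L : Com (IsSqS (k := k) (n := n))} (f : K ⟶ L) (i : ℤ) :
    f.f i ≫ bidualX L i =
      bidualX K i ≫ (alex k n).map ((alex k n).map (f.f (- -i)).op).op := by
  rw [bidualX, bidualX, Category.assoc, ← bidual_naturality, ← Category.assoc,
    HomologicalComplex.XIsoOfEq_hom_naturality, Category.assoc]

instance (K : Com (IsSqS (k := k) (n := n))) (i : ℤ) : IsIso (bidualX K i) := by
  unfold bidualX; infer_instance

/-- The morphism `M → A(A(M))` for bounded complexes. -/
def bidualCom (M : ComB (IsSqS (k := k) (n := n))) :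
    M ⟶ (alexCom k n).obj (Opposite.op ((alexCom k n).obj (Opposite.op M))) :=
  ObjectProperty.homMk { f := bidualX M.obj, comm' := fun i j _ => bidualX_d M.obj i j }

lemma bidualCom_naturality {M N : ComB (IsSqS (k := k) (n := n))} (f : M ⟶ N) :
    f ≫ bidualCom N = bidualCom M ≫ (alexCom k n).map ((alexCom k n).map f.op).op :=
  ObjectProperty.hom_ext _ (HomologicalComplex.hom_ext _ _ fun i => bidualX_naturality f.hom i)

instance (M : ComB (IsSqS (k := k) (n := n))) : IsIso (bidualCom M) := by
  have h1 : ∀ i, IsIso ((bidualCom M).hom.f i) := fun i =>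
    inferInstanceAs (IsIso (bidualX M.obj i))
  have h2 : IsIso ((isBounded _).ι.map (bidualCom M)) :=
    HomologicalComplex.Hom.isIso_of_components (bidualCom M).hom
  exact isIso_of_fully_faithful (isBounded _).ι _

/-! ### The comparison of `𝒮 ∘ ℛ` with `D ∘ A` -/

variable {k : Type u} [Field k] {n : ℕ}

/-! #### Coefficients of elements of the dualizing complex -/

namespace Om

/-- The coefficient of the basis element `(G, a)`. -/
def coef (G : Finset (Fin n)) (a : Fin n → ℤ) : Om k n →ₗ[k] k :=
  (Finsupp.lapply (G, a) : ((Finset (Fin n) × (Fin n → ℤ)) →₀ k) →ₗ[k] k)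

lemma coef_mon_same (G : Finset (Fin n)) (a : Fin n → ℤ) : coef G a (mon G a : Om k n) = 1 :=
  Finsupp.single_eq_same

lemma coef_mon_ne {G G' : Finset (Fin n)} {a a' : Fin n → ℤ} (h : (G', a') ≠ (G, a)) :
    coef G a (mon G' a' : Om k n) = 0 := Finsupp.single_eq_of_ne h.symm

/-- For `l ∈ G`, multiplication by `x_l` shifts the monomials of the summand of `G` injectively and
preserves the summands, so no coefficient is lost or mixed. -/
lemma coef_X {G : Finset (Fin n)} {l : Fin n} (hl : l ∈ G) (a : Fin n → ℤ) (y : Om k n) :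
    coef G (a + eps l) ((MvPolynomial.X l : S k n) • y) = coef G a y := by
  rw [X_smul]
  refine LinearMap.congr_fun (f := coef G (a + eps l) ∘ₗ op l) (hom_ext fun G' a' => ?_) y
  rw [LinearMap.comp_apply]
  by_cases h : (G', a') = (G, a)
  · obtain ⟨rfl, rfl⟩ := Prod.mk.inj h
    rw [op_pos (Or.inl hl), coef_mon_same, coef_mon_same]
  · rw [coef_mon_ne h]
    by_cases h1 : l ∈ G' ∨ a' l < 0
    · rw [op_pos h1, coef_mon_ne]
      intro h2
      obtain ⟨rfl, h3⟩ := Prod.mk.inj h2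
      exact h (by rw [add_right_cancel h3])
    · rw [op_neg h1, map_zero]

lemma eq_sum {i : ℤ} {a : Fin n → ℤ} {y : Om k n} (hy : y ∈ piece k i a) :
    y = ∑ G, coef G a y • mon G a := by
  have := eq_on_piece (f := LinearMap.id)
    (g := ∑ G, LinearMap.smulRight (coef G a) (mon G a : Om k n)) (fun F _ _ => by
      rw [LinearMap.id_apply, LinearMap.sum_apply, Finset.sum_eq_single F]
      · rw [LinearMap.smulRight_apply, coef_mon_same, one_smul]
      · intro G _ hG
        rw [LinearMap.smulRight_apply, coef_mon_ne (fun h => hG (Prod.mk.inj h).1.symm), zero_smul]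
      · simp) hy
  rw [LinearMap.id_apply, LinearMap.sum_apply] at this
  exact this

lemma coef_eq_zero {i : ℤ} {a : Fin n → ℤ} {y : Om k n} (hy : y ∈ piece k i a)
    {G : Finset (Fin n)} (h : ¬ ((G.card : ℤ) = -i ∧ ∀ l ∉ G, a l ≤ 0)) : coef G a y = 0 :=
  eq_on_piece (f := coef G a) (g := 0) (fun F h1 h2 => by
    rw [coef_mon_ne, LinearMap.zero_apply]
    rintro h3
    obtain ⟨rfl, -⟩ := Prod.mk.inj h3
    exact h ⟨h1, h2⟩) hy

end Om

/-! #### The maps `A(M) → ω` given by elements of `M` -/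

variable (k) in
/-- The squarefree monomial with support `H`. -/
def xS (H : Finset (Fin n)) : S k n := ∏ l ∈ H, MvPolynomial.X l

lemma xS_insert {H : Finset (Fin n)} {l : Fin n} (hl : l ∉ H) :
    xS k (insert l H) = MvPolynomial.X l * xS k H := Finset.prod_insert hl

section

variable {M : SqS k n}

/-- The component of degree `B` of the map `A(M) → ω` of degree `F` given by a family of elements
of `M`. -/
def capLin (F : Finset (Fin n)) (v : Finset (Fin n) → M.obj) (B : Finset (Fin n)) :
    ((alex k n).obj (Opposite.op M)).obj.deg (ind B) →ₗ[k] Om k n :=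
  (∑ G, if F ∪ B ⊆ G then LinearMap.smulRight
    (Module.Dual.eval k M.obj (xS k (G \ B) • v G)) (Om.mon G (ind B + ind F)) else 0) ∘ₗ
      aCoef M B ∘ₗ Submodule.subtype _

lemma capLin_apply (F : Finset (Fin n)) (v : Finset (Fin n) → M.obj) {B : Finset (Fin n)}
    {φ : Module.Dual k M.obj} (hφ : φ ∈ M.obj.dualDeg (ind Bᶜ)) :
    capLin F v B ⟨aSq B hφ, aSq_mem hφ⟩ =
      ∑ G, if F ∪ B ⊆ G then φ (xS k (G \ B) • v G) • Om.mon G (ind B + ind F) else 0 := by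
  rw [capLin, LinearMap.comp_apply, LinearMap.comp_apply, Submodule.subtype_apply, aCoef_aSq,
    LinearMap.sum_apply]
  refine Finset.sum_congr rfl fun G _ => ?_
  split_ifs <;> rfl

/-- The form `φ ∘ x_l` turns `x^{G∖(B∪l)}` into `x^{G∖B}` for `l ∈ G`. For `l ∉ G` the sum on the
left has no summand at `G`, and on the right `x_l` kills the monomial, whose `l`-th exponent is `0`.
-/
lemma capLin_X (F : Finset (Fin n)) (v : Finset (Fin n) → M.obj) {B : Finset (Fin n)} {l : Fin n}
    (hl : l ∉ B) (y : ((alex k n).obj (Opposite.op M)).obj.deg (ind B)) :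
    capLin F v (insert l B) ⟨(MvPolynomial.X l : S k n) • y.1,
        ind_insert hl ▸ X_smul_mem _ l y.2⟩ =
      (MvPolynomial.X l : S k n) • capLin F v B y := by
  obtain ⟨y, hy⟩ := y
  obtain ⟨φ, hφ, rfl⟩ := exists_aSq hy
  have h1 := capLin_apply F v (comp_mulX_mem_dualDeg hl hφ)
  have h2 : (⟨(MvPolynomial.X l : S k n) • aSq B hφ, ind_insert hl ▸ X_smul_mem _ l hy⟩ :
      ((alex k n).obj (Opposite.op M)).obj.deg (ind (insert l B))) =
      ⟨aSq (insert l B) (comp_mulX_mem_dualDeg hl hφ), aSq_mem _⟩ := Subtype.ext (X_smul_aSq hl hφ)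
  rw [h2, h1, capLin_apply, Finset.smul_sum]
  refine Finset.sum_congr rfl fun G _ => ?_
  have h3 : F ∪ insert l B ⊆ G ↔ l ∈ G ∧ F ∪ B ⊆ G := by
    rw [Finset.union_insert, Finset.insert_subset_iff]
  by_cases h4 : F ∪ B ⊆ G
  · rw [if_pos h4, smul_comm, Om.X_smul]
    by_cases h5 : l ∈ G
    · rw [if_pos (h3.mpr ⟨h5, h4⟩), Om.op_pos (Or.inl h5), LinearMap.comp_apply, mulX_apply,
        smul_smul, ← xS_insert (by simp), ind_insert hl, add_right_comm]
      congr 5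
      ext m
      by_cases h : m = l <;> simp_all
    · rw [if_neg (fun h => h5 (h3.mp h).1), Om.op_neg, smul_zero]
      rintro (h | h)
      · exact h5 h
      · have h6 := ind_nonneg B l
        have h7 := ind_nonneg F l
        simp only [Pi.add_apply, Pi.zero_apply] at h h6 h7
        omega
  · rw [if_neg h4, if_neg (fun h => h4 (h3.mp h).2), smul_zero]

/-- The `S`-linear map `A(M) → ω` of degree `F` given by a family of elements of `M`. -/
def cap (F : Finset (Fin n)) (v : Finset (Fin n) → M.obj) :
    ((alex k n).obj (Opposite.op M)).obj →ₗ[S k n] Om k n :=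
  (((alex k n).obj (Opposite.op M)).property.exists_lin (capLin F v)
    fun _ _ => capLin_X F v).choose

lemma cap_apply (F : Finset (Fin n)) (v : Finset (Fin n) → M.obj) {B : Finset (Fin n)}
    {φ : Module.Dual k M.obj} (hφ : φ ∈ M.obj.dualDeg (ind Bᶜ)) :
    cap F v (aSq B hφ) =
      ∑ G, if F ∪ B ⊆ G then φ (xS k (G \ B) • v G) • Om.mon G (ind B + ind F) else 0 :=
  ((((alex k n).obj (Opposite.op M)).property.exists_lin (capLin F v)
    fun _ _ => capLin_X F v).choose_spec B ⟨aSq B hφ, aSq_mem hφ⟩).trans (capLin_apply F v hφ)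

lemma a_lin_ext {f g : ((alex k n).obj (Opposite.op M)).obj →ₗ[S k n] Om k n}
    (h : ∀ B (φ : Module.Dual k M.obj) (hφ : φ ∈ M.obj.dualDeg (ind Bᶜ)),
      f (aSq B hφ) = g (aSq B hφ)) : f = g :=
  ((alex k n).obj (Opposite.op M)).property.lin_ext fun B m hm => by
    obtain ⟨φ, hφ, rfl⟩ := exists_aSq hm
    exact h B φ hφ

end

/-! #### Signs -/

variable (k) in
/-- The sign in the comparison of `𝒮 ∘ ℛ` with `D ∘ A`. -/
def sgn (F G : Finset (Fin n)) : k := (-1) ^ (n * G.card + ∑ m ∈ G \ F, alpha m F)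

lemma sgn_mul_self (F G : Finset (Fin n)) : sgn k F G * sgn k F G = 1 := by
  rw [sgn, ← mul_pow]
  simp

/-- Used for the differentials: `(-1)^n` is the sign of the translation, and `(-1)^{α(l, F)}` turns
the sign `(-1)^{α(l, G)}` of `ω` into the sign `(-1)^{α(l, G∖F)}` of `e_l e_{G∖F}`. -/
lemma sgn_insert_right {F G : Finset (Fin n)} {l : Fin n} (hF : F ⊆ G) (hl : l ∉ G) :
    sgn k F (insert l G) = (-1) ^ n * (-1) ^ alpha l F * sgn k F G := by
  have h1 : insert l G \ F = insert l (G \ F) :=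
    Finset.insert_sdiff_of_notMem _ fun h => hl (hF h)
  rw [sgn, sgn, h1, Finset.sum_insert (by simp [hl]), Finset.card_insert_of_notMem hl]
  ring

/-- Used for the action of `x_l`: the three extra signs come from the definition of `𝒮`, from moving
`e_l` to the left past `e_{G∖(F∪l)}`, and from sorting it into that monomial. -/
lemma sgn_insert_left {F G : Finset (Fin n)} {l : Fin n} (hl : l ∉ F) (hG : l ∈ G) :
    sgn k (insert l F) G * (-1) ^ alpha l F * (-1) ^ (G \ insert l F).card *
      (-1) ^ alpha l (G \ insert l F) = sgn k F G := by
  have h1 : G \ F = insert l (G \ insert l F) := by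
    ext m
    by_cases h : m = l <;> simp_all
  have h2 : l ∉ G \ insert l F := by simp
  rw [sgn, sgn]
  generalize G \ insert l F = H at h1 h2
  have h3 : ∑ m ∈ H, alpha m (insert l F) = ∑ m ∈ H, alpha m F + (H.filter fun m => l < m).card := by
    rw [Finset.card_filter, ← Finset.sum_add_distrib]
    exact Finset.sum_congr rfl fun m _ => alpha_insert hl
  have h4 : H.card = (H.filter fun m => l < m).card + alpha l H := by
    rw [alpha, ← Finset.card_filter_add_card_filter_not (s := H) (fun m => l < m)]
    congr 2
    refine Finset.filter_congr fun m hm => ?_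
    have : m ≠ l := fun h => h2 (h ▸ hm)
    omega
  rw [h1, Finset.sum_insert h2, h3, h4]
  have h5 : ((-1 : k) ^ (H.filter fun m => l < m).card) * (-1) ^ (H.filter fun m => l < m).card = 1 := by
    rw [← mul_pow]; simp
  have h6 : ((-1 : k) ^ alpha l H) * (-1) ^ alpha l H = 1 := by
    rw [← mul_pow]; simp
  simp only [pow_add]
  linear_combination ((-1 : k) ^ (n * G.card) * (-1) ^ (∑ m ∈ H, alpha m F) * (-1) ^ alpha l F *
    (-1) ^ alpha l H * (-1) ^ alpha l H) * h5 +
    ((-1 : k) ^ (n * G.card) * (-1) ^ (∑ m ∈ H, alpha m F) * (-1) ^ alpha l F) * h6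

variable {k : Type u} [Field k] {n : ℕ}

/-! ### The comparison map in each degree, its homogeneity, naturality and `S`-linearity -/

section

variable (M : ComB (IsSqS (k := k) (n := n)))

/-- The element of degree `B` of `A(M)^j` given by a linear form on the component of
degree `[n] ∖ B` of `M^{-j}`. -/
def cSq (j : ℤ) (B : Finset (Fin n)) {φ : Module.Dual k (M.obj.X (-j)).obj}
    (hφ : φ ∈ (M.obj.X (-j)).obj.dualDeg (ind Bᶜ)) : ((alexObj M).X j).obj := aSq B hφ

variable {M}

lemma cSq_mem {j : ℤ} {B : Finset (Fin n)} {φ : Module.Dual k (M.obj.X (-j)).obj}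
    (hφ : φ ∈ (M.obj.X (-j)).obj.dualDeg (ind Bᶜ)) :
    cSq M j B hφ ∈ ((alexObj M).X j).obj.deg (ind B) := aSq_mem hφ

lemma exists_cSq {j : ℤ} {B : Finset (Fin n)} {m : ((alexObj M).X j).obj}
    (hm : m ∈ ((alexObj M).X j).obj.deg (ind B)) :
    ∃ φ, ∃ hφ : φ ∈ (M.obj.X (-j)).obj.dualDeg (ind Bᶜ), m = cSq M j B hφ := exists_aSq hm

lemma cSq_add {j : ℤ} {B : Finset (Fin n)} {φ ψ : Module.Dual k (M.obj.X (-j)).obj}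
    (hφ : φ ∈ (M.obj.X (-j)).obj.dualDeg (ind Bᶜ)) (hψ : ψ ∈ (M.obj.X (-j)).obj.dualDeg (ind Bᶜ)) :
    cSq M j B (Submodule.add_mem _ hφ hψ) = cSq M j B hφ + cSq M j B hψ := aSq_add hφ hψ

lemma cSq_smul {j : ℤ} {B : Finset (Fin n)} (c : k) {φ : Module.Dual k (M.obj.X (-j)).obj}
    (hφ : φ ∈ (M.obj.X (-j)).obj.dualDeg (ind Bᶜ)) :
    cSq M j B (Submodule.smul_mem _ c hφ) = c • cSq M j B hφ := aSq_smul c hφ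

lemma X_smul_cSq {j : ℤ} {B : Finset (Fin n)} {l : Fin n} (hl : l ∉ B)
    {φ : Module.Dual k (M.obj.X (-j)).obj} (hφ : φ ∈ (M.obj.X (-j)).obj.dualDeg (ind Bᶜ)) :
    (MvPolynomial.X l : S k n) • cSq M j B hφ =
      cSq M j (insert l B) (comp_mulX_mem_dualDeg hl hφ) := X_smul_aSq hl hφ

lemma d_cSq (i j : ℤ) {B : Finset (Fin n)} {φ : Module.Dual k (M.obj.X (-i)).obj}
    (hφ : φ ∈ (M.obj.X (-i)).obj.dualDeg (ind Bᶜ)) :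
    ((alexObj M).d i j).hom.lin (cSq M i B hφ) =
      cSq M j B (comp_mem_dualDeg (M.obj.d (-j) (-i)) hφ) := alex_map_aSq (M.obj.d (-j) (-i)) hφ

lemma cSq_ext {f g : DAmb (alexObj M)} (h : ∀ j B (φ : Module.Dual k (M.obj.X (-j)).obj)
    (hφ : φ ∈ (M.obj.X (-j)).obj.dualDeg (ind Bᶜ)), f j (cSq M j B hφ) = g j (cSq M j B hφ)) :
    f = g :=
  funext fun j => a_lin_ext fun B φ hφ => h j B φ hφ

variable (M) in
/-- The map from the component of degree `-F` of `ℛ(M)` to the component of degree `F` of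
`Hom_S(A(M), ω)`. -/
def thetaFun (F : Finset (Fin n)) (g : RAmb M.obj) : DAmb (alexObj M) :=
  fun j => cap F fun G => sgn k F G • g (-j) (eF k n (G \ F))

lemma thetaFun_apply (F : Finset (Fin n)) (g : RAmb M.obj) (j : ℤ) {B : Finset (Fin n)}
    {φ : Module.Dual k (M.obj.X (-j)).obj} (hφ : φ ∈ (M.obj.X (-j)).obj.dualDeg (ind Bᶜ)) :
    thetaFun M F g j (cSq M j B hφ) = ∑ G, if F ∪ B ⊆ G then
      (sgn k F G * φ (xS k (G \ B) • g (-j) (eF k n (G \ F)))) • Om.mon G (ind B + ind F) else 0 := by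
  refine (cap_apply F _ hφ).trans (Finset.sum_congr rfl fun G _ => ?_)
  split_ifs
  · rw [smul_comm _ (sgn k F G), map_smul, smul_eq_mul]
  · rfl

variable (M) in
/-- The linear map `thetaFun`. -/
def theta (F : Finset (Fin n)) : RAmb M.obj →ₗ[k] DAmb (alexObj M) where
  toFun := thetaFun M F
  map_add' g h := cSq_ext fun j B φ hφ => by
    rw [Pi.add_apply, LinearMap.add_apply, thetaFun_apply, thetaFun_apply, thetaFun_apply,
      ← Finset.sum_add_distrib]
    refine Finset.sum_congr rfl fun G _ => ?_
    split_ifs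
    · rw [Pi.add_apply, CoInd.add_apply, smul_add, map_add, mul_add, add_smul]
    · rw [add_zero]
  map_smul' c g := cSq_ext fun j B φ hφ => by
    rw [RingHom.id_apply, Pi.smul_apply, LinearMap.smul_apply, thetaFun_apply, thetaFun_apply,
      Finset.smul_sum]
    refine Finset.sum_congr rfl fun G _ => ?_
    split_ifs
    · rw [Pi.smul_apply, CoInd.ksmul_apply, smul_comm _ c, map_smul, smul_eq_mul, mul_left_comm,
        mul_smul]
    · rw [smul_zero]

lemma theta_apply (F : Finset (Fin n)) (g : RAmb M.obj) (j : ℤ) {B : Finset (Fin n)}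
    {φ : Module.Dual k (M.obj.X (-j)).obj} (hφ : φ ∈ (M.obj.X (-j)).obj.dualDeg (ind Bᶜ)) :
    theta M F g j (cSq M j B hφ) = ∑ G, if F ∪ B ⊆ G then
      (sgn k F G * φ (xS k (G \ B) • g (-j) (eF k n (G \ F)))) • Om.mon G (ind B + ind F) else 0 :=
  thetaFun_apply F g j hφ

/-- This is the degree of `g(e_{G∖F})` for `g` of degree `-F`; it is the degree `Gᶜ` of `M` that is
dual to the degree `G` of `A(M)`. -/
lemma neg_ind_sdiff {F G : Finset (Fin n)} (h : F ⊆ G) : -ind (G \ F) + 1 + -ind F = ind Gᶜ := by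
  ext l
  have := @h l
  by_cases h1 : l ∈ F <;> by_cases h2 : l ∈ G <;> simp_all [ind]

lemma tot_ind_compl (G : Finset (Fin n)) : tot (ind Gᶜ) = n - G.card := by
  have h1 : tot (ind Gᶜ) = (Gᶜ.card : ℤ) := by
    simp only [tot, ind, Finset.sum_boole, Finset.filter_univ_mem]
  have := Finset.card_add_card_compl G
  rw [Fintype.card_fin] at this
  omega

/-- Maps to `ω` are homogeneous if they are on the squarefree components. -/
lemma mem_homPiece {K : Com (IsSqS (k := k) (n := n))} {t : ℤ} {a : Fin n → ℤ} {f : DAmb K}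
    (h : ∀ j B, ∀ m ∈ (K.X j).obj.deg (ind B), f j m ∈ Om.piece k (t + j) (a + ind B)) :
    f ∈ homPiece K t a := by
  intro j b m hm
  by_cases hb : 0 ≤ b
  · obtain ⟨d, -, e, u, hu, rfl⟩ := (K.X j).property.exists_monomial hb hm
    rw [map_smul]
    have := smul_mem_of_X (Om.piece k (t + j)) (Om.piece_X (t + j)) _ _ _ _
      (monomial_mem_grS d 1) (h j _ u hu)
    rwa [add_comm (toZ d), add_assoc, e] at this
  · rw [(K.X j).property.nonneg b hb, Submodule.mem_bot] at hm
    rw [hm, map_zero]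
    exact Submodule.zero_mem _

/-- The cohomological degrees match: `g_{-j}(e_{G∖F})` can be nonzero only if `-j + (n - |G|) = i +
n`, that is `|G| = -(i + j)`, which is the condition for the summand of `G` to occur in `ω^{i+j}`.
-/
lemma theta_mem {i : ℤ} {F : Finset (Fin n)} {g : RAmb M.obj}
    (hg : g ∈ rPiece M.obj (i + n) (-ind F)) : theta M F g ∈ homPiece (alexObj M) i (ind F) := by
  refine mem_homPiece fun j B m hm => ?_
  obtain ⟨φ, hφ, rfl⟩ := exists_cSq hm
  rw [theta_apply, add_comm (ind F)]
  refine Submodule.sum_mem _ fun G _ => ?_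
  split_ifs with hG
  · have hF : F ⊆ G := (Finset.subset_union_left).trans hG
    by_cases hc : (G.card : ℤ) = -(i + j)
    · refine Submodule.smul_mem _ _ (Om.mon_mem hc fun l hl => ?_)
      have h1 : l ∉ F := fun h => hl (hF h)
      have h2 : l ∉ B := fun h => hl (hG (Finset.mem_union_right _ h))
      simp [ind, h1, h2]
    · have h1 := (mem_rPiece.mp hg (-j) (G \ F)).2
      rw [neg_ind_sdiff hF, tot_ind_compl] at h1
      rw [h1 (by omega), smul_zero, map_zero, mul_zero, zero_smul]
      exact Submodule.zero_mem _
  · exact Submodule.zero_mem _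

lemma theta_naturality {M N : ComB (IsSqS (k := k) (n := n))} (f : M ⟶ N) (F : Finset (Fin n))
    (g : RAmb M.obj) :
    theta N F (rMap f.hom g) = dMap ((alexCom k n).map f.op).hom (theta M F g) := by
  refine cSq_ext fun j B φ hφ => ?_
  have h : dMap ((alexCom k n).map f.op).hom (theta M F g) j (cSq N j B hφ) =
    theta M F g j (cSq M j B (comp_mem_dualDeg (f.hom.f (-j)) hφ)) :=
    congrArg (theta M F g j) (alex_map_aSq (f.hom.f (-j)) hφ)
  refine Eq.trans ?_ h.symm
  rw [theta_apply, theta_apply]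
  refine Finset.sum_congr rfl fun G _ => ?_
  rw [rMap_apply, LinearMap.comp_apply, LinearMap.restrictScalars_apply,
    map_smul (f.hom.f (-j)).hom.lin]

/-- The summands with `l ∈ G` agree because `(e_l g)(e_{G∖(F∪l)})` is a sign times `g(e_{G∖F})`, and
that sign is the one in `sgn_insert_left`. For `l ∉ G` the summand is missing on the left and killed
by `x_l` on the right. -/
lemma theta_X {F : Finset (Fin n)} {l : Fin n} (hl : l ∉ F) (g : RAmb M.obj) :
    theta M (insert l F) ((-1 : ℤ) ^ alpha l F • (e k n l • g)) =
      (MvPolynomial.X l : S k n) • theta M F g := by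
  refine cSq_ext fun j B φ hφ => ?_
  rw [Pi.smul_apply, LinearMap.smul_apply, theta_apply, theta_apply, Finset.smul_sum]
  refine Finset.sum_congr rfl fun G _ => ?_
  have h3 : insert l F ∪ B ⊆ G ↔ l ∈ G ∧ F ∪ B ⊆ G := by
    rw [Finset.insert_union, Finset.insert_subset_iff]
  by_cases h4 : F ∪ B ⊆ G
  · rw [if_pos h4, Om.X_smul, map_smul (Om.op l)]
    by_cases h5 : l ∈ G
    · rw [if_pos (h3.mpr ⟨h5, h4⟩), Om.op_pos (Or.inl h5), ind_insert hl, ← add_assoc]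
      congr 1
      have h6 : G \ F = insert l (G \ insert l F) := by
        ext m
        by_cases h : m = l <;> simp_all
      -- The action of `E` on `Hom_k(E, M)` multiplies the argument from the right, so `e_l` has to
      -- be moved to the front before it is sorted in.
      have h7 : eF k n (G \ insert l F) * e k n l =
          ((-1 : k) ^ (G \ insert l F).card * (-1) ^ alpha l (G \ insert l F)) •
            eF k n (G \ F) := by
        rw [eF_mul_e, e_mul_eF _ _ (by simp), smul_smul, h6]
      have h8 : ((-1 : ℤ) ^ alpha l F • (e k n l • g)) (-j) (eF k n (G \ insert l F)) =
          ((-1 : k) ^ alpha l F * ((-1) ^ (G \ insert l F).card *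
            (-1) ^ alpha l (G \ insert l F))) • g (-j) (eF k n (G \ F)) := by
        have : ((-1 : ℤ) ^ alpha l F • (e k n l • g)) (-j) (eF k n (G \ insert l F)) =
            ((-1 : k) ^ alpha l F) • g (-j) (eF k n (G \ insert l F) * e k n l) := by
          rcases neg_one_pow_eq_or ℤ (alpha l F) with h | h
          · have h' : (-1 : k) ^ alpha l F = 1 := by exact_mod_cast congrArg (Int.cast : ℤ → k) h
            rw [h, h', one_smul, one_smul]; rfl
          · have h' : (-1 : k) ^ alpha l F = -1 := by exact_mod_cast congrArg (Int.cast : ℤ → k) h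
            rw [h, h', neg_smul, one_smul, neg_smul, one_smul]; rfl
        rw [this, h7, map_smul, smul_smul]
      rw [h8, smul_comm _ (_ * _ : k), map_smul, smul_eq_mul, ← sgn_insert_left hl h5]
      ring
    · rw [if_neg (fun h => h5 (h3.mp h).1), Om.op_neg, smul_zero]
      rintro (h | h)
      · exact h5 h
      · have h6 := ind_nonneg B l
        have h7 := ind_nonneg F l
        simp only [Pi.add_apply, Pi.zero_apply] at h h6 h7
        omega
  · rw [if_neg h4, if_neg (fun h => h4 (h3.mp h).2), smul_zero]

end

/-! ### Compatibility of the comparison map with the differentials -/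

variable {k : Type u} [Field k] {n : ℕ}

/-- Pairs `(G, l)` with `l ∈ G` are reindexed by `(G ∖ {l}, l)`. The differential of `ω` removes
elements from `G`, whereas that of `ℛ` adds them, and this matches the two sums. -/
lemma sum_mem_eq_sum_notMem {V : Type*} [AddCommMonoid V] (h : Finset (Fin n) → Fin n → V) :
    ∑ G, ∑ l ∈ G, h G l = ∑ G : Finset (Fin n), ∑ l, if l ∈ G then 0 else h (insert l G) l := by
  have h1 : ∀ G : Finset (Fin n), ∑ l ∈ G, h G l = ∑ l, if l ∈ G then h G l else 0 := fun G => by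
    rw [← Finset.sum_filter, Finset.filter_univ_mem]
  rw [Finset.sum_congr rfl fun G _ => h1 G]
  refine Finset.sum_comm.trans (Eq.trans ?_ Finset.sum_comm)
  refine Finset.sum_congr rfl fun l _ => ?_
  have h2 : ∀ G : Finset (Fin n), (if l ∈ G then 0 else h (insert l G) l) =
    if l ∉ G then h (insert l G) l else 0 := fun G => by
    by_cases h : l ∈ G <;> simp [h]
  rw [Finset.sum_congr rfl fun G _ => h2 G, ← Finset.sum_filter, ← Finset.sum_filter]
  refine Finset.sum_nbij' (fun G => G.erase l) (fun G => insert l G) ?_ ?_ ?_ ?_ ?_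
  · intro G _; simp
  · intro G _; simp
  · intro G hG; exact Finset.insert_erase (Finset.mem_filter.mp hG).2
  · intro G hG; exact Finset.erase_insert (Finset.mem_filter.mp hG).2
  · intro G hG
    rw [Finset.insert_erase (Finset.mem_filter.mp hG).2]

lemma alpha_sdiff {F G : Finset (Fin n)} (h : F ⊆ G) (l : Fin n) :
    alpha l G = alpha l F + alpha l (G \ F) := by
  rw [alpha, alpha, alpha, ← Finset.card_union_of_disjoint, ← Finset.filter_union,
    Finset.union_sdiff_of_subset h]
  exact Finset.disjoint_filter_filter Finset.disjoint_sdiff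

lemma alpha_insert_self (l : Fin n) (G : Finset (Fin n)) : alpha l (insert l G) = alpha l G := by
  rw [alpha, alpha, Finset.filter_insert, if_neg (lt_irrefl l)]

lemma negOnePow_cast (m : ℕ) : (((m : ℤ).negOnePow : ℤ) : k) = (-1) ^ m := by
  induction m with
  | zero => simp
  | succ m ih => rw [Nat.cast_succ, Int.negOnePow_succ, Units.val_neg, Int.cast_neg, ih]; ring

section

variable {M : ComB (IsSqS (k := k) (n := n))}

lemma rDiff_apply_neg (i : ℤ) (f : RAmb M.obj) (j : ℤ) (s : E k n) :
    rDiff M.obj i f (-j) s = ∑ l, (MvPolynomial.X l : S k n) • f (-j) (e k n l * s) +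
      (i.negOnePow : ℤ) • (M.obj.d (-(j + 1)) (-j)).hom.lin (f (-(j + 1)) s) := by
  rw [rDiff_apply]
  have : ∀ j', j' = -(j + 1) → (M.obj.d j' (-j)).hom.lin (f j' s) =
      (M.obj.d (-(j + 1)) (-j)).hom.lin (f (-(j + 1)) s) := by
    rintro _ rfl; rfl
  rw [this _ (by ring)]

/-- At an index `l ∈ T ∩ F` the degree `-T + 𝟏 - F` has the entry `-1`, and `M` is zero there. -/
lemma rPiece_eq_zero {i : ℤ} {F T : Finset (Fin n)} {g : RAmb M.obj}
    (hg : g ∈ rPiece M.obj i (-ind F)) (h : ¬ Disjoint T F) (j : ℤ) : g j (eF k n T) = 0 := by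
  obtain ⟨l, h1, h2⟩ := Finset.not_disjoint_iff.mp h
  have h3 := (mem_rPiece.mp hg j T).1
  rw [(M.obj.X j).property.nonneg, Submodule.mem_bot] at h3
  · exact h3
  · intro h4
    have := h4 l
    simp [ind, h1, h2] at this

lemma sum_X_smul {i : ℤ} {F G : Finset (Fin n)} {g : RAmb M.obj}
    (hg : g ∈ rPiece M.obj i (-ind F)) (hF : F ⊆ G) (j : ℤ) :
    ∑ l, (MvPolynomial.X l : S k n) • g j (e k n l * eF k n (G \ F)) =
      ∑ l, if l ∈ G then 0 else (-1 : k) ^ alpha l (G \ F) •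
        (MvPolynomial.X l : S k n) • g j (eF k n (insert l G \ F)) := by
  refine Finset.sum_congr rfl fun l _ => ?_
  by_cases h1 : l ∈ F
  · rw [if_pos (hF h1), e_mul_eF _ _ (by simp [h1]), map_smul, rPiece_eq_zero hg, smul_zero,
      smul_zero]
    exact Finset.not_disjoint_iff.mpr ⟨l, Finset.mem_insert_self _ _, h1⟩
  · by_cases h2 : l ∈ G
    · rw [if_pos h2, e_mul_eF_of_mem _ _ (Finset.mem_sdiff.mpr ⟨h2, h1⟩), map_zero, smul_zero]
    · rw [if_neg h2, e_mul_eF _ _ (by simp [h2]), map_smul, smul_comm,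
        Finset.insert_sdiff_of_notMem _ h1]

lemma d_theta (F : Finset (Fin n)) (g : RAmb M.obj) (j : ℤ) {B : Finset (Fin n)}
    {φ : Module.Dual k (M.obj.X (-j)).obj} (hφ : φ ∈ (M.obj.X (-j)).obj.dualDeg (ind Bᶜ)) :
    Om.d k n (theta M F g j (cSq M j B hφ)) = ∑ G, if F ∪ B ⊆ G then
      ((-1) ^ n * (sgn k F G * φ (xS k (G \ B) • ∑ l, if l ∈ G then 0 else
        (-1 : k) ^ alpha l (G \ F) • (MvPolynomial.X l : S k n) •
          g (-j) (eF k n (insert l G \ F))))) • Om.mon G (ind B + ind F) else 0 := by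
  rw [theta_apply, Om.d_apply, map_sum]
  have h1 : ∀ G : Finset (Fin n), Om.dk (if F ∪ B ⊆ G then
      (sgn k F G * φ (xS k (G \ B) • g (-j) (eF k n (G \ F)))) • Om.mon G (ind B + ind F) else 0 : Om k n) =
      ∑ l ∈ G, if F ∪ B ⊆ G.erase l then
        (sgn k F G * φ (xS k (G \ B) • g (-j) (eF k n (G \ F))) * (-1 : k) ^ alpha l G) •
          Om.mon (G.erase l) (ind B + ind F) else 0 := by
    intro G
    -- The map `nat` that drops `l` is nonzero on `x^{B+F}` exactly when `l` lies in neither `F` nor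
    -- `B`, and this is also the condition for `G ∖ {l}` to occur in the sum.
    have h2 : ∀ l, F ∪ B ⊆ G.erase l ↔ F ∪ B ⊆ G ∧ (ind B + ind F) l ≤ 0 := by
      intro l
      rw [Finset.subset_erase]
      refine and_congr_right fun _ => ?_
      by_cases h3 : l ∈ F <;> by_cases h4 : l ∈ B <;> simp [ind, h3, h4]
    split_ifs with h
    · rw [map_smul, Om.dk_mon, Finset.smul_sum]
      refine Finset.sum_congr rfl fun l _ => ?_
      by_cases h3 : (ind B + ind F) l ≤ 0
      · rw [if_pos h3, if_pos ((h2 l).mpr ⟨h, h3⟩), smul_smul]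
      · rw [if_neg h3, if_neg (fun h4 => h3 ((h2 l).mp h4).2), smul_zero]
    · rw [map_zero, Finset.sum_eq_zero]
      intro l _
      rw [if_neg (fun h4 => h ((h2 l).mp h4).1)]
  rw [Finset.sum_congr rfl fun G _ => h1 G, sum_mem_eq_sum_notMem]
  refine Finset.sum_congr rfl fun G _ => ?_
  split_ifs with h
  · have hF : F ⊆ G := Finset.subset_union_left.trans h
    have hB : B ⊆ G := Finset.subset_union_right.trans h
    rw [Finset.smul_sum, map_sum, Finset.mul_sum, Finset.mul_sum, Finset.sum_smul]
    refine Finset.sum_congr rfl fun l _ => ?_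
    by_cases hl : l ∈ G
    · rw [if_pos hl, if_pos hl, smul_zero, map_zero, mul_zero, mul_zero, zero_smul]
    · rw [if_neg hl, if_neg hl, Finset.erase_insert hl, if_pos h, alpha_insert_self,
        sgn_insert_right hF hl, alpha_sdiff hF, smul_comm _ ((-1 : k) ^ _), map_smul φ ((-1 : k) ^ _),
        smul_eq_mul, Finset.insert_sdiff_of_notMem _ (fun h' => hl (hB h')), xS_insert (by simp [hl]),
        mul_comm (MvPolynomial.X l), mul_smul (xS k _)]
      congr 1
      have : ((-1 : k) ^ alpha l F) * (-1) ^ alpha l F = 1 := by rw [← mul_pow]; simp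
      rw [pow_add]
      linear_combination ((-1) ^ n * sgn k F G * φ (xS k (G \ B) • (MvPolynomial.X l : S k n) •
        g (-j) (eF k n (insert l G \ F))) * (-1) ^ alpha l (G \ F)) * this
  · rw [Finset.sum_eq_zero]
    intro l _
    by_cases hl : l ∈ G
    · rw [if_pos hl]
    · rw [if_neg hl, Finset.erase_insert hl, if_neg h]

/-- By `d_theta`, the differential of `ω` corresponds, up to `(-1)^n`, to the part of the
differential of `ℛ` with the variables. The part with the differential of `M` carries `(-1)^{i+n}`
in `ℛ` and `(-1)^i` in `Hom`. Both discrepancies are the sign `(-1)^n` in the differential of the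
`n`-fold translation. -/
lemma theta_d {i : ℤ} {F : Finset (Fin n)} {g : RAmb M.obj}
    (hg : g ∈ rPiece M.obj (i + n) (-ind F)) :
    ((n : ℤ).negOnePow : ℤ) • theta M F (rDiff M.obj (i + n) g) =
      dDiff (alexObj M) i (theta M F g) := by
  refine cSq_ext fun j B φ hφ => ?_
  rw [dDiff_apply, d_cSq, d_theta, ← map_zsmul, theta_apply, theta_apply, Finset.smul_sum,
    ← Finset.sum_add_distrib]
  refine Finset.sum_congr rfl fun G _ => ?_
  split_ifs with h
  · have hF : F ⊆ G := Finset.subset_union_left.trans h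
    rw [← Int.cast_smul_eq_zsmul k (i.negOnePow : ℤ), smul_smul, ← add_smul]
    congr 1
    have h1 : (((n : ℤ).negOnePow : ℤ) • rDiff M.obj (i + n) g) (-j) (eF k n (G \ F)) =
      ((-1 : k) ^ n) • rDiff M.obj (i + n) g (-j) (eF k n (G \ F)) := by
      rw [← negOnePow_cast, Int.cast_smul_eq_zsmul]; rfl
    rw [h1, rDiff_apply_neg, sum_X_smul hg hF, smul_comm _ ((-1 : k) ^ n), map_smul, smul_add,
      map_add, ← Int.cast_smul_eq_zsmul k ((i + n).negOnePow : ℤ), smul_comm _ (Int.cast _ : k),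
      map_smul φ, Int.negOnePow_add, Units.val_mul, Int.cast_mul, negOnePow_cast,
      LinearMap.comp_apply, LinearMap.restrictScalars_apply, map_smul (M.obj.d _ _).hom.lin]
    have h2 : ((-1 : k) ^ n) * (-1) ^ n = 1 := by rw [← mul_pow]; simp
    simp only [smul_eq_mul]
    linear_combination (sgn k F G * (i.negOnePow : ℤ) *
      φ (xS k (G \ B) • (M.obj.d (-(j + 1)) (-j)).hom.lin (g (-(j + 1)) (eF k n (G \ F))))) * h2
  · rw [smul_zero, add_zero]

end

/-! ### Bijectivity of the comparison map -/

variable {k : Type u} [Field k] {n : ℕ} {M : ComB (IsSqS (k := k) (n := n))}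

lemma coef_theta (F : Finset (Fin n)) (g : RAmb M.obj) (j : ℤ) {B : Finset (Fin n)}
    {φ : Module.Dual k (M.obj.X (-j)).obj} (hφ : φ ∈ (M.obj.X (-j)).obj.dualDeg (ind Bᶜ))
    {G : Finset (Fin n)} (hG : F ∪ B ⊆ G) :
    Om.coef G (ind B + ind F) (theta M F g j (cSq M j B hφ)) =
      sgn k F G * φ (xS k (G \ B) • g (-j) (eF k n (G \ F))) := by
  rw [theta_apply, map_sum, Finset.sum_eq_single G]
  · rw [if_pos hG, map_smul, Om.coef_mon_same, smul_eq_mul, mul_one]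
  · intro G' _ h
    split_ifs
    · rw [map_smul, Om.coef_mon_ne (fun h' => h (Prod.mk.inj h').1), smul_zero]
    · rw [map_zero]
  · simp

lemma xS_empty : xS k (∅ : Finset (Fin n)) = 1 := Finset.prod_empty

/-- For `T` disjoint from `F` take `B = G = T ∪ F`: the coefficient at `G` of the image of `φ` is `±
φ(g(e_T))`, and linear forms separate points. If `T` meets `F`, then `g(e_T)` is zero anyway. -/
lemma theta_injective {i : ℤ} {F : Finset (Fin n)} {g : RAmb M.obj}
    (hg : g ∈ rPiece M.obj i (-ind F)) (h : theta M F g = 0) : g = 0 := by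
  refine rAmb_ext fun j T => ?_
  obtain ⟨j, rfl⟩ : ∃ j', j = -j' := ⟨-j, by simp⟩
  by_cases hT : Disjoint T F
  · have hF : F ⊆ T ∪ F := Finset.subset_union_right
    have h1 : (T ∪ F) \ F = T := Finset.union_sdiff_cancel_right hT
    have h2 := (mem_rPiece.mp hg (-j) T).1
    rw [← h1, neg_ind_sdiff hF, h1] at h2
    refine GrMod.eq_zero_of_dualDeg h2 fun φ hφ => ?_
    have h3 := coef_theta F g j hφ (G := T ∪ F)
      (Finset.union_subset hF subset_rfl)
    rw [h, Finset.sdiff_self, xS_empty, one_smul, h1] at h3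
    have h4 := congrArg (sgn k F (T ∪ F) * ·) h3
    simp only [← mul_assoc, sgn_mul_self, one_mul] at h4
    rw [← h4]
    exact (congrArg _ (map_zero (Om.coef _ _))).trans (mul_zero _)
  · exact rPiece_eq_zero hg hT _

/-- On the summand of `G`, a map to `ω` is determined by its values in degree `G`: for `l ∈ G ∖ B`,
multiplying by `x_l` preserves the coefficient and replaces `B` by `B ∪ {l}`, so induction on `G ∖
B` reaches `B = G`. -/
lemma coef_hom {F G : Finset (Fin n)} (f : DAmb (alexObj M)) (j : ℤ) {v : (M.obj.X (-j)).obj}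
    (hv : ∀ φ (hφ : φ ∈ (M.obj.X (-j)).obj.dualDeg (ind Gᶜ)),
      Om.coef G (ind G + ind F) (f j (cSq M j G hφ)) = φ v) (H : Finset (Fin n)) :
    ∀ B, B ⊆ G → G \ B = H → ∀ φ (hφ : φ ∈ (M.obj.X (-j)).obj.dualDeg (ind Bᶜ)),
      Om.coef G (ind B + ind F) (f j (cSq M j B hφ)) = φ (xS k H • v) := by
  induction H using Finset.induction_on with
  | empty =>
    intro B h1 h2 φ hφ
    obtain rfl : B = G := h1.antisymm (Finset.sdiff_eq_empty_iff_subset.mp h2)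
    rw [xS_empty, one_smul, hv]
  | insert l H hl ih =>
    intro B h1 h2 φ hφ
    have h3 : l ∈ G \ B := h2 ▸ Finset.mem_insert_self _ _
    obtain ⟨h4, h5⟩ := Finset.mem_sdiff.mp h3
    have h6 := ih (insert l B) (Finset.insert_subset h4 h1)
      (by rw [← Finset.erase_insert hl, ← h2, Finset.sdiff_insert]) _ (comp_mulX_mem_dualDeg h5 hφ)
    rw [← X_smul_cSq h5 hφ, map_smul, ind_insert h5, add_right_comm, Om.coef_X h4] at h6
    rw [h6, xS_insert hl, mul_smul]
    rfl

/-- The coefficient of `f` at `G` in degree `G` is a linear form on the dual of the component of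
degree `Gᶜ` of `M^{-j}`, hence evaluation at an element `v`, as that component is finite
dimensional. These elements, with signs, are the values of `g`. -/
lemma theta_surjective {i : ℤ} {F : Finset (Fin n)} {f : DAmb (alexObj M)}
    (hf : f ∈ homPiece (alexObj M) i (ind F)) :
    ∃ g ∈ rPiece M.obj (i + n) (-ind F), theta M F g = f := by
  have hf' : ∀ j B φ (hφ : φ ∈ (M.obj.X (-j)).obj.dualDeg (ind Bᶜ)),
      f j (cSq M j B hφ) ∈ Om.piece k (i + j) (ind B + ind F) := fun j B φ hφ => by
    rw [add_comm (ind B)]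
    exact hf j _ _ (cSq_mem hφ)
  -- The family `g` is indexed by the degree `j'` of `M`, while `f` is indexed by the degree `j =
  -- -j'` of `A(M)`; `v` is therefore chosen for each `j'` and transported.
  have h1 : ∀ j' G, ∃ v : (M.obj.X j').obj, v ∈ (M.obj.X j').obj.deg (ind Gᶜ) ∧
      ∀ j (h : j' = -j) φ (hφ : φ ∈ (M.obj.X (-j)).obj.dualDeg (ind Gᶜ)),
        Om.coef G (ind G + ind F) (f j (cSq M j G hφ)) = φ (h ▸ v) := by
    intro j' G
    obtain ⟨j, rfl⟩ : ∃ j, j' = -j := ⟨-j', by simp⟩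
    obtain ⟨v, hv, h⟩ := GrMod.exists_eval ((M.obj.X (-j)).property.finite (ind Gᶜ))
      { toFun := fun φ => Om.coef G (ind G + ind F) (f j (cSq M j G φ.2))
        map_add' := fun φ ψ => (congrArg (fun y => Om.coef G (ind G + ind F) (f j y))
          (cSq_add φ.2 ψ.2)).trans (by rw [map_add, map_add])
        map_smul' := fun c φ => (congrArg (fun y => Om.coef G (ind G + ind F) (f j y))
          (cSq_smul c φ.2)).trans (by
            rw [LinearMap.map_smul_of_tower, map_smul]; rfl) }
    refine ⟨v, hv, fun j₂ h₂ φ hφ => ?_⟩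
    obtain rfl : j = j₂ := neg_injective h₂
    exact h φ hφ
  choose v hv h2 using h1
  have h3 : ∀ j G φ (hφ : φ ∈ (M.obj.X (-j)).obj.dualDeg (ind Gᶜ)),
      Om.coef G (ind G + ind F) (f j (cSq M j G hφ)) = φ (v (-j) G) := fun j G => h2 _ G j rfl
  -- The values are forced by `coef_theta` with `B = G = T ∪ F`, the sign being its own inverse.
  let g : RAmb M.obj := rOf fun j T =>
    if Disjoint T F then sgn k F (T ∪ F) • v j (T ∪ F) else 0
  refine ⟨g, mem_rPiece.mpr fun j T => ?_, cSq_ext fun j B φ hφ => ?_⟩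
  · obtain ⟨j, rfl⟩ : ∃ j', j = -j' := ⟨-j, by simp⟩
    rw [rOf_apply]
    split_ifs with hT
    · have hF : F ⊆ T ∪ F := Finset.subset_union_right
      have h1 : (T ∪ F) \ F = T := Finset.union_sdiff_cancel_right hT
      have h4 := neg_ind_sdiff hF
      rw [h1] at h4
      rw [h4, tot_ind_compl]
      refine ⟨Submodule.smul_mem _ _ (hv _ _), fun h5 => ?_⟩
      rw [GrMod.eq_zero_of_dualDeg (hv (-j) (T ∪ F)), smul_zero]
      intro φ hφ
      rw [← h3 j _ φ hφ]
      exact Om.coef_eq_zero (hf' j _ φ hφ) fun h6 => h5 (by have := h6.1; omega)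
    · exact ⟨Submodule.zero_mem _, fun _ => rfl⟩
  · rw [theta_apply, Om.eq_sum (hf' j B φ hφ)]
    refine Finset.sum_congr rfl fun G _ => ?_
    split_ifs with h
    · have hF : F ⊆ G := Finset.subset_union_left.trans h
      congr 1
      rw [rOf_apply, if_pos Finset.sdiff_disjoint, Finset.sdiff_union_of_subset hF,
        smul_comm _ (sgn k F G), map_smul φ, smul_eq_mul, ← mul_assoc, sgn_mul_self, one_mul,
        coef_hom f j (h3 j G) _ B (Finset.subset_union_right.trans h) rfl]
    -- If `F ∪ B` is not contained in `G`, then `x^{B+F}` has a positive exponent outside `G` and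
    -- does not occur in `*E(S/P_G)`.
    · obtain ⟨l, h4, h5⟩ := Finset.not_subset.mp h
      rw [Om.coef_eq_zero (hf' j B φ hφ), zero_smul]
      rintro ⟨-, h6⟩
      have h7 := h6 l h5
      by_cases h8 : l ∈ F <;> by_cases h9 : l ∈ B <;> simp_all [ind]

/-! ### The comparison as a natural isomorphism of complexes -/

variable {k : Type u} [Field k] {n : ℕ}

section

variable {N N' : SqE k n} {F : Finset (Fin n)}

/-- The element of degree `F` of `𝒮(N)` given by `z ∈ N_{-F}`. -/
def sSq (F : Finset (Fin n)) {z : N.obj} (hz : z ∈ N.obj.deg (-ind F)) : ((fS k n).obj N).obj :=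
  (extRep N).sq F hz

lemma sSq_mem {z : N.obj} (hz : z ∈ N.obj.deg (-ind F)) :
    sSq F hz ∈ ((fS k n).obj N).obj.deg (ind F) := BoolRep.sq_mem (ρ := extRep N) hz

lemma exists_sSq {x : ((fS k n).obj N).obj} (hx : x ∈ ((fS k n).obj N).obj.deg (ind F)) :
    ∃ z, ∃ hz : z ∈ N.obj.deg (-ind F), x = sSq F hz := BoolRep.exists_sq (ρ := extRep N) hx

lemma sSq_zero : sSq F (N.obj.deg (-ind F)).zero_mem = 0 :=
  Subtype.ext (((extRep N).inc (ind F)).map_zero)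

lemma fS_map_sSq (f : N ⟶ N') {z : N.obj} (hz : z ∈ N.obj.deg (-ind F)) :
    ((fS k n).map f).hom.lin (sSq F hz) = sSq F (f.hom.map_deg _ _ hz) :=
  Subtype.ext (BoolRep.mapAmb_inc (ρ := extRep N) (σ := extRep N') _ _ z)

variable (N) in
/-- The element of `N_{-F}` given by the component of degree `F` of an element of `𝒮(N)`. -/
def sCoef (F : Finset (Fin n)) : ((fS k n).obj N).obj →ₗ[k] N.obj := (extRep N).coef (ind F)

lemma sCoef_sSq {z : N.obj} (hz : z ∈ N.obj.deg (-ind F)) : sCoef N F (sSq F hz) = z :=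
  BoolRep.coef_sq (ρ := extRep N) hz

lemma sCoef_X {l : Fin n} (hl : l ∉ F) {z : N.obj} (hz : z ∈ N.obj.deg (-ind F)) :
    sCoef N (insert l F) ((MvPolynomial.X l : S k n) • sSq F hz) =
      (-1 : ℤ) ^ alpha l F • (e k n l • z) :=
  (congrArg (sCoef N (insert l F)) (BoolRep.X_smul_sq (ρ := extRep N) hl hz)).trans
    (BoolRep.coef_sq (ρ := extRep N) _)

lemma sCoef_mem {x : ((fS k n).obj N).obj} (hx : x ∈ ((fS k n).obj N).obj.deg (ind F)) :
    sCoef N F x ∈ N.obj.deg (-ind F) := by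
  obtain ⟨z, hz, rfl⟩ := exists_sSq hx
  rw [sCoef_sSq]
  exact hz

end

section

variable (M : ComB (IsSqS (k := k) (n := n)))

/-- The terms of the squarefree part of `ℛ(M)`. -/
abbrev rSqX (i : ℤ) : SqE k n := ((rSq k n).obj M).obj.X i

/-- The element of the ambient module given by an element of the squarefree part of `ℛ(M)`. -/
def rVal (i : ℤ) : (rSqX M i).obj →ₗ[k] RAmb M.obj where
  toFun x := x.1.1
  map_add' _ _ := rfl
  map_smul' _ _ := rfl

variable {M}

lemma rVal_mem {i : ℤ} {a : Fin n → ℤ} {x : (rSqX M i).obj} (hx : x ∈ (rSqX M i).obj.deg a) :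
    rVal M i x ∈ rPiece M.obj i a := hx.1

lemma rVal_injective {i : ℤ} {x : (rSqX M i).obj} (h : rVal M i x = 0) : x = 0 :=
  Subtype.ext (Subtype.ext h)

lemma exists_rVal {i : ℤ} {F : Finset (Fin n)} {g : RAmb M.obj}
    (hg : g ∈ rPiece M.obj i (-ind F)) :
    ∃ x ∈ (rSqX M i).obj.deg (-ind F), rVal M i x = g := by
  have h : (⟨g, GrMod.mem_pieces hg⟩ : rMod M.obj i) ∈ (rNonpos k n).U M i (-ind F) :=
    ⟨hg, fun h => absurd (neg_ind_nonpos F) h⟩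
  exact ⟨(rNonpos k n).elt iSup_grE h, h, rfl⟩

lemma rVal_d {i j : ℤ} (h : i + 1 = j) (x : (rSqX M i).obj) :
    rVal M j ((((rSq k n).obj M).obj.d i j).hom.lin x) = rDiff M.obj i (rVal M i x) := by
  subst h
  exact congrArg (fun f => (f.hom.lin x.1).1) (rCom_d M i)

lemma rVal_map {M N : ComB (IsSqS (k := k) (n := n))} (f : M ⟶ N) (i : ℤ) (x : (rSqX M i).obj) :
    rVal N i ((((rSq k n).map f).hom.f i).hom.lin x) = rMap f.hom (rVal M i x) := rfl

variable (M) in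
/-- The component of degree `F` of the morphism `𝒮(ℛ(M))[n] → D(A(M))`. -/
def thetaLin (i : ℤ) (F : Finset (Fin n)) :
    ((fS k n).obj (rSqX M (i + n))).obj.deg (ind F) →ₗ[k]
      (dObj ((alexCom k n).obj (Opposite.op M)) i).obj where
  toFun x := ⟨theta M F (rVal M (i + n) (sCoef (rSqX M (i + n)) F x.1)),
    GrMod.mem_pieces (a := ind F) (by
      rw [dPiece_pos (ind_nonneg F)]
      exact theta_mem (rVal_mem (sCoef_mem x.2)))⟩
  map_add' x y := Subtype.ext ((theta M F ∘ₗ rVal M (i + n) ∘ₗ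
    sCoef (rSqX M (i + n)) F).map_add x.1 y.1)
  map_smul' c x := Subtype.ext ((theta M F ∘ₗ rVal M (i + n) ∘ₗ
    sCoef (rSqX M (i + n)) F).map_smul c x.1)

lemma thetaLin_X (i : ℤ) {F : Finset (Fin n)} {l : Fin n} (hl : l ∉ F)
    (m : ((fS k n).obj (rSqX M (i + n))).obj.deg (ind F)) :
    thetaLin M i (insert l F)
      ⟨(MvPolynomial.X l : S k n) • m.1, ind_insert hl ▸ X_smul_mem _ l m.2⟩ =
        (MvPolynomial.X l : S k n) • thetaLin M i F m := by
  obtain ⟨m, hm⟩ := m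
  obtain ⟨z, hz, rfl⟩ := exists_sSq hm
  refine Subtype.ext ?_
  refine (congrArg (fun y => theta M (insert l F) (rVal M (i + n) y)) (sCoef_X hl hz)).trans
    (Eq.trans ?_ (congrArg (fun y => (MvPolynomial.X l : S k n) •
      theta M F (rVal M (i + n) y)) (sCoef_sSq hz).symm))
  refine Eq.trans ?_ (theta_X hl (rVal M (i + n) z))
  rw [map_zsmul]
  rfl

variable (M) in
/-- The terms of the morphism `𝒮(ℛ(M))[n] → D(A(M))`. -/
def thetaX (i : ℤ) : (fS k n).obj (rSqX M (i + n)) ⟶ dObj ((alexCom k n).obj (Opposite.op M)) i :=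
  sqHom (thetaLin M i) (fun F m => by
    change theta M F _ ∈ dPiece _ _ _
    rw [dPiece_pos (ind_nonneg F)]
    exact theta_mem (rVal_mem (sCoef_mem m.2))) fun _ _ => thetaLin_X i

lemma thetaX_sq {i : ℤ} {F : Finset (Fin n)} {z : (rSqX M (i + n)).obj}
    (hz : z ∈ (rSqX M (i + n)).obj.deg (-ind F)) :
    ((thetaX M i).hom.lin (sSq F hz)).1 =
      theta M F (rVal M (i + n) z) := by
  refine (congrArg Subtype.val (sqHom_apply (thetaLin M i) _ _
    (sSq_mem hz))).trans ?_
  exact congrArg (fun y => theta M F (rVal M (i + n) y)) (sCoef_sSq hz)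

lemma thetaX_bijOn (i : ℤ) (a : Fin n → ℤ) :
    Set.BijOn (thetaX M i).hom.lin (((fS k n).obj (rSqX M (i + n))).obj.deg a)
      ((dObj ((alexCom k n).obj (Opposite.op M)) i).obj.deg a) := by
  refine IsSqS.bijOn_of_ind (ObjectProperty.FullSubcategory.property _)
    (ObjectProperty.FullSubcategory.property _) (fun F => ⟨fun m hm =>
      (thetaX M i).hom.map_deg _ m hm, ?_, ?_⟩) a
  · intro x hx y hy hxy
    rw [← sub_eq_zero]
    have hxy' : (thetaX M i).hom.lin (x - y) = 0 := by rw [map_sub, hxy, sub_self]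
    obtain ⟨z, hz, e1⟩ := exists_sSq
      (Submodule.sub_mem _ hx hy)
    rw [e1] at hxy' ⊢
    have h1 := theta_injective (rVal_mem hz)
      ((thetaX_sq hz).symm.trans (congrArg Subtype.val hxy'))
    have h2 := rVal_injective h1
    subst h2
    exact sSq_zero
  · intro y hy
    have hy' : y.1 ∈ dPiece (alexObj M) i (ind F) := hy
    rw [dPiece_pos (ind_nonneg F)] at hy'
    obtain ⟨g, hg, e1⟩ := theta_surjective hy'
    obtain ⟨z, hz, rfl⟩ := exists_rVal hg
    exact ⟨_, sSq_mem hz,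
      Subtype.ext ((thetaX_sq hz).trans e1)⟩

lemma units_smul_lin {M N : SqS k n} (u : ℤˣ) (f : M ⟶ N) (x : M.obj) :
    (u • f).hom.lin x = (u : ℤ) • f.hom.lin x := by
  rcases Int.units_eq_one_or u with rfl | rfl
  · rw [one_smul, Units.val_one, one_smul]
  · rw [Units.neg_smul, one_smul, Units.val_neg, Units.val_one, neg_smul, one_smul]
    rfl

lemma dCom_d (K : (ComB (IsSqS (k := k) (n := n)))ᵒᵖ) (i : ℤ) :
    ((dCom k n).obj K).obj.d i (i + 1) = dD K.unop i := CochainComplex.of_d _ _ _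

/-- The factor `(-1)^n` on the right is part of the differential of the translated complex. -/
lemma thetaX_d (i : ℤ) :
    thetaX M i ≫ ((dCom k n).obj (Opposite.op ((alexCom k n).obj (Opposite.op M)))).obj.d i (i + 1) =
      ((n : ℤ).negOnePow • (fS k n).map (((rSq k n).obj M).obj.d (i + n) (i + 1 + n))) ≫
        thetaX M (i + 1) := by
  rw [dCom_d]
  refine sq_hom_ext fun F m hm => ?_
  obtain ⟨z, hz, rfl⟩ := exists_sSq hm
  refine Subtype.ext ?_
  change dDiff (alexObj M) i ((thetaX M i).hom.lin (sSq F hz)).1 =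
    ((thetaX M (i + 1)).hom.lin (((n : ℤ).negOnePow •
      (fS k n).map (((rSq k n).obj M).obj.d (i + n) (i + 1 + n))).hom.lin (sSq F hz))).1
  rw [units_smul_lin]
  have h1 := thetaX_sq ((((rSq k n).obj M).obj.d (i + n) (i + 1 + n)).hom.map_deg _ _ hz)
  have h2 := fS_map_sSq (((rSq k n).obj M).obj.d (i + n) (i + 1 + n)) hz
  rw [map_zsmul]
  refine (congrArg (dDiff (alexObj M) i) (thetaX_sq hz)).trans ?_
  rw [← theta_d (rVal_mem hz)]
  refine Eq.trans ?_ (congrArg (fun y => (((n : ℤ).negOnePow : ℤ) •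
    ((thetaX M (i + 1)).hom.lin y).1)) h2.symm)
  rw [← rVal_d (by ring : i + n + 1 = i + 1 + n)]
  exact congrArg (((n : ℤ).negOnePow : ℤ) • ·) h1.symm

end

variable (k n) in
/-- The natural transformation `𝒮(ℛ(M))[n] → D(A(M))`. -/
def thetaNat : rSq k n ⋙ fSCom k n ⋙ shiftCom IsSqS n ⟶ (alexCom k n).rightOp ⋙ dCom k n where
  app M := ObjectProperty.homMk
    { f := fun i => thetaX M i
      comm' := fun i j hij => by
        obtain rfl : i + 1 = j := hij
        exact thetaX_d i }
  naturality M N f := ObjectProperty.hom_ext _ (HomologicalComplex.hom_ext _ _ fun i => by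
    refine sq_hom_ext fun F m hm => ?_
    obtain ⟨z, hz, rfl⟩ := exists_sSq hm
    have h1 := fS_map_sSq (((rSq k n).map f).hom.f (i + n)) hz
    refine Subtype.ext (((congrArg (fun y => ((thetaX N i).hom.lin y).1) h1).trans
      (thetaX_sq _)).trans ?_)
    refine Eq.trans ?_ (congrArg (dMap ((alexCom k n).map f.op).hom) (thetaX_sq hz)).symm
    rw [rVal_map, theta_naturality])

lemma thetaNat_qis (M : ComB (IsSqS (k := k) (n := n))) :
    qisB IsSqS ((thetaNat k n).app M) :=
  qis_of_bijOn fun i a => thetaX_bijOn i a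

/-! ### The functor `D` preserves quasi-isomorphisms -/

variable {k : Type u} [Field k] {n : ℕ}

lemma of_le_inverseImage {C D : Type*} [Category C] [Category D] {W : MorphismProperty C}
    {W' : MorphismProperty D} {F : C ⥤ D} (h : W ≤ W'.inverseImage F) {X Y : C} {f : X ⟶ Y}
    (hf : W f) : W' (F.map f) := h f hf

lemma qisB_of_comm_sq {X Y X' Y' : ComB (IsSqS (k := k) (n := n))} {f : X ⟶ Y} {g : X' ⟶ Y'}
    {p : X ⟶ X'} {q : Y ⟶ Y'} (h : f ≫ q = p ≫ g) (hp : qisB IsSqS p) (hq : qisB IsSqS q) :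
    qisB IsSqS f ↔ qisB IsSqS g := by
  refine (qis_iff f.hom).trans (Iff.trans ?_ (qis_iff g.hom).symm)
  refine forall_congr' fun i => forall_congr' fun a => ?_
  have h1 : IsIso ((coh IsSqS i a).map p.hom) := (qis_iff _).mp hp i a
  have h2 : IsIso ((coh IsSqS i a).map q.hom) := (qis_iff _).mp hq i a
  have h3 := congrArg (fun r => (coh IsSqS i a).map r.hom) h
  exact isIso_of_comm_sq (((coh IsSqS i a).map_comp f.hom q.hom).symm.trans
    (h3.trans ((coh IsSqS i a).map_comp p.hom g.hom)))

lemma qisB_of_isIso {X Y : ComB (IsSqS (k := k) (n := n))} (f : X ⟶ Y) [IsIso f] :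
    qisB IsSqS f := by
  refine (qis_iff f.hom).mpr fun i a => ?_
  exact inferInstanceAs (IsIso (((isBounded _).ι ⋙ coh IsSqS i a).map f))

/-- The functors `rSq`, `𝒮` and the translation preserve quasi-isomorphisms, and their composition
is naturally quasi-isomorphic to `D ∘ A`. -/
lemma dCom_alexCom_qis {M N : ComB (IsSqS (k := k) (n := n))} (f : M ⟶ N) (hf : qisB IsSqS f) :
    qisB IsSqS ((dCom k n).map ((alexCom k n).map f.op).op) := by
  have h1 : qisB IsSqE ((rSq k n).map f) := of_le_inverseImage rSq_qis hf
  have h2 : qisB IsSqS ((fSCom k n).map ((rSq k n).map f)) :=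
    of_le_inverseImage (fSCom_qis k n) h1
  have h3 : qisB IsSqS ((shiftCom IsSqS n).map ((fSCom k n).map ((rSq k n).map f))) :=
    of_le_inverseImage (shiftCom_qis IsSqS n) h2
  have h4 : (shiftCom IsSqS n).map ((fSCom k n).map ((rSq k n).map f)) ≫ (thetaNat k n).app N =
      (thetaNat k n).app M ≫ (dCom k n).map ((alexCom k n).map f.op).op :=
    (thetaNat k n).naturality f
  exact (qisB_of_comm_sq h4 (thetaNat_qis M) (thetaNat_qis N)).mp h3

/-- By biduality `D(f)` is isomorphic to `D(A(A(f)))`. As `A(f)` is a quasi-isomorphism, the result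
for `D ∘ A` applies to it. -/
lemma dCom_map_qis {M N : ComB (IsSqS (k := k) (n := n))} (f : M ⟶ N) (hf : qisB IsSqS f) :
    qisB IsSqS ((dCom k n).map f.op) := by
  have h1 : qisB IsSqS ((alexCom k n).map f.op) := of_le_inverseImage (alexCom_qis k n) hf
  have h2 := dCom_alexCom_qis _ h1
  have h3 := congrArg (fun r => (dCom k n).map r) (congrArg Quiver.Hom.op (bidualCom_naturality f))
  simp only [op_comp, Functor.map_comp] at h3
  exact (qisB_of_comm_sq h3.symm (qisB_of_isIso _) (qisB_of_isIso _)).mp h2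

variable (k n) in
lemma dCom_qis : (qisB IsSqS).op ≤ (qisB IsSqS).inverseImage (dCom k n) := fun _ _ f hf =>
  (MorphismProperty.inverseImage_iff _ _ _).mpr (dCom_map_qis f.unop hf)

/-! ### Composition of contravariant functors on localizations -/

section

variable {C₁ C₂ C₃ : Type*} [Category C₁] [Category C₂] [Category C₃] {W₁ : MorphismProperty C₁}
  {W₂ : MorphismProperty C₂} {W₃ : MorphismProperty C₃}

/-- The functor induced by a contravariant functor `F` on localizations is compatible with `F`. -/
def derivedOpFac (F : C₁ᵒᵖ ⥤ C₂) (h : W₁.op ≤ W₂.inverseImage F) :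
    W₁.Q.op ⋙ derivedOp F h ≅ F ⋙ W₂.Q := Localization.fac (F ⋙ W₂.Q) _ W₁.Q.op

/-- The opposite of the functor induced by a contravariant functor `F` on localizations is
compatible with the opposite of `F`. -/
def derivedOpRightOpFac (F : C₁ᵒᵖ ⥤ C₂) (h : W₁.op ≤ W₂.inverseImage F) :
    W₁.Q ⋙ (derivedOp F h).rightOp ≅ F.rightOp ⋙ W₂.Q.op :=
  NatIso.ofComponents (fun X => ((derivedOpFac F h).app (Opposite.op X)).symm.op) fun f =>
    Quiver.Hom.unop_inj ((derivedOpFac F h).inv.naturality f.op).symm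

/-- The composition of two contravariant functors on localizations is compatible with the
composition. -/
def derivedOpCompFac (F : C₁ᵒᵖ ⥤ C₂) (h : W₁.op ≤ W₂.inverseImage F)
    (G : C₂ᵒᵖ ⥤ C₃) (h' : W₂.op ≤ W₃.inverseImage G) :
    W₁.Q ⋙ (derivedOp F h).rightOp ⋙ derivedOp G h' ≅ (F.rightOp ⋙ G) ⋙ W₃.Q :=
  Functor.isoWhiskerRight (derivedOpRightOpFac F h) (derivedOp G h') ≪≫
    Functor.isoWhiskerLeft F.rightOp (derivedOpFac G h')

end

/-! ### The lift of `ℛ` and the isomorphism of derived functors -/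

variable (k n) in
/-- The functor `ℛ` with values in the bounded derived category of squarefree `E`-modules. -/
def rDer : DerB (IsSqS (k := k) (n := n)) ⥤ DerB (IsSqE (k := k) (n := n)) :=
  derived (rSq k n) rSq_qis

variable (k n) in
/-- `rDer` lifts the functor induced by `ℛ`. -/
def rDerIso : rDer k n ⋙ inclDer k n ≅ derived (rCom k n) rCom_qis :=
  isoDer (compFac (derivedFac (rSq k n) rSq_qis) (derivedFac (inclCom k n) (inclCom_qis k n)))
    (derivedFac (rCom k n) rCom_qis) (rSqι k n) rSqι_qis

variable (k n) in
/-- The isomorphism of `T^n ∘ 𝒮 ∘ ℛ` with `D ∘ A` on the derived category. -/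
def rDerDualIso : rDer k n ⋙ derived (fSCom k n) (fSCom_qis k n) ⋙ shiftDer IsSqS n ≅
    (derivedOp (alexCom k n) (alexCom_qis k n)).rightOp ⋙ derivedOp (dCom k n) (dCom_qis k n) :=
  isoDer (compFac (derivedFac (rSq k n) rSq_qis) (compFac (derivedFac (fSCom k n) (fSCom_qis k n))
      (derivedFac (shiftCom IsSqS n) (shiftCom_qis IsSqS n))))
    (derivedOpCompFac (alexCom k n) (alexCom_qis k n) (dCom k n) (dCom_qis k n))
    (thetaNat k n) thetaNat_qis

end SqBGG

end

theorem proposition4p4 (k : Type u) [Field k] (n : ℕ) :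
    ∃ (hA : (qisB IsSqS).op ≤ (qisB IsSqS).inverseImage (alexCom k n))
      (hD : (qisB IsSqS).op ≤ (qisB IsSqS).inverseImage (dCom k n))
      (hS : qisB IsSqE ≤ (qisB IsSqS).inverseImage (fSCom k n))
      (hR : qisB IsSqS ≤ (qis IsFgE).inverseImage (rCom k n)),
      ((inclDer k n).Full ∧ (inclDer k n).Faithful ∧ (inclDer k n).essImage = isDbSqE k n) ∧
      (∀ M : DerB (IsSqS (k := k) (n := n)), isDbSqE k n ((derived (rCom k n) hR).obj M)) ∧
      ∃ R : DerB (IsSqS (k := k) (n := n)) ⥤ DerB (IsSqE (k := k) (n := n)),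
        Nonempty (R ⋙ inclDer k n ≅ derived (rCom k n) hR) ∧
        Nonempty (R ⋙ derived (fSCom k n) hS ⋙ shiftDer IsSqS n ≅
          (derivedOp (alexCom k n) hA).rightOp ⋙ derivedOp (dCom k n) hD) := by
  refine ⟨alexCom_qis k n, dCom_qis k n, fSCom_qis k n, rCom_qis,
    ⟨inferInstance, inferInstance, essImage_inclDer k n⟩, fun M => ?_,
    rDer k n, ⟨rDerIso k n⟩, ⟨rDerDualIso k n⟩⟩
  -- `ℛ(M)` is isomorphic to the image of its squarefree part under the canonical functor, and the
  -- condition on the cohomology is invariant under isomorphism.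
  exact isDbSqE_of_iso ((rDerIso k n).app M) (isDbSqE_inclDer _)
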